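/- **Setting.** Let $n\ge1$ and let $\mathfrak L_j=\{|\zeta-\zeta_j|=r_j\}$, $r_j>0$ ($j=0,\dots,n-1$), be circles with $|\zeta_j-\zeta_k|>r_j+r_k$ for $j\ne k$. Let $\mathfrak D^e$ be their common exterior and $T_j(\zeta)=\zeta_j+r_j^2/(\bar\zeta-\bar\zeta_j)$. Let $\mathfrak G$ be the symmetry Schottky group of all $\sigma=T_{k_1}T_{k_2}\cdots T_{k_{2s}}$, $k_{i+1}\ne k_i$, $s\ge 0$. It contains the identity $\sigma_0$ and $\sigma_j=T_jT_0$; write $\sigma(\zeta)=(\alpha_\sigma\zeta+\beta_\sigma)/(\gamma_\sigma\zeta+\delta_\sigma)$. Suppose that $\mathfrak G$ is of the first class: $$\sum_{\sigma\ne\sigma_0}|\alpha_\sigma\delta_\sigma-\beta_\sigma\gamma_\sigma|\,|\gamma_\sigma|^{-2}<\infty .$$ Let $\mu,\mu_j>0$ be shear moduli of a matrix and of $n$ inclusions, $\kappa_j=\mu_j/\mu\neq1$, and let $\tau=\tau_1+i\tau_2\ne0$, $\tau^\infty=\tau_1^\infty+i\tau_2^\infty$ be the stresses inside the inclusions and at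 infinity. Let $c_{-1}\in\mathbb C\setminus\{0\}$, a finite point $\zeta_*\in\mathfrak D^e$ and $a_0,\tilde d_0\in\mathbb R$ be arbitrary, and put $c=(\bar\tau^\infty-\bar\tau)c_{-1}/\mu$, $\lambda_j=\kappa_j/(1-\kappa_j)$. **Formula.** Put $$\mathcal K(\zeta,\eta)=\sum_{\sigma\in\mathfrak G}\Big(\frac1{\eta-\sigma(\zeta)}-\frac1{\eta-\sigma(\zeta_*)}\Big),\qquad \chi_{\sigma_j}(\eta)=\mathcal K(\sigma_j(\zeta_*),\eta),$$ all circles being described counterclockwise. For $j\ge1$ let $$a_j=a_0+\frac1{2\pi}\,\mathrm{Im}\sum_{l}\int_{\mathfrak L_l}\mathrm{Im}(c\eta)\,\chi_{\sigma_j}(\eta)\,d\eta ,$$ and let $$\Psi_1(\zeta)=\frac1{2\pi}\sum_l\int_{\mathfrak L_l}[\mathrm{Im}(c\eta)-a_l]\,\mathcal K(\zeta,\eta)\,d\eta .$$ For $\xi\in\mathfrak L_j$ put $$F(\xi)=c\xi-i[\mathrm{Im}(c\xi)-a_j]+\Psi_1(\xi)+\overline{\Psi_1(T_0(\xi))},\qquad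 g^\circ_{2j}(\xi)=\mathrm{Re}\Big(\frac{\kappa_j}{\kappa_j-1}F(\xi)+\frac{\bar\tau}{\mu}c_{-1}\xi\Big).$$ For $j\ge 1$ let $$\tilde d_j=\tilde d_0+\frac1{2\pi}\,\mathrm{Im}\sum_l\int_{\mathfrak L_l}g^\circ_{2l}(\eta)\,\chi_{\sigma_j}(\eta)\,d\eta ,$$ let $$\Psi_2(\zeta)=\frac1{2\pi}\sum_l\int_{\mathfrak L_l}[g^\circ_{2l}(\eta)-\tilde d_l]\,\mathcal K(\zeta,\eta)\,d\eta ,$$ and, for $\xi\in\mathfrak L_j$, $$\omega_*(\xi)=c_{-1}\xi-\frac{\mu}{\bar\tau}\Big[g^\circ_{2j}(\xi)-\tilde d_j+i\Psi_2(\xi)+i\,\overline{\Psi_2(T_0(\xi))}\Big].\tag{4.1}$$ Here, for $\xi\in\mathfrak L$, $\Psi_m(\xi)$ and $\Psi_m(T_0(\xi))$ are Cauchy principal values (at $\eta=\xi$). **Schwarz problems.** Find $F,\omega$ analytic in $\mathfrak D^e$ and continuous on its closure, and real $a_j,d_j'$, with $\mathrm{Im}\,F=a_j$ and $\mathrm{Re}[\bar\tau\omega/\mu]=\lambda_j(\mathrm{Re}\,F-d_j')$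 on $\mathfrak L_j$, and $F(\zeta)=c\zeta+O(1)$, $\omega(\zeta)=c_{-1}\zeta+O(1)$ as $\zeta\to\infty$. **Uniformly stressed inclusions.** Disjoint bounded domains $D_j$ with contours $L_j=\partial D_j$ are *uniformly stressed* if, for some real $d_j'$ and $u_j=(\tau_1x_1+\tau_2x_2)/\mu_j+d_j'$, there is a function $\phi$, analytic in the exterior $D^e$ of the inclusions and continuously differentiable up to the contours, such that $u=\mathrm{Re}\,\phi$ satisfies $u=u_j$ and $\mu\,\partial u/\partial\nu=\mu_j\,\partial u_j/\partial\nu$ on $L_j$, and $\phi(z)-\bar\tau^\infty z/\mu$ tends to a constant as $z\to\infty$. **Claim.** 1. The series for $\mathcal K(\zeta,\eta)$ converges absolutely whenever $\eta\in\mathfrak L=\bigcup_l\mathfrak L_l$ and $\zeta$ is the image of a finite point of $\overline{\mathfrak D^e}$ under a composition of the $T_k$ (a term with zero denominator, if there is one, being disregarded), and the principal values exist. 2. There is a solution $(F,\omega)$ of the Schwarz problems, with the constants $a_j$ above and $d_j'=\frac{\kappa_j-1}{\kappa_j}\tilde d_j$, whose boundary values are the $F(\xi)$ above and $\omega_*(\xi)$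 of (4.1). Conversely, for every solution, with any real constants $a_j,d_j'$, the boundary values of $F$ and of $\omega$ differ from these only by additive complex constants. 3. Let $\omega$ be a conformal map of $\mathfrak D^e$ onto the exterior $D^e$ of $n$ disjoint bounded domains $D_j$ that is injective on $\overline{\mathfrak D^e}$, continuously differentiable up to $\mathfrak L$ with nonvanishing derivative, takes $\mathfrak L_j$ onto $\partial D_j$, and satisfies $\omega(\zeta)=c_{-1}\zeta+O(1)$ at infinity. Then the inclusions $D_j$ are uniformly stressed if and only if the boundary values of $\omega$ are given by (4.1) up to a translation: $\omega=\omega_*+\mathrm{const}$ on $\mathfrak L$. (Univalence and non-overlap of the contours are not asserted; they remain restrictions on the parameters.) 4. Let $n\ge2$ and fix $\zeta_0$, $r_0>0$ and $\mathrm{Im}\,\zeta_1$ (for instance $0,1,0$). The remaining free parameters of the family (4.1), namely $r_1,\dots,r_{n-1}$, $\mathrm{Re}\,\zeta_1$, $\zeta_2,\dots,\zeta_{n-1}$, form a real vector space of dimension $3n-4$, and the set of their values for which the circles lie outside one another and $\mathfrak G$ is of the first class has nonempty interior. -/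

import Mathlib

open Filter Topology Bornology
open scoped Real ComplexConjugate

namespace Antiplane

/-! ### Circles, inversions and the symmetry Schottky group -/

/-- Centres `ζ_j` and radii `r_j` of `n` circles `𝔏_0, …, 𝔏_{n-1}`. -/
structure Circles (n : ℕ) where
  center : Fin n → ℂ
  radius : Fin n → ℝ

namespace Circles

variable {n : ℕ}

/-- The circles are genuine and lie outside one another. -/
def Valid (Γ : Circles n) : Prop :=
  (∀ j, 0 < Γ.radius j) ∧
    ∀ j k, j ≠ k → Γ.radius j + Γ.radius k < dist (Γ.center j) (Γ.center k)

/-- The circle `𝔏_j`. -/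
def circle (Γ : Circles n) (j : Fin n) : Set ℂ :=
  Metric.sphere (Γ.center j) (Γ.radius j)

/-- The (finite points of the) exterior `𝔇^e` of the `n` circles. -/
def ext (Γ : Circles n) : Set ℂ :=
  {ζ | ∀ j, Γ.radius j < dist ζ (Γ.center j)}

/-- The symmetry `T_j(ζ) = ζ_j + r_j² / conj (ζ - ζ_j)` with respect to `𝔏_j`. -/
noncomputable def T (Γ : Circles n) (j : Fin n) (ζ : ℂ) : ℂ :=
  Γ.center j + (Γ.radius j : ℂ) ^ 2 / conj (ζ - Γ.center j)

/-- The composition `T_{k_1} T_{k_2} ⋯ T_{k_m}` attached to a list of indices. -/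
noncomputable def comp (Γ : Circles n) (w : List (Fin n)) (ζ : ℂ) : ℂ :=
  w.foldr (fun k z => Γ.T k z) ζ

/-- The matrix `A_j` with `T_j(ζ) = A_j · conj ζ` (as a linear fractional transformation). -/
noncomputable def symMatrix (Γ : Circles n) (j : Fin n) : Matrix (Fin 2) (Fin 2) ℂ :=
  !![Γ.center j, (Γ.radius j : ℂ) ^ 2 - Γ.center j * conj (Γ.center j);
     1, -conj (Γ.center j)]

/-- The matrix of `T_{k_1} ⋯ T_{k_m}`; for even `m` this is the coefficient matrix
`(α_σ, β_σ; γ_σ, δ_σ)` of the linear fractional transformation `σ = T_{k_1} ⋯ T_{k_m}`. -/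
noncomputable def compMatrix (Γ : Circles n) : List (Fin n) → Matrix (Fin 2) (Fin 2) ℂ
  | [] => 1
  | k :: w => Γ.symMatrix k * (Γ.compMatrix w).map (starRingEnd ℂ)

end Circles

/-- The elements of the symmetry Schottky group `𝔊`, listed as the reduced words
`σ = T_{k_1} T_{k_2} ⋯ T_{k_{2s}}`, `k_{i+1} ≠ k_i`, of even length.  For circles lying outside one
another, distinct words are distinct transformations.  The empty word is the identity `σ_0`. -/
def SchottkyWord (n : ℕ) : Type :=
  {w : List (Fin n) // w.IsChain (· ≠ ·) ∧ Even w.length}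

namespace Circles

variable {n : ℕ}

/-- `𝔊` is of the first class: the series `∑ |α_σ δ_σ - β_σ γ_σ| / |γ_σ|²` over `σ ≠ σ_0`
converges. -/
def FirstClass (Γ : Circles n) : Prop :=
  Summable fun w : {w : SchottkyWord n // w.1 ≠ []} =>
    ‖(Γ.compMatrix w.1.1).det‖ / ‖Γ.compMatrix w.1.1 1 0‖ ^ 2

/-- The term of the kernel series that belongs to `σ ∈ 𝔊`. -/
noncomputable def kernelTerm (Γ : Circles n) (ζs ζ η : ℂ) (w : SchottkyWord n) : ℂ :=
  1 / (η - Γ.comp w.1 ζ) - 1 / (η - Γ.comp w.1 ζs)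

/-- The quasiautomorphic analogue `𝒦(ζ, η)` of the Cauchy kernel, with base point `ζs = ζ_*`. -/
noncomputable def kernel (Γ : Circles n) (ζs ζ η : ℂ) : ℂ :=
  ∑' w : SchottkyWord n, Γ.kernelTerm ζs ζ η w

/-- `χ_{σ_j}(η) = 𝒦(σ_j(ζ_*), η)`, where `σ_j = T_j T_0`. -/
noncomputable def chi [NeZero n] (Γ : Circles n) (ζs : ℂ) (j : Fin n) (η : ℂ) : ℂ :=
  Γ.kernel ζs (Γ.T j (Γ.T 0 ζs)) η

/-- `(1 / 2π) ∑_l ∫_{𝔏_l} g_l(η) 𝒦(ζ, η) dη`, with the arc `|η - ξ| ≤ ε` cut out; the circles are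
described counterclockwise. -/
noncomputable def truncPsi (Γ : Circles n) (ζs : ℂ) (g : Fin n → ℂ → ℝ) (ζ ξ : ℂ) (ε : ℝ) : ℂ :=
  1 / (2 * (π : ℂ)) * ∑ l, ∮ η in C(Γ.center l, Γ.radius l),
    {η : ℂ | ε < dist η ξ}.indicator (fun η => (g l η : ℂ) * Γ.kernel ζs ζ η) η

/-- The Cauchy principal value at `η = ξ` of `(1 / 2π) ∑_l ∫_{𝔏_l} g_l(η) 𝒦(ζ, η) dη`. -/
noncomputable def pvPsi (Γ : Circles n) (ζs : ℂ) (g : Fin n → ℂ → ℝ) (ζ ξ : ℂ) : ℂ :=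
  limUnder (𝓝[>] (0 : ℝ)) (Γ.truncPsi ζs g ζ ξ)

end Circles

/-! ### The loading and the uniformly stressed inclusions -/

/-- Shear moduli `μ` of the matrix and `μ_j` of the inclusions, the uniform stress
`τ = τ_1 + i τ_2` inside the inclusions, and the stress `τ^∞ = τ_1^∞ + i τ_2^∞` at infinity. -/
structure Loading (n : ℕ) where
  mu : ℝ
  muIncl : Fin n → ℝ
  tau : ℂ
  tauInf : ℂ

namespace Loading

variable {n : ℕ}

/-- `κ_j = μ_j / μ`. -/
noncomputable def kappa (L : Loading n) (j : Fin n) : ℝ := L.muIncl j / L.mu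

/-- `λ_j = κ_j / (1 - κ_j)`. -/
noncomputable def lam (L : Loading n) (j : Fin n) : ℝ := L.kappa j / (1 - L.kappa j)

/-- `c = (conj τ^∞ - conj τ) c_{-1} / μ`, where `c₁` stands for `c_{-1}`. -/
noncomputable def c (L : Loading n) (c₁ : ℂ) : ℂ :=
  (conj L.tauInf - conj L.tau) / (L.mu : ℂ) * c₁

/-- The displacement `u_j = (τ_1 x_1 + τ_2 x_2) / μ_j + d_j'` of an inclusion in which the stresses
are `τ_{13} = τ_1` and `τ_{23} = τ_2`. -/
noncomputable def inclDisplacement (L : Loading n) (j : Fin n) (d : ℝ) (z : ℂ) : ℝ :=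
  (L.tau.re * z.re + L.tau.im * z.im) / L.muIncl j + d

end Loading

/-- `n` disjoint bounded domains. -/
structure IsInclusionFamily {n : ℕ} (D : Fin n → Set ℂ) : Prop where
  isOpen : ∀ j, IsOpen (D j)
  isConnected : ∀ j, IsConnected (D j)
  isBounded : ∀ j, IsBounded (D j)
  disjoint : ∀ j k, j ≠ k → Disjoint (D j) (D k)

/-- The open region occupied by the matrix, outside the inclusions and their contours. -/
def matrixRegion {n : ℕ} (D : Fin n → Set ℂ) : Set ℂ := (⋃ j, closure (D j))ᶜ

/-- `ν` is a normal vector (of any length) of the contour `S` at `z`: it is the rotation by a right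
angle of the velocity at `z` of a curve in `S`. -/
def IsNormalVector (S : Set ℂ) (z ν : ℂ) : Prop :=
  ∃ (p : ℝ → ℂ) (v : ℂ), (∀ t, p t ∈ S) ∧ p 0 = z ∧ HasDerivAt p v 0 ∧ ν = -Complex.I * v

/-- `φ = u + i v` is the complex potential of an antiplane state of the matrix which is in ideal
contact with the uniformly stressed inclusions `D_j` with displacements
`u_j = (τ_1 x_1 + τ_2 x_2) / μ_j + d_j'`, and which has the stress `τ^∞` at infinity.
Here `φ` is analytic in the matrix and continuously differentiable up to the contours, with
derivative `φ'`, so that the derivative of `u = Re φ` in the direction `ν` is `Re (φ' ν)`. -/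
structure IsAntiplaneState {n : ℕ} (L : Loading n) (D : Fin n → Set ℂ) (d : Fin n → ℝ)
    (φ φ' : ℂ → ℂ) : Prop where
  hasDeriv : ∀ z ∈ closure (matrixRegion D),
    HasDerivWithinAt φ (φ' z) (closure (matrixRegion D)) z
  continuous_deriv : ContinuousOn φ' (closure (matrixRegion D))
  /-- `u = u_j` on the contours -/
  displacement : ∀ j, ∀ z ∈ frontier (D j), (φ z).re = L.inclDisplacement j (d j) z
  /-- `μ ∂u/∂ν = μ_j ∂u_j/∂ν` on the contours -/
  traction : ∀ j, ∀ z ∈ frontier (D j), ∀ ν : ℂ, IsNormalVector (frontier (D j)) z ν →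
    L.mu * (φ' z * ν).re = L.muIncl j * fderiv ℝ (L.inclDisplacement j (d j)) z ν
  /-- `φ ∼ conj τ^∞ z / μ + const` at infinity -/
  infinity : ∃ b : ℂ,
    Tendsto (fun z => φ z - conj L.tauInf / (L.mu : ℂ) * z) (cobounded ℂ) (𝓝 b)

/-- The inclusions `D_j` are uniformly stressed: their stress is `τ` throughout while the body is
in antiplane shear with stress `τ^∞` at infinity. -/
def UniformlyStressed {n : ℕ} (L : Loading n) (D : Fin n → Set ℂ) : Prop :=
  ∃ (d : Fin n → ℝ) (φ φ' : ℂ → ℂ), IsAntiplaneState L D d φ φ'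

/-- `ω` is a conformal map of the exterior of the circles onto the exterior of the inclusions which
takes `𝔏_j` to the contour of `D_j`, is regular up to the contours (continuously differentiable
with nonvanishing derivative), and satisfies `ω(ζ) = c_{-1} ζ + O(1)` at infinity. -/
structure IsConformalMap {n : ℕ} (Γ : Circles n) (D : Fin n → Set ℂ) (c₁ : ℂ) (ω : ℂ → ℂ) :
    Prop where
  injOn : Set.InjOn ω (closure Γ.ext)
  image_ext : ω '' Γ.ext = matrixRegion D
  image_circle : ∀ j, ω '' Γ.circle j = frontier (D j)
  regular : ∃ ω' : ℂ → ℂ, ContinuousOn ω' (closure Γ.ext) ∧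
    ∀ ζ ∈ closure Γ.ext, ω' ζ ≠ 0 ∧ HasDerivWithinAt ω (ω' ζ) (closure Γ.ext) ζ
  infinity : (fun ζ => ω ζ - c₁ * ζ) =O[cobounded ℂ] (fun _ => (1 : ℝ))

/-- The two consecutive Schwarz problems for `F` and `ω` in the exterior of the circles, with the
real constants `a_j` and `d_j'`. -/
structure SolvesSchwarz {n : ℕ} (L : Loading n) (Γ : Circles n) (c₁ : ℂ) (a d : Fin n → ℝ)
    (F ω : ℂ → ℂ) : Prop where
  F_analytic : DifferentiableOn ℂ F Γ.ext
  F_continuous : ContinuousOn F (closure Γ.ext)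
  ω_analytic : DifferentiableOn ℂ ω Γ.ext
  ω_continuous : ContinuousOn ω (closure Γ.ext)
  F_boundary : ∀ j, ∀ ξ ∈ Γ.circle j, (F ξ).im = a j
  ω_boundary : ∀ j, ∀ ξ ∈ Γ.circle j,
    (conj L.tau / (L.mu : ℂ) * ω ξ).re = L.lam j * ((F ξ).re - d j)
  F_infinity : (fun ζ => F ζ - L.c c₁ * ζ) =O[cobounded ℂ] (fun _ => (1 : ℝ))
  ω_infinity : (fun ζ => ω ζ - c₁ * ζ) =O[cobounded ℂ] (fun _ => (1 : ℝ))

/-! ### The series-form solution -/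

/-- The data on which the series-form solution depends: the loading, the circles, the point `ζ_*`,
the coefficient `c_{-1}` (written `c₁`), and the free real constants `a_0` and `d̃_0`. -/
structure Data (n : ℕ) where
  L : Loading n
  Γ : Circles n
  ζs : ℂ
  c₁ : ℂ
  a₀ : ℝ
  d₀ : ℝ

namespace Data

variable {n : ℕ} [NeZero n]

/-- The constants `a_j`. -/
noncomputable def a (P : Data n) (j : Fin n) : ℝ :=
  if j = 0 then P.a₀ else
    P.a₀ + 1 / (2 * π) * (∑ l, ∮ η in C(P.Γ.center l, P.Γ.radius l),
      (((P.L.c P.c₁ * η).im : ℝ) : ℂ) * P.Γ.chi P.ζs j η).im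

/-- The density `Im (c η) - a_l`, `η ∈ 𝔏_l`, of `Ψ₁`. -/
noncomputable def dens₁ (P : Data n) (l : Fin n) (η : ℂ) : ℝ :=
  (P.L.c P.c₁ * η).im - P.a l

/-- `F(ξ) = c ξ - i [Im (c ξ) - a_j] + Ψ₁(ξ) + conj Ψ₁(T_0(ξ))` for `ξ ∈ 𝔏_j`, the integrals being
principal values. -/
noncomputable def F (P : Data n) (j : Fin n) (ξ : ℂ) : ℂ :=
  P.L.c P.c₁ * ξ - Complex.I * (P.dens₁ j ξ : ℂ)
    + P.Γ.pvPsi P.ζs P.dens₁ ξ ξ + conj (P.Γ.pvPsi P.ζs P.dens₁ (P.Γ.T 0 ξ) ξ)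

/-- `g°_{2j}(ξ) = Re (κ_j / (κ_j - 1) F(ξ) + conj τ c_{-1} ξ / μ)` for `ξ ∈ 𝔏_j`. -/
noncomputable def g (P : Data n) (j : Fin n) (ξ : ℂ) : ℝ :=
  (((P.L.kappa j / (P.L.kappa j - 1) : ℝ) : ℂ) * P.F j ξ
    + conj P.L.tau / (P.L.mu : ℂ) * P.c₁ * ξ).re

/-- The constants `d̃_j`. -/
noncomputable def d (P : Data n) (j : Fin n) : ℝ :=
  if j = 0 then P.d₀ else
    P.d₀ + 1 / (2 * π) * (∑ l, ∮ η in C(P.Γ.center l, P.Γ.radius l),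
      (P.g l η : ℂ) * P.Γ.chi P.ζs j η).im

/-- The density `g°_{2l}(η) - d̃_l`, `η ∈ 𝔏_l`, of `Ψ₂`. -/
noncomputable def dens₂ (P : Data n) (l : Fin n) (η : ℂ) : ℝ :=
  P.g l η - P.d l

/-- The closed form of the boundary values of the conformal map: for `ξ ∈ 𝔏_j`,
`c_{-1} ξ - (μ / conj τ) [g°_{2j}(ξ) - d̃_j + i Ψ₂(ξ) + i conj Ψ₂(T_0(ξ))]`,
the integrals being principal values. -/
noncomputable def ω (P : Data n) (j : Fin n) (ξ : ℂ) : ℂ :=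
  P.c₁ * ξ - (P.L.mu : ℂ) / conj P.L.tau *
    ((P.dens₂ j ξ : ℂ) + Complex.I * P.Γ.pvPsi P.ζs P.dens₂ ξ ξ
      + Complex.I * conj (P.Γ.pvPsi P.ζs P.dens₂ (P.Γ.T 0 ξ) ξ))

end Data

/-! ### The free parameters -/

/-- The free parameters: the radii `r_1, …, r_{n-1}`, the abscissa of `ζ_1`, and the complex centres
`ζ_2, …, ζ_{n-1}`. -/
abbrev FreeParams (n : ℕ) : Type := (Fin (n - 1) → ℝ) × ℝ × (Fin (n - 2) → ℂ)

/-- The circles with given free parameters, when `ζ_0 = z₀`, `r_0 = r₀` and `Im ζ_1 = y₁` are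
fixed. -/
noncomputable def circlesOf {n : ℕ} (z₀ : ℂ) (r₀ y₁ : ℝ) (p : FreeParams n) : Circles n where
  center j :=
    if j.1 = 0 then z₀ else
      if _h : 2 ≤ j.1 then p.2.2 ⟨j.1 - 2, by have := j.2; omega⟩ else ⟨p.2.1, y₁⟩
  radius j :=
    if _h : 1 ≤ j.1 then p.1 ⟨j.1 - 1, by have := j.2; omega⟩ else r₀

end Antiplane

/-! The circles are separated with a margin: for some t < 1 the discs do not overlap even after all
radii are divided by t (`Sep`). Hence a reduced word T_{k_1}⋯T_{k_m}, m ≥ 2, sends the closed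
exterior, and even the larger region `hood`, into the disc of radius t·r_{k_1} about the first
centre, and the images of any two points differ by at most a constant times the word's term `isoRad`
of the first-class series. So ∑_σ |σ(ζ) − σ(ζ_*)| converges for every ζ in the orbit of the closed
exterior (`Sep.summable_orbit`), only finitely many images of ζ lie on the circles, and the kernel
may be integrated term by term: Ψ(ζ) = ∑_σ (V(σζ) − V(σζ_*)), where V is the Cauchy potential of the
density (`potential`).

For ζ near the circles only the identity term of Ψ(ζ) is singular, and in Ψ(T_0ζ) only the n terms
with σT_0 = T_k. The Plemelj jumps for Lipschitz densities, obtained by subtracting the density at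
the nearest point of the circle (`cauchyReg`), show that S = Ψ + conj(Ψ∘T_0) (`schwarz`) is analytic
in the exterior, bounded, and continuous up to the circles, with values −i g_j plus the two
principal values on 𝔏_j. Reindexing by σ ↦ σσ_j shows that Ψ(ξ) − Ψ(T_0ξ) is a constant on 𝔏_j,
namely (1/2π) ∑_l ∮ g χ_{σ_j} (`Sep.pvPsi_sub_pvPsi_T`). Since ∮_{𝔏_l} χ_{σ_j} = 2πi(δ_{lj} −
δ_{l0}) (`Sep.circleIntegral_chi`), the constants a_j and d̃_j are exactly the corrections of the
densities that make this constant real. Then Im S = −g_j on 𝔏_j, and both Schwarz problems are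
solved: by cζ + S for the first density and by c_{-1}ζ − (μ/conj τ) i S for the second.

On each circle Im(cη) − a_l agrees with a rational function of η, so F continues analytically across
the circles (`Sep.exists_schwarz_extension`). This makes the second density Lipschitz, and later
makes the physical potential continuously differentiable up to the contours.

Uniqueness: a nonconstant difference of two solutions, bounded at infinity and with constant
imaginary part on each circle, would map the exterior onto a bounded open set whose frontier lies on
finitely many horizontal lines, which is impossible (`Sep.eq_const_of_im_const`). The substitution F
= φ∘ω − conj(τ)ω/μ turns the contact conditions on the contours into the two Schwarz conditions, so
the characterization of uniformly stressed inclusions follows from existence, uniqueness and the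
continuation of F. Finally, n t² < 1 forces the first-class series to be dominated by a geometric
one, which yields an open set of admissible parameters. -/

namespace Antiplane

/-! ### Separation of the circles and contraction by reduced words -/

namespace Circles

variable {n : ℕ}

/-- The circles are separated with ratio `t < 1`: they stay outside one another when all radii are
divided by `t`. -/
structure Sep (Γ : Circles n) (t : ℝ) : Prop where
  pos : 0 < t
  lt_one : t < 1
  radius_pos : ∀ j, 0 < Γ.radius j
  sep : ∀ j k, j ≠ k → Γ.radius j + Γ.radius k ≤ t * dist (Γ.center j) (Γ.center k)

theorem Valid.exists_sep {Γ : Circles n} (h : Γ.Valid) : ∃ t, Γ.Sep t := by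
  have h1 : ∀ᶠ t : ℝ in 𝓝[<] 1, ∀ j k, j ≠ k →
      Γ.radius j + Γ.radius k ≤ t * dist (Γ.center j) (Γ.center k) := by
    simp only [eventually_all]
    intro j k hjk
    have h2 : Tendsto (fun t : ℝ => t * dist (Γ.center j) (Γ.center k)) (𝓝[<] 1)
        (𝓝 (1 * dist (Γ.center j) (Γ.center k))) :=
      ((continuous_id.mul continuous_const).tendsto _).mono_left nhdsWithin_le_nhds
    rw [one_mul] at h2
    exact (h2.eventually (lt_mem_nhds (h.2 j k hjk))).mono fun t ht => ht.le
  have h3 : ∀ᶠ t : ℝ in 𝓝[<] 1, 0 < t ∧ t < 1 := by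
    filter_upwards [self_mem_nhdsWithin, mem_nhdsWithin_of_mem_nhds (lt_mem_nhds one_pos)]
      with t h4 h5 using ⟨h5, h4⟩
  obtain ⟨t, h4, h5⟩ := (h1.and h3).exists
  exact ⟨t, h5.1, h5.2, h.1, h4⟩

theorem Sep.mono {Γ : Circles n} {s t : ℝ} (h : Γ.Sep s) (hst : s ≤ t) (ht : t < 1) : Γ.Sep t :=
  ⟨h.pos.trans_le hst, ht, h.radius_pos, fun j k hjk =>
    (h.sep j k hjk).trans (mul_le_mul_of_nonneg_right hst dist_nonneg)⟩

/-- Homogeneous coordinates of the image of `(u.1 : u.2)` under `T_{k_1} ⋯ T_{k_m}`. -/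
noncomputable def numDen (Γ : Circles n) : List (Fin n) → ℂ × ℂ → ℂ × ℂ
  | [], u => u
  | k :: w, u =>
    (Γ.center k * conj ((Γ.numDen w u).1 - Γ.center k * (Γ.numDen w u).2)
        + (Γ.radius k : ℂ) ^ 2 * conj (Γ.numDen w u).2,
      conj ((Γ.numDen w u).1 - Γ.center k * (Γ.numDen w u).2))

@[simp] theorem numDen_nil (Γ : Circles n) (u : ℂ × ℂ) : Γ.numDen [] u = u := rfl

theorem numDen_cons_snd (Γ : Circles n) (k : Fin n) (w : List (Fin n)) (u : ℂ × ℂ) :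
    (Γ.numDen (k :: w) u).2 = conj ((Γ.numDen w u).1 - Γ.center k * (Γ.numDen w u).2) := rfl

theorem numDen_cons_fst (Γ : Circles n) (k : Fin n) (w : List (Fin n)) (u : ℂ × ℂ) :
    (Γ.numDen (k :: w) u).1 - Γ.center k * (Γ.numDen (k :: w) u).2
      = (Γ.radius k : ℂ) ^ 2 * conj (Γ.numDen w u).2 := by
  simp only [numDen]; ring

/-- The product of the squared radii along a word. -/
noncomputable def radProd (Γ : Circles n) (w : List (Fin n)) : ℝ :=
  (w.map fun k => Γ.radius k ^ 2).prod

/-- The wedge of two coordinate pairs is a 2×2 determinant. Each inversion conjugates it and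
multiplies it by −r_k², so only the product of the squared radii survives in the norm. -/
theorem norm_numDen_wedge (Γ : Circles n) (w : List (Fin n)) (u v : ℂ × ℂ) :
    ‖(Γ.numDen w u).1 * (Γ.numDen w v).2 - (Γ.numDen w v).1 * (Γ.numDen w u).2‖
      = Γ.radProd w * ‖u.1 * v.2 - v.1 * u.2‖ := by
  induction w with
  | nil => simp [radProd]
  | cons k w ih =>
    have : (Γ.numDen (k :: w) u).1 * (Γ.numDen (k :: w) v).2
        - (Γ.numDen (k :: w) v).1 * (Γ.numDen (k :: w) u).2
        = -((Γ.radius k : ℂ) ^ 2) * conj ((Γ.numDen w u).1 * (Γ.numDen w v).2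
          - (Γ.numDen w v).1 * (Γ.numDen w u).2) := by
      simp only [numDen, map_sub, map_mul]; ring
    rw [this, norm_mul, RCLike.norm_conj, ih, norm_neg, norm_pow, Complex.norm_real,
      Real.norm_eq_abs, sq_abs]
    simp [radProd, mul_assoc]

/-- `z` or its conjugate, according to the parity. -/
noncomputable def conjPow (m : ℕ) (z : ℂ) : ℂ := if Even m then z else conj z

theorem conj_conjPow (m : ℕ) (z : ℂ) : conj (conjPow m z) = conjPow (m + 1) z := by
  unfold conjPow
  by_cases h : Even m
  · simp [h, Nat.even_add_one]
  · simp [h, Nat.even_add_one]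

theorem norm_conjPow (m : ℕ) (z : ℂ) : ‖conjPow m z‖ = ‖z‖ := by
  unfold conjPow; split_ifs <;> simp

theorem conjPow_conjPow (m : ℕ) (z : ℂ) : conjPow m (conjPow m z) = z := by
  unfold conjPow; split_ifs <;> simp

theorem conjPow_sub (m : ℕ) (z w : ℂ) : conjPow m (z - w) = conjPow m z - conjPow m w := by
  unfold conjPow; split_ifs <;> simp

/-- The coordinates are linear in (z, 1) for even words and conjugate-linear for odd ones, so the
images of ∞ = (1 : 0) and of 0 = (0 : 1) are the columns of coefficients. -/
theorem numDen_point (Γ : Circles n) (w : List (Fin n)) (z : ℂ) :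
    (Γ.numDen w (z, 1)).1 = conjPow w.length z * (Γ.numDen w (1, 0)).1 + (Γ.numDen w (0, 1)).1 ∧
    (Γ.numDen w (z, 1)).2 = conjPow w.length z * (Γ.numDen w (1, 0)).2 + (Γ.numDen w (0, 1)).2 := by
  induction w with
  | nil => simp [conjPow]
  | cons k w ih =>
    simp only [numDen, ih.1, ih.2, List.length_cons, ← conj_conjPow, map_sub, map_mul, map_add]
    constructor <;> ring

theorem compMatrix_col (Γ : Circles n) (w : List (Fin n)) :
    Γ.compMatrix w 0 0 = (Γ.numDen w (1, 0)).1 ∧ Γ.compMatrix w 1 0 = (Γ.numDen w (1, 0)).2 := by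
  induction w with
  | nil => simp [compMatrix]
  | cons k w ih =>
    simp only [compMatrix, symMatrix, Matrix.mul_apply, Fin.sum_univ_two, Matrix.map_apply, ih.1,
      ih.2, numDen]
    constructor <;> simp <;> ring

theorem norm_det_compMatrix (Γ : Circles n) (w : List (Fin n)) :
    ‖(Γ.compMatrix w).det‖ = Γ.radProd w := by
  induction w with
  | nil => simp [compMatrix, radProd]
  | cons k w ih =>
    have h1 : (Γ.symMatrix k).det = -((Γ.radius k : ℂ) ^ 2) := by
      rw [symMatrix, Matrix.det_fin_two_of]; ring
    have h2 : ((Γ.compMatrix w).map (starRingEnd ℂ)).det = conj (Γ.compMatrix w).det := by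
      rw [RingHom.map_det]; rfl
    rw [compMatrix, Matrix.det_mul, h1, h2, norm_mul, RCLike.norm_conj, ih, norm_neg, norm_pow,
      Complex.norm_real, Real.norm_eq_abs, sq_abs]
    simp [radProd]

theorem radProd_nonneg (Γ : Circles n) (w : List (Fin n)) : 0 ≤ Γ.radProd w := by
  rw [← norm_det_compMatrix]; exact norm_nonneg _

/-- The squared radius of the isometric circle of `T_{k_1} ⋯ T_{k_m}`. -/
noncomputable def isoRad (Γ : Circles n) (w : List (Fin n)) : ℝ :=
  Γ.radProd w / ‖(Γ.numDen w (1, 0)).2‖ ^ 2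

theorem isoRad_nonneg (Γ : Circles n) (w : List (Fin n)) : 0 ≤ Γ.isoRad w :=
  div_nonneg (Γ.radProd_nonneg w) (sq_nonneg _)

@[simp] theorem isoRad_nil (Γ : Circles n) : Γ.isoRad [] = 0 := by simp [isoRad]

/-- Away from the last disc (up to the factor `t`), homogeneous coordinates propagate into the
first disc. -/
theorem Sep.numDen_mem {Γ : Circles n} {t : ℝ} (h : Γ.Sep t) (u : ℂ × ℂ) (w : List (Fin n)) :
    ∀ k, (k :: w).IsChain (· ≠ ·) →
      (∀ m ∈ (k :: w).getLast?, t * Γ.radius m * ‖u.2‖ ≤ ‖u.1 - Γ.center m * u.2‖ ∧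
        u.1 - Γ.center m * u.2 ≠ 0) →
      (Γ.numDen (k :: w) u).2 ≠ 0 ∧
      ‖(Γ.numDen (k :: w) u).1 - Γ.center k * (Γ.numDen (k :: w) u).2‖
        ≤ Γ.radius k / t * ‖(Γ.numDen (k :: w) u).2‖ ∧
      (w ≠ [] → ‖(Γ.numDen (k :: w) u).1 - Γ.center k * (Γ.numDen (k :: w) u).2‖
        ≤ t * Γ.radius k * ‖(Γ.numDen (k :: w) u).2‖ ∧
        Γ.radius k / t * ‖(Γ.numDen w u).2‖ ≤ ‖(Γ.numDen (k :: w) u).2‖) := by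
  have ht := h.pos
  induction w with
  | nil =>
    intro k _ hu
    obtain ⟨h1, h2⟩ := hu k (by simp)
    refine ⟨by rw [numDen_cons_snd]; exact (map_ne_zero _).2 h2, ?_, by simp⟩
    rw [numDen_cons_fst, numDen_cons_snd, norm_mul, RCLike.norm_conj, RCLike.norm_conj, norm_pow,
      Complex.norm_real, Real.norm_eq_abs, sq_abs, numDen_nil, div_mul_eq_mul_div, le_div_iff₀ ht]
    nlinarith [h.radius_pos k]
  | cons j w ih =>
    intro k hk hu
    rw [List.isChain_cons_cons] at hk
    obtain ⟨h1, h2, -⟩ := ih j hk.2 (by simpa using hu)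
    have hr := h.radius_pos k
    have hd := h.sep k j hk.1
    set v := Γ.numDen (j :: w) u with hv
    have hvp : 0 < ‖v.2‖ := norm_pos_iff.2 h1
    -- The point v is within r_j/t of the centre of j, so by separation it is at least r_k/t from
    -- the centre of k. The inversion T_k then brings it within r_k²/(r_k/t) = t·r_k of that centre.
    have h3 : Γ.radius k / t * ‖v.2‖ ≤ ‖v.1 - Γ.center k * v.2‖ := by
      have h4 : dist (Γ.center k) (Γ.center j) * ‖v.2‖
          ≤ ‖v.1 - Γ.center k * v.2‖ + ‖v.1 - Γ.center j * v.2‖ := by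
        rw [dist_eq_norm, ← norm_mul]
        calc _ = ‖-(v.1 - Γ.center k * v.2) + (v.1 - Γ.center j * v.2)‖ := by
              congr 1; ring
          _ ≤ _ := (norm_add_le _ _).trans (by rw [norm_neg])
      have h5 : (Γ.radius k + Γ.radius j) / t ≤ dist (Γ.center k) (Γ.center j) := by
        rw [div_le_iff₀ ht]; linarith
      have h6 := mul_le_mul_of_nonneg_right h5 hvp.le
      rw [add_div, add_mul] at h6
      linarith
    have h4 : ‖(Γ.numDen (k :: j :: w) u).2‖ = ‖v.1 - Γ.center k * v.2‖ := by
      rw [numDen_cons_snd, RCLike.norm_conj]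
    have h5 : ‖(Γ.numDen (k :: j :: w) u).1 - Γ.center k * (Γ.numDen (k :: j :: w) u).2‖
        = Γ.radius k ^ 2 * ‖v.2‖ := by
      rw [numDen_cons_fst, norm_mul, RCLike.norm_conj, norm_pow, Complex.norm_real,
        Real.norm_eq_abs, sq_abs]
    have h6 : Γ.radius k ^ 2 * ‖v.2‖ ≤ t * Γ.radius k * ‖v.1 - Γ.center k * v.2‖ := by
      rw [div_mul_eq_mul_div, div_le_iff₀ ht] at h3
      nlinarith
    have hpos : 0 < ‖v.1 - Γ.center k * v.2‖ := lt_of_lt_of_le (by positivity) h3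
    rw [h5, h4]
    refine ⟨fun h0 => ?_, ?_, fun _ => ⟨h6, h3⟩⟩
    · rw [h0, norm_zero] at h4; exact hpos.ne h4
    · refine h6.trans (mul_le_mul_of_nonneg_right ?_ hpos.le)
      rw [le_div_iff₀ ht]
      nlinarith [h.lt_one, mul_pos hr ht]

/-- Points at infinity are admissible starting points. -/
theorem Sep.numDen_infty {Γ : Circles n} {t : ℝ} (h : Γ.Sep t) {k : Fin n} {w : List (Fin n)}
    (hw : (k :: w).IsChain (· ≠ ·)) :
    (Γ.numDen (k :: w) (1, 0)).2 ≠ 0 ∧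
      (w ≠ [] → Γ.radius k / t * ‖(Γ.numDen w (1, 0)).2‖ ≤ ‖(Γ.numDen (k :: w) (1, 0)).2‖) := by
  obtain ⟨h1, -, h2⟩ := h.numDen_mem (1, 0) w k hw (by simp)
  exact ⟨h1, fun hw => (h2 hw).2⟩

/-- A new first letter multiplies the numerator by r_k² and the denominator |γ|² by at least
(r_k/t)². -/
theorem Sep.isoRad_cons_le {Γ : Circles n} {t : ℝ} (h : Γ.Sep t) {k : Fin n} {w : List (Fin n)}
    (hw : (k :: w).IsChain (· ≠ ·)) (hne : w ≠ []) : Γ.isoRad (k :: w) ≤ t ^ 2 * Γ.isoRad w := by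
  obtain ⟨h1, h2⟩ := h.numDen_infty hw
  have h3 := h2 hne
  have hr := h.radius_pos k
  have ht := h.pos
  obtain ⟨j, w, rfl⟩ := List.exists_cons_of_ne_nil hne
  have h4 : 0 < ‖(Γ.numDen (j :: w) (1, 0)).2‖ :=
    norm_pos_iff.2 (h.numDen_infty (List.isChain_cons_cons.1 hw).2).1
  have h5 : 0 < ‖(Γ.numDen (k :: j :: w) (1, 0)).2‖ := norm_pos_iff.2 h1
  have h6 : Γ.radProd (k :: j :: w) = Γ.radius k ^ 2 * Γ.radProd (j :: w) := by simp [radProd]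
  rw [isoRad, isoRad, h6, div_le_iff₀ (by positivity)]
  have h7 := pow_le_pow_left₀ (by positivity) h3 2
  have h8 : Γ.radius k ^ 2 * Γ.radProd (j :: w)
      = t ^ 2 * (Γ.radProd (j :: w) / ‖(Γ.numDen (j :: w) (1, 0)).2‖ ^ 2)
        * (Γ.radius k / t * ‖(Γ.numDen (j :: w) (1, 0)).2‖) ^ 2 := by
    field_simp
  rw [h8]
  exact mul_le_mul_of_nonneg_left h7
    (mul_nonneg (by positivity) (div_nonneg (radProd_nonneg _ _) (by positivity)))

theorem isoRad_singleton (Γ : Circles n) (k : Fin n) : Γ.isoRad [k] = Γ.radius k ^ 2 := by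
  simp [isoRad, radProd, numDen]

theorem Sep.isoRad_le_pow {Γ : Circles n} {t C : ℝ} (h : Γ.Sep t)
    (hC : ∀ k, Γ.radius k ^ 2 ≤ C) (w : List (Fin n)) :
    ∀ k, (k :: w).IsChain (· ≠ ·) → Γ.isoRad (k :: w) ≤ C * (t ^ 2) ^ w.length := by
  induction w with
  | nil => intro k _; simpa [isoRad_singleton] using hC k
  | cons j w ih =>
    intro k hk
    refine (h.isoRad_cons_le hk (by simp)).trans ?_
    have := mul_le_mul_of_nonneg_left (ih j (List.isChain_cons_cons.1 hk).2) (sq_nonneg t)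
    calc _ ≤ _ := this
      _ = _ := by rw [List.length_cons]; ring

/-! ### Compositions as fractions -/

@[simp] theorem comp_nil (Γ : Circles n) (z : ℂ) : Γ.comp [] z = z := rfl

@[simp] theorem comp_cons (Γ : Circles n) (k : Fin n) (w : List (Fin n)) (z : ℂ) :
    Γ.comp (k :: w) z = Γ.T k (Γ.comp w z) := rfl

theorem comp_append (Γ : Circles n) (v w : List (Fin n)) (z : ℂ) :
    Γ.comp (v ++ w) z = Γ.comp v (Γ.comp w z) := by
  simp [comp, List.foldr_append]

/-- `z` lies at distance at least `t` radii from the centre of the last letter of `w`. -/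
def AwayLast (Γ : Circles n) (t : ℝ) (w : List (Fin n)) (z : ℂ) : Prop :=
  ∀ m ∈ w.getLast?, t * Γ.radius m ≤ dist z (Γ.center m)

theorem Sep.awayLast_numDen {Γ : Circles n} {t : ℝ} (h : Γ.Sep t) {w : List (Fin n)} {z : ℂ}
    (hz : Γ.AwayLast t w z) :
    ∀ m ∈ w.getLast?, t * Γ.radius m * ‖((z, 1) : ℂ × ℂ).2‖
      ≤ ‖((z, 1) : ℂ × ℂ).1 - Γ.center m * ((z, 1) : ℂ × ℂ).2‖ ∧
        ((z, 1) : ℂ × ℂ).1 - Γ.center m * ((z, 1) : ℂ × ℂ).2 ≠ 0 := by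
  intro m hm
  have h1 := hz m hm
  rw [dist_eq_norm] at h1
  have h2 : 0 < ‖z - Γ.center m‖ := lt_of_lt_of_le (mul_pos h.pos (h.radius_pos m)) h1
  simpa using ⟨h1, norm_pos_iff.1 h2⟩

theorem AwayLast.of_cons_cons {Γ : Circles n} {t : ℝ} {j k : Fin n} {w : List (Fin n)} {z : ℂ}
    (h : Γ.AwayLast t (k :: j :: w) z) : Γ.AwayLast t (j :: w) z := by
  simpa [AwayLast] using h

theorem Sep.den_ne_zero {Γ : Circles n} {t : ℝ} (h : Γ.Sep t) {w : List (Fin n)} {z : ℂ}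
    (hw : w.IsChain (· ≠ ·)) (hz : Γ.AwayLast t w z) : (Γ.numDen w (z, 1)).2 ≠ 0 := by
  cases w with
  | nil => simp
  | cons k w => exact (h.numDen_mem _ _ _ hw (h.awayLast_numDen hz)).1

theorem Sep.comp_eq {Γ : Circles n} {t : ℝ} (h : Γ.Sep t) (w : List (Fin n)) {z : ℂ}
    (hw : w.IsChain (· ≠ ·)) (hz : Γ.AwayLast t w z) :
    Γ.comp w z = (Γ.numDen w (z, 1)).1 / (Γ.numDen w (z, 1)).2 := by
  induction w with
  | nil => simp
  | cons k w ih =>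
    have hw' : w.IsChain (· ≠ ·) := hw.tail
    have hz' : Γ.AwayLast t w z := by
      cases w with
      | nil => simp [AwayLast]
      | cons j w => exact hz.of_cons_cons
    have h1 := h.den_ne_zero hw' hz'
    have h2 := h.den_ne_zero hw hz
    rw [comp_cons, ih hw' hz', T]
    have h3 := numDen_cons_fst Γ k w (z, 1)
    have h4 := numDen_cons_snd Γ k w (z, 1)
    set D := (Γ.numDen (k :: w) (z, 1)).2
    set N := (Γ.numDen (k :: w) (z, 1)).1
    have h5 : conj ((Γ.numDen w (z, 1)).1 / (Γ.numDen w (z, 1)).2 - Γ.center k)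
        = D / conj (Γ.numDen w (z, 1)).2 := by
      rw [h4, ← map_div₀]; congr 1; field_simp
    have h6 : conj (Γ.numDen w (z, 1)).2 ≠ 0 := by simpa using h1
    rw [h5]
    field_simp
    linear_combination -h3

/-- The image of a point away from the last disc lies in the first disc (up to the factor `t`). -/
theorem Sep.dist_comp_le {Γ : Circles n} {t : ℝ} (h : Γ.Sep t) {k : Fin n} {w : List (Fin n)}
    {z : ℂ} (hw : (k :: w).IsChain (· ≠ ·)) (hz : Γ.AwayLast t (k :: w) z) :
    dist (Γ.comp (k :: w) z) (Γ.center k) ≤ Γ.radius k / t ∧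
      (w ≠ [] → dist (Γ.comp (k :: w) z) (Γ.center k) ≤ t * Γ.radius k) := by
  obtain ⟨h1, h2, h3⟩ := h.numDen_mem _ _ _ hw (h.awayLast_numDen hz)
  have h4 : dist (Γ.comp (k :: w) z) (Γ.center k) = ‖(Γ.numDen (k :: w) (z, 1)).1
      - Γ.center k * (Γ.numDen (k :: w) (z, 1)).2‖ / ‖(Γ.numDen (k :: w) (z, 1)).2‖ := by
    rw [h.comp_eq _ hw hz, dist_eq_norm, ← norm_div]; congr 1; field_simp
  have h5 : 0 < ‖(Γ.numDen (k :: w) (z, 1)).2‖ := norm_pos_iff.2 h1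
  rw [h4, div_le_iff₀ h5, div_le_iff₀ h5]
  exact ⟨h2, fun hw => (h3 hw).1⟩

/-- The point that `T_{k_1} ⋯ T_{k_m}` sends to infinity. -/
noncomputable def pole (Γ : Circles n) (w : List (Fin n)) : ℂ :=
  conjPow w.length (-(Γ.numDen w (0, 1)).2 / (Γ.numDen w (1, 0)).2)

theorem Sep.den_eq {Γ : Circles n} {t : ℝ} (h : Γ.Sep t) {w : List (Fin n)}
    (hw : w.IsChain (· ≠ ·)) (hne : w ≠ []) (z : ℂ) :
    (Γ.numDen w (z, 1)).2 = (Γ.numDen w (1, 0)).2 * conjPow w.length (z - Γ.pole w) := by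
  obtain ⟨k, w, rfl⟩ := List.exists_cons_of_ne_nil hne
  have h1 := (h.numDen_infty hw).1
  rw [(numDen_point Γ (k :: w) z).2, conjPow_sub, pole, conjPow_conjPow]
  field_simp
  ring

/-- Were the pole far from the last centre, it would be an admissible starting point with
nonvanishing denominator, whereas the denominator vanishes exactly there. -/
theorem Sep.dist_pole_lt {Γ : Circles n} {t : ℝ} (h : Γ.Sep t) {w : List (Fin n)}
    (hw : w.IsChain (· ≠ ·)) {m : Fin n} (hm : m ∈ w.getLast?) :
    dist (Γ.pole w) (Γ.center m) < t * Γ.radius m := by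
  by_contra! h1
  have h2 : Γ.AwayLast t w (Γ.pole w) := by
    intro m' hm'
    obtain rfl : m' = m := by
      rw [Option.mem_def] at hm hm'; rw [hm] at hm'; exact (Option.some.inj hm').symm
    exact h1
  have hne : w ≠ [] := by rintro rfl; simp at hm
  refine h.den_ne_zero hw h2 ?_
  rw [h.den_eq hw hne]
  simp [conjPow]

/-- The usual formula |σz − σz'| = |det| |z − z'| / (|γz + δ| |γz' + δ|), with the denominators
factored through the pole. -/
theorem Sep.dist_comp_comp {Γ : Circles n} {t : ℝ} (h : Γ.Sep t) {w : List (Fin n)}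
    (hw : w.IsChain (· ≠ ·)) (hne : w ≠ []) {z z' : ℂ} (hz : Γ.AwayLast t w z)
    (hz' : Γ.AwayLast t w z') :
    dist (Γ.comp w z) (Γ.comp w z')
      = Γ.isoRad w * (dist z z' / (dist z (Γ.pole w) * dist z' (Γ.pole w))) := by
  have h1 := h.den_ne_zero hw hz
  have h2 := h.den_ne_zero hw hz'
  have h3 := norm_numDen_wedge Γ w (z, 1) (z', 1)
  rw [h.comp_eq _ hw hz, h.comp_eq _ hw hz', dist_eq_norm, div_sub_div _ _ h1 h2, norm_div,
    mul_comm (Γ.numDen w (z, 1)).2 (Γ.numDen w (z', 1)).1, h3, norm_mul, h.den_eq hw hne,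
    h.den_eq hw hne, norm_mul, norm_mul, norm_conjPow, norm_conjPow, isoRad, dist_eq_norm,
    dist_eq_norm, dist_eq_norm]
  simp only [mul_one]
  field_simp

/-- The pole lies in the disc shrunk by s and the points lie outside the one shrunk by t, so both
distances to the pole are at least δ. Bounding |z − z'| by their sum leaves 1/|z − p| + 1/|z' − p| ≤
2/δ, uniformly on an unbounded region. -/
theorem Sep.dist_comp_comp_le {Γ : Circles n} {s t δ : ℝ} (h : Γ.Sep s) (hst : s < t)
    (hδ : 0 < δ) (hr : ∀ k, δ ≤ (t - s) * Γ.radius k) {w : List (Fin n)}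
    (hw : w.IsChain (· ≠ ·)) {z z' : ℂ} (hne : w ≠ []) (hz : Γ.AwayLast t w z)
    (hz' : Γ.AwayLast t w z') :
    dist (Γ.comp w z) (Γ.comp w z') ≤ 2 / δ * Γ.isoRad w := by
  have key : ∀ y, Γ.AwayLast t w y → δ ≤ dist y (Γ.pole w) ∧ Γ.AwayLast s w y := by
    intro y hy
    refine ⟨?_, fun m hm => (mul_le_mul_of_nonneg_right hst.le (h.radius_pos m).le).trans (hy m hm)⟩
    obtain ⟨m, hm⟩ : ∃ m, m ∈ w.getLast? := by
      cases hw' : w.getLast? with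
      | none => exact absurd (List.getLast?_eq_none_iff.1 hw') hne
      | some m => exact ⟨m, rfl⟩
    have h1 := h.dist_pole_lt hw hm
    have h2 := hy m hm
    have h3 := dist_triangle y (Γ.pole w) (Γ.center m)
    have h4 := hr m
    nlinarith
  obtain ⟨h1, h2⟩ := key z hz
  obtain ⟨h3, h4⟩ := key z' hz'
  rw [h.dist_comp_comp hw hne h2 h4, mul_comm]
  refine mul_le_mul_of_nonneg_right ?_ (Γ.isoRad_nonneg w)
  have h5 := dist_triangle_right z z' (Γ.pole w)
  have h6 : 0 < dist z (Γ.pole w) := hδ.trans_le h1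
  have h7 : 0 < dist z' (Γ.pole w) := hδ.trans_le h3
  rw [div_le_div_iff₀ (by positivity) hδ]
  nlinarith [mul_le_mul_of_nonneg_left h1 h7.le, mul_le_mul_of_nonneg_left h3 h6.le]

/-! ### Summability over all reduced words -/

/-- Reduced words of either parity. -/
abbrev RedWord (n : ℕ) : Type := {w : List (Fin n) // w.IsChain (· ≠ ·)}

theorem FirstClass.summable_isoRad_even {Γ : Circles n} (h : Γ.FirstClass) :
    Summable fun w : SchottkyWord n => Γ.isoRad w.1 := by
  have h1 : (fun w : {w : SchottkyWord n // w.1 ≠ []} =>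
      ‖(Γ.compMatrix w.1.1).det‖ / ‖Γ.compMatrix w.1.1 1 0‖ ^ 2)
      = (fun w : SchottkyWord n => Γ.isoRad w.1) ∘ (Subtype.val) := by
    funext w
    simp [isoRad, norm_det_compMatrix, (compMatrix_col Γ w.1.1).2]
  unfold FirstClass at h
  rw [h1] at h
  refine (Function.Injective.summable_iff Subtype.val_injective ?_).1 h
  intro w hw
  have : w.1 = [] := by
    by_contra h0
    exact hw ⟨⟨w, h0⟩, rfl⟩
  simp [this]

/-- The first-class condition speaks of even words only. An odd word is a letter followed by an even
word: `Sep.isoRad_cons_le` bounds its term by that of the even part, except for the finitely many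
single letters, since `isoRad []` is 0. -/
theorem Sep.summable_isoRad {Γ : Circles n} {t : ℝ} (h : Γ.Sep t) (hf : Γ.FirstClass) :
    Summable fun w : RedWord n => Γ.isoRad w.1 := by
  have h0 := hf.summable_isoRad_even
  have h1 : Summable fun p : Fin n × SchottkyWord n =>
      (if p.2.1 = [] then Γ.radius p.1 ^ 2 else 0) + Γ.isoRad p.2.1 := by
    refine Summable.add ?_ ?_
    · refine summable_of_hasFiniteSupport ?_
      refine (Set.finite_range fun k : Fin n => (k, (⟨[], by simp⟩ : SchottkyWord n))).subset ?_
      rintro ⟨k, w⟩ hw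
      refine ⟨k, ?_⟩
      have hw' : w.1 = [] := by
        by_contra h0
        exact hw (if_neg h0)
      exact Prod.ext rfl (Subtype.ext hw'.symm)
    · exact (summable_prod_of_nonneg (f := fun p : Fin n × SchottkyWord n => Γ.isoRad p.2.1)
        (fun p => Γ.isoRad_nonneg p.2.1)).2 ⟨fun _ => h0, Summable.of_finite⟩
  have h2 : Summable fun w : {w : RedWord n | Even w.1.length} => Γ.isoRad w.1.1 :=
    h0.comp_injective (i := fun w : {w : RedWord n | Even w.1.length} =>
      (⟨w.1.1, w.1.2, w.2⟩ : SchottkyWord n)) fun a b hab =>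
        Subtype.ext (Subtype.ext (congrArg (fun w : SchottkyWord n => w.1) hab))
  have h3 : Summable fun w : ({w : RedWord n | Even w.1.length}ᶜ : Set (RedWord n)) =>
      Γ.isoRad w.1.1 := by
    have hodd : ∀ w : ({w : RedWord n | Even w.1.length}ᶜ : Set (RedWord n)),
        ∃ p : Fin n × SchottkyWord n, p.1 :: p.2.1 = w.1.1 := by
      rintro ⟨⟨w, hw⟩, hw'⟩
      cases w with
      | nil => simp at hw'
      | cons k w =>
        refine ⟨(k, ⟨w, hw.tail, ?_⟩), rfl⟩
        simpa [Nat.even_add_one] using hw'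
    choose f hf using hodd
    have hinj : Function.Injective f := by
      intro a b hab
      apply Subtype.ext; apply Subtype.ext
      rw [← hf a, ← hf b, hab]
    refine Summable.of_nonneg_of_le (fun _ => Γ.isoRad_nonneg _) ?_ (h1.comp_injective hinj)
    intro w
    have hch : (((f w).1 :: (f w).2.1)).IsChain (· ≠ ·) := by rw [hf w]; exact w.1.2
    simp only [Function.comp]
    rw [← hf w]
    split_ifs with h4
    · simp [h4, isoRad_singleton]
    · refine (h.isoRad_cons_le hch h4).trans ?_
      have h5 := Γ.isoRad_nonneg (f w).2.1
      have h6 : t ^ 2 ≤ 1 := by nlinarith [h.pos, h.lt_one]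
      nlinarith
  exact (summable_subtype_and_compl).1 ⟨h2, h3⟩

end Circles

end Antiplane

namespace Antiplane

theorem exists_pos_le_of_finite {ι : Type*} [Finite ι] (f : ι → ℝ) (hf : ∀ i, 0 < f i) :
    ∃ δ > 0, ∀ i, δ ≤ f i := by
  cases isEmpty_or_nonempty ι with
  | inl h => exact ⟨1, one_pos, fun i => isEmptyElim i⟩
  | inr h =>
    obtain ⟨i, hi⟩ := Finite.exists_min f
    exact ⟨f i, hf i, hi⟩

namespace Circles

variable {n : ℕ}

/-! ### Inversions -/

theorem dist_T (Γ : Circles n) (k : Fin n) (z : ℂ) :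
    dist (Γ.T k z) (Γ.center k) = Γ.radius k ^ 2 / dist z (Γ.center k) := by
  rw [T, dist_eq_norm, add_sub_cancel_left, norm_div, RCLike.norm_conj, norm_pow,
    Complex.norm_real, Real.norm_eq_abs, sq_abs, dist_eq_norm]

theorem Sep.T_ne_center {Γ : Circles n} {t : ℝ} (h : Γ.Sep t) {k : Fin n} {z : ℂ}
    (hz : z ≠ Γ.center k) : Γ.T k z ≠ Γ.center k := by
  rw [← dist_pos, dist_T]
  exact div_pos (pow_pos (h.radius_pos k) 2) (dist_pos.2 hz)

theorem Sep.T_T {Γ : Circles n} {t : ℝ} (h : Γ.Sep t) {k : Fin n} {z : ℂ}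
    (hz : z ≠ Γ.center k) : Γ.T k (Γ.T k z) = z := by
  have h1 : conj (z - Γ.center k) ≠ 0 := (map_ne_zero _).2 (sub_ne_zero.2 hz)
  have h2 : (Γ.radius k : ℂ) ≠ 0 := by exact_mod_cast (h.radius_pos k).ne'
  have h3 : z - Γ.center k ≠ 0 := sub_ne_zero.2 hz
  simp only [T, add_sub_cancel_left, map_div₀, map_pow, Complex.conj_ofReal, Complex.conj_conj]
  field_simp
  ring

theorem Sep.T_of_mem_circle {Γ : Circles n} {t : ℝ} (h : Γ.Sep t) {k : Fin n} {z : ℂ}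
    (hz : z ∈ Γ.circle k) : Γ.T k z = z := by
  have h1 : dist z (Γ.center k) = Γ.radius k := hz
  have h0 : z - Γ.center k ≠ 0 := by
    rw [← norm_pos_iff, ← dist_eq_norm, h1]; exact h.radius_pos k
  have h2 : (Γ.radius k : ℂ) ^ 2 = (z - Γ.center k) * conj (z - Γ.center k) := by
    rw [Complex.mul_conj', ← dist_eq_norm, h1]
  have h3 : conj (z - Γ.center k) ≠ 0 := (map_ne_zero _).2 h0
  rw [T, h2, mul_div_cancel_right₀ _ h3, add_sub_cancel]

/-- The union of the circles. -/
def contour (Γ : Circles n) : Set ℂ := ⋃ l, Γ.circle l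

theorem mem_contour {Γ : Circles n} {z : ℂ} : z ∈ Γ.contour ↔ ∃ l, z ∈ Γ.circle l := by
  simp [contour]

theorem isCompact_contour (Γ : Circles n) : IsCompact Γ.contour :=
  isCompact_iUnion fun _ => isCompact_sphere _ _

/-- Depth inside one disc bounds the distance to all the circles at once, because the other circles
lie outside this disc. -/
theorem Sep.le_dist_contour {Γ : Circles n} {t ρ : ℝ} (h : Γ.Sep t) {k : Fin n} {y : ℂ}
    (hy : dist y (Γ.center k) ≤ ρ) {η : ℂ} (hη : η ∈ Γ.contour) : Γ.radius k - ρ ≤ dist y η := by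
  obtain ⟨l, hl⟩ := mem_contour.1 hη
  have hl : dist η (Γ.center l) = Γ.radius l := hl
  by_cases hkl : k = l
  · subst hkl
    have := dist_triangle_left η (Γ.center k) y
    linarith
  · have h1 := h.sep k l hkl
    have h2 : t * dist (Γ.center k) (Γ.center l) ≤ dist (Γ.center k) (Γ.center l) := by
      nlinarith [h.lt_one, @dist_nonneg _ _ (Γ.center k) (Γ.center l)]
    have h3 := dist_triangle4 (Γ.center k) y η (Γ.center l)
    rw [dist_comm (Γ.center k) y] at h3
    linarith

theorem isOpen_ext (Γ : Circles n) : IsOpen Γ.ext := by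
  simp only [ext, Set.ofPred_forall]
  exact isOpen_iInter_of_finite fun j => isOpen_lt continuous_const (by fun_prop)

/-- The discs with radii divided by t still do not overlap. -/
theorem Sep.lt_dist_of_ne {Γ : Circles n} {t : ℝ} (h : Γ.Sep t) {j k : Fin n} (hjk : j ≠ k)
    {z : ℂ} (hz : dist z (Γ.center j) ≤ Γ.radius j / t) :
    Γ.radius k / t ≤ dist z (Γ.center k) := by
  have h1 := h.sep j k hjk
  have h2 : (Γ.radius j + Γ.radius k) / t ≤ dist (Γ.center j) (Γ.center k) := by
    rw [div_le_iff₀ h.pos]; linarith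
  rw [add_div] at h2
  have h3 := dist_triangle_left (Γ.center j) (Γ.center k) z
  linarith

theorem Sep.radius_lt_div {Γ : Circles n} {t : ℝ} (h : Γ.Sep t) (k : Fin n) :
    Γ.radius k < Γ.radius k / t := by
  rw [lt_div_iff₀ h.pos]; nlinarith [h.radius_pos k, h.lt_one]

theorem Sep.mem_closure_ext {Γ : Circles n} {t : ℝ} (h : Γ.Sep t) {z : ℂ} :
    z ∈ closure Γ.ext ↔ ∀ j, Γ.radius j ≤ dist z (Γ.center j) := by
  constructor
  · intro hz j
    have h1 : Γ.ext ⊆ {z | Γ.radius j ≤ dist z (Γ.center j)} := fun z hz => (hz j).le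
    exact closure_minimal h1 (isClosed_le continuous_const (by fun_prop)) hz
  · intro hz
    by_cases hall : z ∈ Γ.ext
    · exact subset_closure hall
    obtain ⟨j, hj⟩ : ∃ j, dist z (Γ.center j) ≤ Γ.radius j := by
      by_contra! h0; exact hall h0
    have hj' : dist z (Γ.center j) = Γ.radius j := le_antisymm hj (hz j)
    have h1 : Tendsto (fun s : ℝ => Γ.center j + (1 + s) * (z - Γ.center j)) (𝓝[>] 0) (𝓝 z) := by
      have : Tendsto (fun s : ℝ => Γ.center j + (1 + (s : ℂ)) * (z - Γ.center j)) (𝓝 0)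
          (𝓝 (Γ.center j + (1 + ((0 : ℝ) : ℂ)) * (z - Γ.center j))) :=
        Continuous.tendsto (by fun_prop) 0
      simp only [Complex.ofReal_zero, add_zero, one_mul, add_sub_cancel] at this
      exact this.mono_left nhdsWithin_le_nhds
    refine mem_closure_of_tendsto h1 ?_
    have h2 : ∀ᶠ y in 𝓝 z, ∀ k, k ≠ j → Γ.radius k < dist y (Γ.center k) := by
      rw [eventually_all]
      intro k
      by_cases hk : k = j
      · simp [hk]
      have h3 : Γ.radius k < dist z (Γ.center k) :=
        (h.radius_lt_div k).trans_le
          (h.lt_dist_of_ne (Ne.symm hk) (hj.trans (h.radius_lt_div j).le))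
      exact ((continuous_id.dist continuous_const).continuousAt.eventually
        (lt_mem_nhds h3)).mono fun y hy _ => hy
    filter_upwards [h1.eventually h2, self_mem_nhdsWithin] with s hs hs0 k
    by_cases hk : k = j
    · subst hk
      have h4 : dist (Γ.center k + (1 + (s : ℂ)) * (z - Γ.center k)) (Γ.center k)
          = (1 + s) * Γ.radius k := by
        rw [dist_eq_norm, add_sub_cancel_left, norm_mul, ← dist_eq_norm, hj']
        congr 1
        rw [← Complex.ofReal_one, ← Complex.ofReal_add, Complex.norm_real, Real.norm_eq_abs,
          abs_of_pos]
        have : (0 : ℝ) < s := hs0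
        linarith
      rw [h4]
      have : (0 : ℝ) < s := hs0
      nlinarith [h.radius_pos k]
    · exact hs k hk

theorem circle_subset_closure_ext {Γ : Circles n} {t : ℝ} (h : Γ.Sep t) (j : Fin n) :
    Γ.circle j ⊆ closure Γ.ext := by
  intro z hz
  have hz : dist z (Γ.center j) = Γ.radius j := hz
  rw [h.mem_closure_ext]
  intro k
  by_cases hk : k = j
  · subst hk; exact hz.ge
  · exact ((h.radius_lt_div k).trans_le (h.lt_dist_of_ne (Ne.symm hk)
      (hz.le.trans (h.radius_lt_div j).le))).le

theorem Sep.closure_ext_eq {Γ : Circles n} {t : ℝ} (h : Γ.Sep t) :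
    closure Γ.ext = Γ.ext ∪ Γ.contour := by
  ext z
  constructor
  · intro hz
    rw [h.mem_closure_ext] at hz
    by_cases hall : z ∈ Γ.ext
    · exact Or.inl hall
    · obtain ⟨j, hj⟩ : ∃ j, dist z (Γ.center j) ≤ Γ.radius j := by
        by_contra! h0; exact hall h0
      exact Or.inr (mem_contour.2 ⟨j, le_antisymm hj (hz j)⟩)
  · rintro (hz | hz)
    · exact subset_closure hz
    · obtain ⟨j, hj⟩ := mem_contour.1 hz
      exact circle_subset_closure_ext h j hj

/-! ### Reduced words -/

/-- Right multiplication of a reduced word by a letter, followed by reduction. -/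
def rmul (k : Fin n) (w : RedWord n) : RedWord n :=
  if h : w.1.getLast? = some k then ⟨w.1.dropLast, w.2.dropLast⟩
  else ⟨w.1 ++ [k], w.2.append (List.isChain_singleton k) (by
    intro x hx y hy
    simp only [List.head?_cons, Option.mem_def, Option.some.injEq] at hy
    rintro rfl
    exact h (hy ▸ hx))⟩

theorem rmul_of_last {k : Fin n} {w : RedWord n} (h : w.1.getLast? = some k) :
    w.1 = (rmul k w).1 ++ [k] ∧ (rmul k w).1.getLast? ≠ some k := by
  have h1 : (rmul k w).1 = w.1.dropLast := by rw [rmul, dif_pos h]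
  have h2 : w.1 = w.1.dropLast ++ [k] := by
    have hne : w.1 ≠ [] := by rintro h0; simp [h0] at h
    rw [List.getLast?_eq_some_getLast hne, Option.some.injEq] at h
    conv_lhs => rw [← List.dropLast_append_getLast hne, h]
  refine ⟨by rw [h1]; exact h2, ?_⟩
  rw [h1]
  intro h3
  have h4 := w.2
  rw [h2, List.isChain_append] at h4
  exact h4.2.2 k h3 k (by simp) rfl

theorem rmul_of_not_last {k : Fin n} {w : RedWord n} (h : w.1.getLast? ≠ some k) :
    (rmul k w).1 = w.1 ++ [k] := by rw [rmul, dif_neg h]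

theorem rmul_rmul (k : Fin n) (w : RedWord n) : rmul k (rmul k w) = w := by
  apply Subtype.ext
  by_cases h : w.1.getLast? = some k
  · obtain ⟨h1, h2⟩ := rmul_of_last h
    rw [rmul_of_not_last h2, ← h1]
  · have h1 := rmul_of_not_last h
    have h2 : (rmul k w).1.getLast? = some k := by rw [h1]; simp
    have h3 := (rmul_of_last h2).1
    rw [h1] at h3
    exact (List.append_cancel_right h3).symm

/-- Right multiplication by a letter as a permutation of the reduced words. -/
def rmulEquiv (k : Fin n) : RedWord n ≃ RedWord n :=
  Function.Involutive.toPerm (rmul k) (rmul_rmul k)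

@[simp] theorem rmulEquiv_apply (k : Fin n) (w : RedWord n) : rmulEquiv k w = rmul k w := rfl

theorem length_rmul (k : Fin n) (w : RedWord n) :
    (rmul k w).1.length = w.1.length + 1 ∨ (rmul k w).1.length + 1 = w.1.length := by
  by_cases h : w.1.getLast? = some k
  · right
    conv_rhs => rw [(rmul_of_last h).1]
    simp
  · left
    rw [rmul_of_not_last h]; simp

theorem even_length_rmul (k : Fin n) (w : RedWord n) :
    Even (rmul k w).1.length ↔ ¬ Even w.1.length := by
  rcases length_rmul k w with h | h
  · rw [h, Nat.even_add_one]
  · rw [← h, Nat.even_add_one, not_not]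

/-- T_k is an involution off its centre, so cancelling a final letter k agrees with composing with
T_k on the right. Thus the words form the free product of n groups of order two, acting on points.
-/
theorem Sep.comp_rmul {Γ : Circles n} {t : ℝ} (h : Γ.Sep t) {k : Fin n} (w : RedWord n) {z : ℂ}
    (hz : z ≠ Γ.center k) : Γ.comp (rmul k w).1 z = Γ.comp w.1 (Γ.T k z) := by
  by_cases hw : w.1.getLast? = some k
  · conv_rhs => rw [(rmul_of_last hw).1]
    rw [comp_append, comp_cons, comp_nil, h.T_T hz]
  · rw [rmul_of_not_last hw, comp_append, comp_cons, comp_nil]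

theorem head?_rmul {k : Fin n} {w : RedWord n} (h1 : w.1 ≠ []) (h2 : w.1 ≠ [k]) :
    (rmul k w).1.head? = w.1.head? := by
  by_cases h : w.1.getLast? = some k
  · have h3 := (rmul_of_last h).1
    have h4 : (rmul k w).1 ≠ [] := by
      intro h0; rw [h0] at h3; exact h2 h3
    conv_rhs => rw [h3]
    rw [List.head?_append_of_ne_nil _ h4]
  · rw [rmul_of_not_last h, List.head?_append_of_ne_nil _ h1]

/-! ### The orbit of a point of the closed exterior -/

theorem Sep.awayLast {Γ : Circles n} {t : ℝ} (h : Γ.Sep t) {z : ℂ} (hz : z ∈ closure Γ.ext)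
    (w : List (Fin n)) : Γ.AwayLast t w z := by
  intro m _
  have h1 := (h.mem_closure_ext.1 hz) m
  nlinarith [h.radius_pos m, h.lt_one]

/-- At its own centre T_k would take a spurious value because of division by zero. Orbits of the
closed exterior never meet a centre, so along them T_k is an honest involution. -/
theorem Sep.comp_red_ne_center {Γ : Circles n} {t : ℝ} (h : Γ.Sep t) {z : ℂ}
    (hz : z ∈ closure Γ.ext) (w : List (Fin n)) (hw : w.IsChain (· ≠ ·)) (k : Fin n) :
    Γ.comp w z ≠ Γ.center k := by
  induction w generalizing k with
  | nil =>
    rw [comp_nil, ← dist_pos]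
    exact (h.radius_pos k).trans_le (h.mem_closure_ext.1 hz k)
  | cons j w ih =>
    by_cases hjk : j = k
    · subst hjk; exact h.T_ne_center (ih hw.tail j)
    · have h1 := (h.dist_comp_le hw (h.awayLast hz _)).1
      rw [← dist_pos]
      exact (div_pos (h.radius_pos k) h.pos).trans_le (h.lt_dist_of_ne hjk h1)

theorem Sep.exists_red {Γ : Circles n} {t : ℝ} (h : Γ.Sep t) {z : ℂ}
    (hz : z ∈ closure Γ.ext) (v : List (Fin n)) :
    ∃ w : RedWord n, Γ.comp v z = Γ.comp w.1 z := by
  induction v with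
  | nil => exact ⟨⟨[], List.isChain_nil⟩, rfl⟩
  | cons k v ih =>
    obtain ⟨⟨w, hw⟩, hvw⟩ := ih
    simp only at hvw
    rw [comp_cons, hvw]
    cases w with
    | nil => exact ⟨⟨[k], List.isChain_singleton k⟩, rfl⟩
    | cons j w =>
      by_cases hkj : k = j
      · subst hkj
        refine ⟨⟨w, hw.tail⟩, ?_⟩
        rw [comp_cons, h.T_T (h.comp_red_ne_center hz w hw.tail k)]
      · exact ⟨⟨k :: j :: w, List.isChain_cons_cons.2 ⟨hkj, hw⟩⟩, rfl⟩

theorem Sep.comp_ne_center {Γ : Circles n} {t : ℝ} (h : Γ.Sep t) {z : ℂ}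
    (hz : z ∈ closure Γ.ext) (v : List (Fin n)) (k : Fin n) : Γ.comp v z ≠ Γ.center k := by
  obtain ⟨w, hw⟩ := h.exists_red hz v
  rw [hw]; exact h.comp_red_ne_center hz w.1 w.2 k

/-- The open region where the circles have been shrunk by the factor `t`. -/
def hood (Γ : Circles n) (t : ℝ) : Set ℂ := {z | ∀ k, t * Γ.radius k < dist z (Γ.center k)}

theorem isOpen_hood (Γ : Circles n) (t : ℝ) : IsOpen (Γ.hood t) := by
  simp only [hood, Set.ofPred_forall]
  exact isOpen_iInter_of_finite fun j => isOpen_lt continuous_const (by fun_prop)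

theorem Sep.closure_ext_subset_hood {Γ : Circles n} {t : ℝ} (h : Γ.Sep t) :
    closure Γ.ext ⊆ Γ.hood t := fun z hz k => by
  have h1 := (h.mem_closure_ext.1 hz) k
  nlinarith [h.radius_pos k, h.lt_one]

theorem awayLast_of_mem_hood {Γ : Circles n} {t : ℝ} {z : ℂ} (hz : z ∈ Γ.hood t)
    (w : List (Fin n)) : Γ.AwayLast t w z := fun m _ => (hz m).le

/-- On the neighbourhood `hood` of the closed exterior, words contract at the rate `isoRad`. -/
theorem Sep.exists_contraction {Γ : Circles n} {s t : ℝ} (h : Γ.Sep s) (hst : s < t) :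
    ∃ C > 0, ∀ w : List (Fin n), w.IsChain (· ≠ ·) → w ≠ [] → ∀ z z', Γ.AwayLast t w z →
      Γ.AwayLast t w z' → dist (Γ.comp w z) (Γ.comp w z') ≤ C * Γ.isoRad w := by
  obtain ⟨δ, hδ, hr⟩ := exists_pos_le_of_finite (fun k => (t - s) * Γ.radius k)
    fun k => mul_pos (sub_pos.2 hst) (h.radius_pos k)
  exact ⟨2 / δ, by positivity, fun w hw hne z z' hz hz' =>
    h.dist_comp_comp_le hst hδ hr hw hne hz hz'⟩

/-- Two separation ratios are kept throughout: the gap t − s is what bounds poles away from the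
points considered. -/
theorem Sep.exists_mid {Γ : Circles n} {s : ℝ} (h : Γ.Sep s) : ∃ t, s < t ∧ Γ.Sep t := by
  obtain ⟨t, h1, h2⟩ := exists_between h.lt_one
  exact ⟨t, h1, h.mono h1.le h2⟩

/-- For a word not ending in k the point T_k z is still away from the last disc, so contraction
applies. For a word ending in k, right multiplication by k merely interchanges the two points
(`hinv`) and removes the final k. -/
theorem Sep.summable_T {Γ : Circles n} {s : ℝ} (h : Γ.Sep s) (hf : Γ.FirstClass) {z : ℂ}
    (hz : z ∈ closure Γ.ext) (k : Fin n) :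
    Summable fun w : RedWord n => dist (Γ.comp w.1 (Γ.T k z)) (Γ.comp w.1 z) := by
  obtain ⟨t, hst, ht⟩ := h.exists_mid
  obtain ⟨C, hC, hb⟩ := h.exists_contraction hst
  have hne : z ≠ Γ.center k := h.comp_ne_center hz [] k
  set f : RedWord n → ℝ := fun w => dist (Γ.comp w.1 (Γ.T k z)) (Γ.comp w.1 z) with hfdef
  let b : RedWord n → ℝ := fun w => C * Γ.isoRad w.1 + if w.1 = [] then dist (Γ.T k z) z else 0
  have hb0 : ∀ w, 0 ≤ b w := fun w => by
    refine add_nonneg (mul_nonneg hC.le (Γ.isoRad_nonneg _)) ?_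
    split_ifs <;> positivity
  have hbs : Summable b := by
    refine ((h.summable_isoRad hf).mul_left C).add (summable_of_hasFiniteSupport ?_)
    refine (Set.finite_singleton (⟨[], List.isChain_nil⟩ : RedWord n)).subset ?_
    intro w hw
    by_contra h0
    exact hw (if_neg fun h1 => h0 (Subtype.ext h1))
  have hlast : ∀ w : RedWord n, w.1.getLast? ≠ some k → f w ≤ b w := by
    intro w hw
    by_cases h0 : w.1 = []
    · simp [hfdef, b, h0]
    · simp only [hfdef, b, h0, if_false, add_zero]
      refine hb w.1 w.2 h0 _ _ (fun m hm => ?_) (ht.awayLast hz _)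
      have hmk : k ≠ m := by rintro rfl; exact hw hm
      have h1 : dist (Γ.T k z) (Γ.center k) ≤ Γ.radius k / t := by
        simpa using (ht.dist_comp_le (List.isChain_singleton k) (ht.awayLast hz [k])).1
      refine le_trans ?_ (ht.lt_dist_of_ne hmk h1)
      exact le_trans (by nlinarith [ht.radius_pos m, ht.lt_one]) (ht.radius_lt_div m).le
  have hinv : ∀ w, f (rmul k w) = f w := by
    intro w
    simp only [hfdef]
    rw [h.comp_rmul w (h.T_ne_center hne), h.comp_rmul w hne, h.T_T hne, dist_comm]
  refine Summable.of_nonneg_of_le (fun _ => dist_nonneg) (fun w => ?_)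
    (hbs.add ((rmulEquiv k).summable_iff.2 hbs))
  by_cases hw : w.1.getLast? = some k
  · have h1 := hlast _ (rmul_of_last hw).2
    rw [hinv] at h1
    exact h1.trans (le_add_of_nonneg_left (hb0 w))
  · exact (hlast w hw).trans (le_add_of_nonneg_right (hb0 _))

/-- Induction on v, which need not be reduced: right multiplication by k moves the first letter of v
into the word, and the triangle inequality costs one series of the form `Sep.summable_T`. -/
theorem Sep.summable_orbit {Γ : Circles n} {s : ℝ} (h : Γ.Sep s) (hf : Γ.FirstClass) {z z' : ℂ}
    (hz : z ∈ closure Γ.ext) (hz' : z' ∈ closure Γ.ext) (v : List (Fin n)) :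
    Summable fun w : RedWord n => dist (Γ.comp w.1 (Γ.comp v z)) (Γ.comp w.1 z') := by
  induction v with
  | nil =>
    obtain ⟨t, hst, ht⟩ := h.exists_mid
    obtain ⟨C, hC, hb⟩ := h.exists_contraction hst
    refine Summable.of_norm_bounded_eventually ((h.summable_isoRad hf).mul_left C) ?_
    have hfin : {(⟨[], List.isChain_nil⟩ : RedWord n)}ᶜ ∈ (cofinite : Filter (RedWord n)) :=
      (Set.finite_singleton _).compl_mem_cofinite
    filter_upwards [hfin] with w hw
    rw [Real.norm_of_nonneg dist_nonneg]
    exact hb w.1 w.2 (fun h0 => hw (Subtype.ext h0)) _ _ (ht.awayLast hz _) (ht.awayLast hz' _)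
  | cons k v ih =>
    have hne := h.comp_ne_center hz v k
    have hne' : z' ≠ Γ.center k := h.comp_ne_center hz' [] k
    refine Summable.of_nonneg_of_le (fun _ => dist_nonneg) (fun w => ?_)
      (((rmulEquiv k).summable_iff.2 ih).add (h.summable_T hf hz' k))
    have h1 : dist (Γ.comp (rmul k w).1 (Γ.comp v z)) (Γ.comp (rmul k w).1 z')
        = dist (Γ.comp w.1 (Γ.T k (Γ.comp v z))) (Γ.comp w.1 (Γ.T k z')) := by
      rw [h.comp_rmul w hne, h.comp_rmul w hne']
    simp only [Function.comp, rmulEquiv_apply]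
    rw [h1]
    exact dist_triangle _ _ _

/-- A Schottky word as a reduced word. -/
def _root_.Antiplane.SchottkyWord.toRed (w : SchottkyWord n) : RedWord n := ⟨w.1, w.2.1⟩

theorem _root_.Antiplane.SchottkyWord.toRed_injective :
    Function.Injective (SchottkyWord.toRed : SchottkyWord n → RedWord n) := fun _ _ h =>
  Subtype.ext (congrArg (fun w : RedWord n => w.1) h)

/-- Three cases: the point itself is strictly outside all circles, its n reflections are strictly
inside their discs, and all longer words land in discs of radius t·r_k. -/
theorem Sep.exists_le_dist_orbit {Γ : Circles n} {t : ℝ} (h : Γ.Sep t) {z : ℂ}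
    (hz : z ∈ Γ.ext) :
    ∃ δ > 0, ∀ w : RedWord n, ∀ η ∈ Γ.contour, δ ≤ dist (Γ.comp w.1 z) η := by
  have hz' := subset_closure hz
  obtain ⟨δ₁, hδ₁, h1⟩ := exists_pos_le_of_finite (fun k => dist z (Γ.center k) - Γ.radius k)
    fun k => sub_pos.2 (hz k)
  obtain ⟨δ₂, hδ₂, h2⟩ := exists_pos_le_of_finite
    (fun k => Γ.radius k - Γ.radius k ^ 2 / dist z (Γ.center k)) fun k => by
      have h3 := h.radius_pos k
      have h4 := hz k
      rw [sub_pos, div_lt_iff₀ (h3.trans h4)]; nlinarith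
  obtain ⟨δ₃, hδ₃, h3⟩ := exists_pos_le_of_finite (fun k => Γ.radius k - t * Γ.radius k)
    fun k => by nlinarith [h.radius_pos k, h.lt_one]
  refine ⟨min δ₁ (min δ₂ δ₃), by positivity, ?_⟩
  rintro ⟨w, hw⟩ η hη
  match w, hw with
  | [], _ =>
    refine (min_le_left _ _).trans ?_
    obtain ⟨l, hl⟩ := mem_contour.1 hη
    have hl : dist η (Γ.center l) = Γ.radius l := hl
    have h4 := h1 l
    have h5 := dist_triangle z η (Γ.center l)
    simp only [comp_nil]
    linarith
  | [k], _ =>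
    refine ((min_le_right _ _).trans (min_le_left _ _)).trans ((h2 k).trans ?_)
    exact h.le_dist_contour (by simp [dist_T]) hη
  | k :: j :: w, hw =>
    refine ((min_le_right _ _).trans (min_le_right _ _)).trans ((h3 k).trans ?_)
    exact h.le_dist_contour ((h.dist_comp_le hw (h.awayLast hz' _)).2 (by simp)) hη

/-! ### Convergence of the kernel -/

theorem norm_kernelTerm_le (Γ : Circles n) {ζs z η : ℂ} {w : SchottkyWord n} {δ ε : ℝ}
    (hδ : 0 < δ) (hε : 0 < ε) (h1 : δ ≤ dist (Γ.comp w.1 z) η)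
    (h2 : ε ≤ dist (Γ.comp w.1 ζs) η) :
    ‖Γ.kernelTerm ζs z η w‖ ≤ dist (Γ.comp w.1 z) (Γ.comp w.1 ζs) / (δ * ε) := by
  have h3 : η - Γ.comp w.1 z ≠ 0 := by
    rw [← norm_pos_iff, ← dist_eq_norm, dist_comm]; linarith
  have h4 : η - Γ.comp w.1 ζs ≠ 0 := by
    rw [← norm_pos_iff, ← dist_eq_norm, dist_comm]; linarith
  rw [kernelTerm, div_sub_div _ _ h3 h4, norm_div, norm_mul]
  have h5 : ‖1 * (η - Γ.comp w.1 ζs) - (η - Γ.comp w.1 z) * 1‖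
      = dist (Γ.comp w.1 z) (Γ.comp w.1 ζs) := by
    rw [dist_eq_norm]; congr 1; ring
  rw [h5, ← dist_eq_norm, ← dist_eq_norm, dist_comm η, dist_comm η]
  gcongr

/-- By summability σ(z) is eventually within δ/2 of σ(ζ_*), which keeps the distance δ from the
circles. So only finitely many σ(z) can be on the circles, and for almost all σ the kernel term is
at most |σ(z) − σ(ζ_*)| divided by δ²/2. -/
theorem Sep.exists_kernel_bound [NeZero n] {Γ : Circles n} {t : ℝ} (h : Γ.Sep t) {ζs z : ℂ}
    (hζs : ζs ∈ Γ.ext)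
    (hz : Summable fun w : SchottkyWord n => dist (Γ.comp w.1 z) (Γ.comp w.1 ζs)) :
    {w : SchottkyWord n | Γ.comp w.1 z ∈ Γ.contour}.Finite ∧
    ∃ u : SchottkyWord n → ℝ, Summable u ∧ ∀ w, Γ.comp w.1 z ∉ Γ.contour →
      ∀ η ∈ Γ.contour, ‖Γ.kernelTerm ζs z η w‖ ≤ u w := by
  obtain ⟨δ, hδ, h1⟩ := h.exists_le_dist_orbit hζs
  have hne : Γ.contour.Nonempty := by
    have h0 := h.radius_pos 0
    obtain ⟨x, hx⟩ := (NormedSpace.sphere_nonempty (E := ℂ) (x := Γ.center 0) (r := Γ.radius 0)).2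
      h0.le
    exact ⟨x, mem_contour.2 ⟨0, hx⟩⟩
  have hcl := Γ.isCompact_contour.isClosed
  have h2 : ∀ᶠ w : SchottkyWord n in cofinite,
      dist (Γ.comp w.1 z) (Γ.comp w.1 ζs) < δ / 2 :=
    hz.tendsto_cofinite_zero.eventually (gt_mem_nhds (by positivity))
  have h3 : ∀ᶠ w : SchottkyWord n in cofinite,
      δ / 2 ≤ Metric.infDist (Γ.comp w.1 z) Γ.contour := by
    filter_upwards [h2] with w hw
    refine (Metric.le_infDist hne).2 fun η hη => ?_
    have h4 := h1 w.toRed η hη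
    have h5 := dist_triangle_left (Γ.comp w.1 ζs) η (Γ.comp w.1 z)
    have h6 : Γ.comp w.toRed.1 ζs = Γ.comp w.1 ζs := rfl
    rw [h6] at h4
    linarith
  refine ⟨?_, fun w => dist (Γ.comp w.1 z) (Γ.comp w.1 ζs) /
    (Metric.infDist (Γ.comp w.1 z) Γ.contour * δ), ?_, ?_⟩
  · refine Set.Finite.subset (eventually_cofinite.1 h3) fun w hw hw' => ?_
    have := Metric.infDist_zero_of_mem (s := Γ.contour) hw
    rw [this] at hw'
    linarith
  · refine Summable.of_norm_bounded_eventually (hz.mul_left (1 / (δ / 2 * δ))) ?_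
    filter_upwards [h3] with w hw
    rw [Real.norm_of_nonneg (by have := @Metric.infDist_nonneg _ _ Γ.contour (Γ.comp w.1 z); positivity),
      div_eq_mul_one_div, mul_comm]
    gcongr
  · intro w hw η hη
    refine Γ.norm_kernelTerm_le ?_ hδ (Metric.infDist_le_dist_of_mem hη) (h1 w.toRed η hη)
    exact (hcl.notMem_iff_infDist_pos hne).1 hw

theorem Sep.summable_orbit_even {Γ : Circles n} {s : ℝ} (h : Γ.Sep s) (hf : Γ.FirstClass)
    {z z' : ℂ} (hz : z ∈ closure Γ.ext) (hz' : z' ∈ closure Γ.ext) (v : List (Fin n)) :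
    Summable fun w : SchottkyWord n => dist (Γ.comp w.1 (Γ.comp v z)) (Γ.comp w.1 z') :=
  (h.summable_orbit hf hz hz' v).comp_injective (i := SchottkyWord.toRed)
    SchottkyWord.toRed_injective

/-- The finitely many images on the circles, where a denominator may vanish and 1/0 is read as 0, do
not affect convergence. -/
theorem Sep.summable_norm_kernelTerm [NeZero n] {Γ : Circles n} {t : ℝ} (h : Γ.Sep t)
    {ζs z : ℂ} (hζs : ζs ∈ Γ.ext)
    (hz : Summable fun w : SchottkyWord n => dist (Γ.comp w.1 z) (Γ.comp w.1 ζs))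
    {η : ℂ} (hη : η ∈ Γ.contour) : Summable fun w => ‖Γ.kernelTerm ζs z η w‖ := by
  obtain ⟨h1, u, hu, h2⟩ := h.exists_kernel_bound hζs hz
  refine Summable.of_norm_bounded_eventually hu ?_
  filter_upwards [h1.compl_mem_cofinite] with w hw
  rw [norm_norm]
  exact h2 w hw η hη

end Circles

end Antiplane

namespace Antiplane

open MeasureTheory Metric

/-! ### Cauchy integrals over a circle -/

section Cauchy

variable {c : ℂ} {r : ℝ}

/-- The resolvent identity 1/(η − z) − 1/(η − z') = (z − z')/((η − z)(η − z')). It serves both for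
differentiability and for the Lipschitz estimate off the circles. -/
theorem norm_circleIntegral_div_sub_sub_le (hr : 0 < r) {φ : ℂ → ℂ} (hφ : ContinuousOn φ (sphere c r))
    {B δ : ℝ} (hB : ∀ η ∈ sphere c r, ‖φ η‖ ≤ B) (hδ : 0 < δ) {z z' : ℂ}
    (hz : ∀ η ∈ sphere c r, δ ≤ dist η z) (hz' : ∀ η ∈ sphere c r, δ ≤ dist η z') :
    (∮ η in C(c, r), φ η / (η - z)) - (∮ η in C(c, r), φ η / (η - z'))
        = (z - z') * ∮ η in C(c, r), φ η / (η - z) / (η - z') ∧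
      ‖(∮ η in C(c, r), φ η / (η - z)) - ∮ η in C(c, r), φ η / (η - z')‖
        ≤ 2 * π * r * (B / δ ^ 2) * dist z z' := by
  have hne : ∀ {y : ℂ}, (∀ η ∈ sphere c r, δ ≤ dist η y) → ∀ η ∈ sphere c r, η - y ≠ 0 := by
    intro y hy η hη
    rw [← norm_pos_iff, ← dist_eq_norm]; exact hδ.trans_le (hy η hη)
  have hc : ∀ {y : ℂ}, (∀ η ∈ sphere c r, δ ≤ dist η y) →
      CircleIntegrable (fun η => φ η / (η - y)) c r := fun {y} hy =>
    (hφ.div (by fun_prop) (hne hy)).circleIntegrable hr.le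
  have h1 : (∮ η in C(c, r), φ η / (η - z)) - (∮ η in C(c, r), φ η / (η - z'))
        = (z - z') * ∮ η in C(c, r), φ η / (η - z) / (η - z') := by
    rw [← circleIntegral.integral_sub (hc hz) (hc hz'), ← circleIntegral.integral_const_mul]
    refine circleIntegral.integral_congr hr.le fun η hη => ?_
    have h2 := hne hz η hη
    have h3 := hne hz' η hη
    field_simp
    ring
  refine ⟨h1, ?_⟩
  rw [h1, norm_mul, mul_comm, ← dist_eq_norm]
  refine mul_le_mul_of_nonneg_right ?_ dist_nonneg
  refine circleIntegral.norm_integral_le_of_norm_le_const hr.le fun η hη => ?_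
  have hB0 : 0 ≤ B := (norm_nonneg _).trans (hB η hη)
  rw [norm_div, norm_div, div_div, ← dist_eq_norm, ← dist_eq_norm, sq]
  gcongr
  · exact hB η hη
  · exact hz η hη
  · exact hz' η hη

theorem exists_le_dist_sphere {z : ℂ} (hz : z ∉ sphere c r) :
    ∃ δ > 0, ∀ᶠ y in 𝓝 z, ∀ η ∈ sphere c r, δ ≤ dist η y := by
  have h1 : 0 < |dist z c - r| := abs_pos.2 (sub_ne_zero.2 hz)
  refine ⟨|dist z c - r| / 2, by positivity, ?_⟩
  filter_upwards [ball_mem_nhds z (half_pos h1)] with y hy η hη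
  have hη : dist η c = r := hη
  have hy : dist y z < |dist z c - r| / 2 := hy
  have h2 : |dist z c - r| ≤ dist η z := by
    rw [← hη, dist_comm η z]; exact abs_dist_sub_le _ _ _
  have h3 := dist_triangle η y z
  linarith

theorem differentiableAt_circleIntegral_div_sub (hr : 0 < r) {φ : ℂ → ℂ}
    (hφ : ContinuousOn φ (sphere c r)) {z : ℂ} (hz : z ∉ sphere c r) :
    DifferentiableAt ℂ (fun z => ∮ η in C(c, r), φ η / (η - z)) z := by
  obtain ⟨δ, hδ, hev⟩ := exists_le_dist_sphere hz
  have hz0 := hev.self_of_nhds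
  have hne : ∀ η ∈ sphere c r, η - z ≠ 0 := by
    intro η hη
    rw [← norm_pos_iff, ← dist_eq_norm]; exact hδ.trans_le (hz0 η hη)
  have hψ : ContinuousOn (fun η => φ η / (η - z)) (sphere c r) :=
    hφ.div (by fun_prop) hne
  obtain ⟨B, hB⟩ := (isCompact_sphere c r).exists_bound_of_continuousOn hφ
  obtain ⟨B', hB'⟩ := (isCompact_sphere c r).exists_bound_of_continuousOn hψ
  have : HasDerivAt (fun z => ∮ η in C(c, r), φ η / (η - z))
      (∮ η in C(c, r), φ η / (η - z) / (η - z)) z := by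
    rw [hasDerivAt_iff_tendsto_slope]
    have h1 : Tendsto (fun y => ∮ η in C(c, r), φ η / (η - z) / (η - y)) (𝓝 z)
        (𝓝 (∮ η in C(c, r), φ η / (η - z) / (η - z))) := by
      rw [tendsto_iff_norm_sub_tendsto_zero]
      have h2 : Tendsto (fun y => 2 * π * r * (B' / δ ^ 2) * dist y z) (𝓝 z) (𝓝 0) := by
        have : Tendsto (fun y => 2 * π * r * (B' / δ ^ 2) * dist y z) (𝓝 z)
            (𝓝 (2 * π * r * (B' / δ ^ 2) * dist z z)) := Continuous.tendsto (by fun_prop) z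
        simpa using this
      refine squeeze_zero' (Eventually.of_forall fun _ => norm_nonneg _) ?_ h2
      filter_upwards [hev] with y hy
      exact (norm_circleIntegral_div_sub_sub_le hr hψ hB' hδ hy hz0).2
    refine (h1.mono_left nhdsWithin_le_nhds).congr' ?_
    filter_upwards [mem_nhdsWithin_of_mem_nhds hev, self_mem_nhdsWithin] with y hy hyz
    have hyz : y - z ≠ 0 := sub_ne_zero.2 hyz
    rw [slope_def_field, (norm_circleIntegral_div_sub_sub_le hr hφ hB hδ hy hz0).1,
      mul_div_cancel_left₀ _ hyz]
    exact circleIntegral.integral_congr hr.le fun η _ => div_right_comm _ _ _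
  exact this.differentiableAt

theorem circleIntegral_one_div_sub_of_outside (hr : 0 < r) {z : ℂ} (hz : r < dist z c) :
    (∮ η in C(c, r), 1 / (η - z)) = 0 := by
  have hne : ∀ η ∈ closedBall c r, η - z ≠ 0 := by
    intro η hη h0
    rw [sub_eq_zero] at h0
    subst h0
    exact absurd (mem_closedBall.1 hη) (not_le.2 hz)
  refine Complex.circleIntegral_eq_zero_of_differentiable_on_off_countable hr.le
    Set.countable_empty ?_ ?_
  · exact continuousOn_const.div (by fun_prop) hne
  · intro η hη
    have := hne η (ball_subset_closedBall hη.1)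
    exact DifferentiableAt.div (by fun_prop) (by fun_prop) this

theorem circleIntegral_one_div_sub_of_inside {z : ℂ} (hz : dist z c < r) :
    (∮ η in C(c, r), 1 / (η - z)) = 2 * π * Complex.I := by
  simp only [one_div]
  exact circleIntegral.integral_sub_inv_of_mem_ball hz

/-! ### Truncated integrals -/

theorem circleIntegrable_indicator {f : ℂ → ℂ} {ξ : ℂ} (hf : ContinuousOn f (sphere c |r| \ {ξ}))
    {ε : ℝ} (hε : 0 < ε) :
    CircleIntegrable ({η : ℂ | ε < dist η ξ}.indicator f) c r := by
  have hK : IsCompact (Set.Icc 0 (2 * π) ∩ {θ | ε ≤ dist (circleMap c r θ) ξ}) :=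
    isCompact_Icc.inter_right (isClosed_le continuous_const (by fun_prop))
  have h1 : IntegrableOn (fun θ => f (circleMap c r θ))
      (Set.Icc 0 (2 * π) ∩ {θ | ε ≤ dist (circleMap c r θ) ξ}) := by
    refine ContinuousOn.integrableOn_compact hK (hf.comp (by fun_prop) ?_)
    rintro θ ⟨-, hθ⟩
    refine ⟨by simp, fun h0 => ?_⟩
    have h2 : ε ≤ dist (circleMap c r θ) ξ := hθ
    rw [h0, dist_self] at h2
    linarith
  have hm : MeasurableSet {θ : ℝ | ε < dist (circleMap c r θ) ξ} :=
    (isOpen_lt continuous_const (by fun_prop)).measurableSet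
  rw [CircleIntegrable, intervalIntegrable_iff_integrableOn_Icc_of_le (by positivity)]
  have h2 : (fun θ => {η : ℂ | ε < dist η ξ}.indicator f (circleMap c r θ))
      = {θ : ℝ | ε < dist (circleMap c r θ) ξ}.indicator fun θ => f (circleMap c r θ) := rfl
  rw [h2, integrableOn_indicator_iff hm]
  exact h1.mono_set fun θ hθ => ⟨hθ.2, show ε ≤ _ from le_of_lt hθ.1⟩

theorem tendsto_circleIntegral_indicator (hr : r ≠ 0) {f : ℂ → ℂ} (hf : CircleIntegrable f c r)
    (ξ : ℂ) : Tendsto (fun ε : ℝ => ∮ η in C(c, r), {η : ℂ | ε < dist η ξ}.indicator f η)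
      (𝓝[>] 0) (𝓝 (∮ η in C(c, r), f η)) := by
  have h0 := hf.out
  have hind : ∀ (ε θ : ℝ), deriv (circleMap c r) θ •
      {η : ℂ | ε < dist η ξ}.indicator f (circleMap c r θ)
      = {θ : ℝ | ε < dist (circleMap c r θ) ξ}.indicator
        (fun θ => deriv (circleMap c r) θ • f (circleMap c r θ)) θ := by
    intro ε θ
    by_cases hθ : ε < dist (circleMap c r θ) ξ
    · rw [Set.indicator_of_mem (by exact hθ), Set.indicator_of_mem (by exact hθ)]
    · rw [Set.indicator_of_notMem (by exact hθ), Set.indicator_of_notMem (by exact hθ), smul_zero]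
  unfold circleIntegral
  refine intervalIntegral.tendsto_integral_filter_of_dominated_convergence
    (fun θ => ‖deriv (circleMap c r) θ • f (circleMap c r θ)‖) ?_ ?_ h0.norm ?_
  · refine Eventually.of_forall fun ε => ?_
    simp only [hind]
    exact (intervalIntegrable_iff.1 h0).aestronglyMeasurable.indicator
      (isOpen_lt continuous_const (by fun_prop)).measurableSet
  · refine Eventually.of_forall fun ε => Eventually.of_forall fun θ _ => ?_
    rw [hind]
    exact norm_indicator_le_norm_self _ _
  · have hcount : (circleMap c r ⁻¹' {ξ}).Countable :=
      (Set.countable_singleton ξ).preimage_circleMap c hr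
    filter_upwards [hcount.ae_notMem volume] with θ hθ _
    have hpos : 0 < dist (circleMap c r θ) ξ := dist_pos.2 hθ
    refine tendsto_const_nhds.congr' ?_
    filter_upwards [mem_nhdsWithin_of_mem_nhds (gt_mem_nhds hpos)] with ε hε
    rw [Set.indicator_of_mem (by exact hε)]

/-- On the circle dη/(η − ξ) has constant imaginary part i/2 dθ, and a real part that is odd under
the reflection θ ↦ 2θ₀ − θ. The excised arc is symmetric under this reflection, so the odd part
cancels exactly, for every ε. -/
theorem circleIntegral_indicator_one_div_sub (hr : 0 < r) {ξ : ℂ} (hξ : ξ ∈ sphere c r) {ε : ℝ}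
    (hε : 0 < ε) :
    (∮ η in C(c, r), {η : ℂ | ε < dist η ξ}.indicator (fun η => 1 / (η - ξ)) η)
      = Complex.I / 2 * ∫ θ in (0 : ℝ)..2 * π,
        {θ : ℝ | ε < dist (circleMap c r θ) ξ}.indicator (fun _ => (1 : ℂ)) θ := by
  obtain ⟨θ₀, -, rfl⟩ : ∃ θ₀ ∈ Set.Ioc 0 (2 * π), circleMap c r θ₀ = ξ := by
    have := image_circleMap_Ioc c r
    rw [abs_of_pos hr] at this
    rw [← this] at hξ
    exact hξ
  set ξ := circleMap c r θ₀
  set k : ℝ → ℂ := fun θ => deriv (circleMap c r) θ •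
    {η : ℂ | ε < dist η ξ}.indicator (fun η => 1 / (η - ξ)) (circleMap c r θ) with hk
  have hcont : ContinuousOn (fun η : ℂ => 1 / (η - ξ)) (sphere c |r| \ {ξ}) :=
    continuousOn_const.div (by fun_prop) fun η hη => sub_ne_zero.2 hη.2
  have hki : IntervalIntegrable k volume 0 (2 * π) := (circleIntegrable_indicator hcont hε).out
  have hper : Function.Periodic k (2 * π) := by
    intro θ
    simp only [hk, deriv_circleMap]
    rw [periodic_circleMap c r θ, periodic_circleMap 0 r θ]
  have h1 : ∫ θ in (0 : ℝ)..2 * π, k (2 * θ₀ - θ) = ∫ θ in (0 : ℝ)..2 * π, k θ := by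
    rw [intervalIntegral.integral_comp_sub_left]
    have := hper.intervalIntegral_add_eq (2 * θ₀ - 2 * π) 0
    simpa using this
  have h1i : IntervalIntegrable (fun θ => k (2 * θ₀ - θ)) volume 0 (2 * π) := by
    have h2 : IntervalIntegrable k volume (2 * θ₀ - 0) (2 * θ₀ - 2 * π) :=
      hper.intervalIntegrable₀ (by positivity) hki _ _
    have h3 := h2.comp_sub_left (2 * θ₀)
    simpa using h3
  have h2 : ∀ θ, k θ + k (2 * θ₀ - θ) = Complex.I *
      {θ : ℝ | ε < dist (circleMap c r θ) ξ}.indicator (fun _ => (1 : ℂ)) θ := by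
    intro θ
    set E := Complex.exp (θ * Complex.I) with hE
    set E₀ := Complex.exp (θ₀ * Complex.I) with hE₀
    have hE0 : E ≠ 0 := Complex.exp_ne_zero _
    have hE₀0 : E₀ ≠ 0 := Complex.exp_ne_zero _
    have hr0 : (r : ℂ) ≠ 0 := by exact_mod_cast hr.ne'
    have h3 : Complex.exp (((2 * θ₀ - θ : ℝ) : ℂ) * Complex.I) = E₀ ^ 2 / E := by
      rw [hE, hE₀, ← Complex.exp_nat_mul, ← Complex.exp_sub]
      congr 1; push_cast; ring
    have e1 : circleMap c r θ - ξ = r * (E - E₀) := by simp [circleMap, ξ, hE, hE₀]; ring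
    have e2 : circleMap c r (2 * θ₀ - θ) - ξ = r * (E₀ * (E₀ - E) / E) := by
      simp only [circleMap, ξ, h3, ← hE₀]; field_simp; ring
    have hn1 : ‖E‖ = 1 := Complex.norm_exp_ofReal_mul_I θ
    have hn2 : ‖E₀‖ = 1 := Complex.norm_exp_ofReal_mul_I θ₀
    have e3 : dist (circleMap c r (2 * θ₀ - θ)) ξ = dist (circleMap c r θ) ξ := by
      rw [dist_eq_norm, dist_eq_norm, e1, e2]
      simp only [norm_mul, norm_div, hn1, hn2]
      rw [norm_sub_rev]; ring
    simp only [hk]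
    by_cases hθ : ε < dist (circleMap c r θ) ξ
    · rw [Set.indicator_of_mem (by exact hθ), Set.indicator_of_mem (by rw [← e3] at hθ; exact hθ),
        Set.indicator_of_mem (by exact hθ), e1, e2, deriv_circleMap, deriv_circleMap]
      have hEE : E - E₀ ≠ 0 := by
        intro h0
        rw [dist_eq_norm, e1, h0, mul_zero, norm_zero] at hθ
        linarith
      have hEE' : E₀ - E ≠ 0 := by rw [← neg_sub]; exact neg_ne_zero.2 hEE
      simp only [circleMap, h3, ← hE, zero_add, smul_eq_mul, mul_one]
      rw [← neg_sub E E₀]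
      field_simp
      ring
    · rw [Set.indicator_of_notMem (by exact hθ),
        Set.indicator_of_notMem (by rw [← e3] at hθ; exact hθ), Set.indicator_of_notMem (by exact hθ)]
      simp
  have h3 : (2 : ℂ) * ∫ θ in (0 : ℝ)..2 * π, k θ = Complex.I * ∫ θ in (0 : ℝ)..2 * π,
        {θ : ℝ | ε < dist (circleMap c r θ) ξ}.indicator (fun _ => (1 : ℂ)) θ := by
    rw [two_mul]
    conv_lhs => rw [← h1, add_comm, h1]
    rw [← intervalIntegral.integral_const_mul]
    conv_lhs => arg 2; rw [← h1]
    rw [← intervalIntegral.integral_add hki h1i]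
    simp only [h2]
  change (∫ θ in (0 : ℝ)..2 * π, k θ) = _
  linear_combination h3 / 2

/-- The remaining arc fills the circle as ε → 0, giving (i/2)·2π: half of the residue value. -/
theorem tendsto_circleIntegral_indicator_one_div_sub (hr : 0 < r) {ξ : ℂ} (hξ : ξ ∈ sphere c r) :
    Tendsto (fun ε : ℝ => ∮ η in C(c, r), {η : ℂ | ε < dist η ξ}.indicator
      (fun η => 1 / (η - ξ)) η) (𝓝[>] 0) (𝓝 (π * Complex.I)) := by
  have h1 : Tendsto (fun ε : ℝ => Complex.I / 2 * ∫ θ in (0 : ℝ)..2 * π,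
        {θ : ℝ | ε < dist (circleMap c r θ) ξ}.indicator (fun _ => (1 : ℂ)) θ) (𝓝[>] 0)
        (𝓝 (Complex.I / 2 * ∫ _ in (0 : ℝ)..2 * π, (1 : ℂ))) := by
    refine Tendsto.const_mul _ ?_
    refine intervalIntegral.tendsto_integral_filter_of_dominated_convergence
      (fun _ => 1) ?_ ?_ (by simp) ?_
    · refine Eventually.of_forall fun ε => ?_
      exact aestronglyMeasurable_const.indicator
        (isOpen_lt continuous_const (by fun_prop)).measurableSet
    · refine Eventually.of_forall fun ε => Eventually.of_forall fun θ _ => ?_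
      refine (norm_indicator_le_norm_self _ _).trans (by simp)
    · have hcount : (circleMap c r ⁻¹' {ξ}).Countable :=
        (Set.countable_singleton ξ).preimage_circleMap c hr.ne'
      filter_upwards [hcount.ae_notMem volume] with θ hθ _
      have hpos : 0 < dist (circleMap c r θ) ξ := dist_pos.2 hθ
      refine tendsto_const_nhds.congr' ?_
      filter_upwards [mem_nhdsWithin_of_mem_nhds (gt_mem_nhds hpos)] with ε hε
      rw [Set.indicator_of_mem (by exact hε)]
  have h2 : Complex.I / 2 * ∫ _ in (0 : ℝ)..2 * π, (1 : ℂ) = π * Complex.I := by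
    rw [intervalIntegral.integral_const]; simp; ring
  rw [h2] at h1
  refine h1.congr' ?_
  filter_upwards [self_mem_nhdsWithin] with ε hε
  rw [circleIntegral_indicator_one_div_sub hr hξ hε]

end Cauchy

end Antiplane

namespace Antiplane

open MeasureTheory Metric
open scoped NNReal

/-! ### Boundary behaviour of Cauchy integrals with Lipschitz density -/

section Plemelj

variable {c : ℂ} {r : ℝ}

/-- The radial projection onto the circle `|η - c| = r`. -/
noncomputable def radialProj (c : ℂ) (r : ℝ) (z : ℂ) : ℂ := c + ((r / ‖z - c‖ : ℝ) : ℂ) * (z - c)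

theorem radialProj_mem (hr : 0 < r) {z : ℂ} (hz : z ≠ c) : radialProj c r z ∈ sphere c r := by
  have h1 : 0 < ‖z - c‖ := norm_pos_iff.2 (sub_ne_zero.2 hz)
  rw [mem_sphere, radialProj, dist_eq_norm, add_sub_cancel_left, norm_mul, Complex.norm_real,
    Real.norm_of_nonneg (by positivity), div_mul_cancel₀ _ h1.ne']

theorem radialProj_of_mem {z : ℂ} (hr : 0 < r) (hz : z ∈ sphere c r) : radialProj c r z = z := by
  have h1 : ‖z - c‖ = r := by rw [← dist_eq_norm]; exact hz
  rw [radialProj, h1, div_self hr.ne']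
  simp

theorem dist_radialProj {z : ℂ} (hz : z ≠ c) : dist z (radialProj c r z) = |dist z c - r| := by
  have h1 : 0 < ‖z - c‖ := norm_pos_iff.2 (sub_ne_zero.2 hz)
  have h2 : z - radialProj c r z = ((1 - r / ‖z - c‖ : ℝ) : ℂ) * (z - c) := by
    rw [radialProj]; push_cast; ring
  rw [dist_eq_norm, h2, norm_mul, Complex.norm_real, Real.norm_eq_abs, dist_eq_norm]
  conv_lhs => arg 2; rw [← abs_of_pos h1]
  rw [← abs_mul]
  congr 1
  field_simp

/-- The projection is the point of the circle nearest to z, so it is no farther from z than η is. -/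
theorem dist_radialProj_le {z η : ℂ} (hz : z ≠ c) (hη : η ∈ sphere c r) :
    dist η (radialProj c r z) ≤ 2 * dist η z := by
  have h1 : dist z (radialProj c r z) ≤ dist η z := by
    rw [dist_radialProj hz, ← mem_sphere.1 hη, dist_comm η z]
    exact abs_dist_sub_le _ _ _
  have := dist_triangle η z (radialProj c r z)
  linarith

theorem continuousAt_radialProj {z : ℂ} (hz : z ≠ c) : ContinuousAt (radialProj c r) z := by
  have h1 : ‖z - c‖ ≠ 0 := norm_ne_zero_iff.2 (sub_ne_zero.2 hz)
  unfold radialProj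
  fun_prop (disch := exact h1)

/-- The Cauchy integral of `g` after subtraction of its value at the nearest point of the
circle. -/
noncomputable def cauchyReg (c : ℂ) (r : ℝ) (g : ℂ → ℝ) (z : ℂ) : ℂ :=
  ∮ η in C(c, r), ((g η - g (radialProj c r z) : ℝ) : ℂ) / (η - z)

variable {g : ℂ → ℝ} {K : ℝ≥0}

/-- The Lipschitz bound at the nearest point cancels the singularity uniformly in z, both off and on
the circle. This is the domination needed for continuity across it. -/
theorem norm_cauchyReg_integrand_le (hr : 0 < r) (hg : LipschitzOnWith K g (sphere c r)) {z η : ℂ}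
    (hz : z ≠ c) (hη : η ∈ sphere c r) :
    ‖((g η - g (radialProj c r z) : ℝ) : ℂ) / (η - z)‖ ≤ 2 * K := by
  rw [norm_div, Complex.norm_real]
  refine div_le_of_le_mul₀ (norm_nonneg _) (by positivity) ?_
  rw [← dist_eq_norm, ← dist_eq_norm]
  calc _ ≤ K * dist η (radialProj c r z) := hg.dist_le_mul _ hη _ (radialProj_mem hr hz)
    _ ≤ K * (2 * dist η z) := by gcongr; exact dist_radialProj_le hz hη
    _ = _ := by ring

theorem continuous_comp_circleMap (hr : 0 < r) (hg : LipschitzOnWith K g (sphere c r)) :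
    Continuous fun θ => g (circleMap c r θ) :=
  hg.continuousOn.comp_continuous (continuous_circleMap c r)
    fun θ => circleMap_mem_sphere c hr.le θ

theorem circleIntegrable_cauchyReg (hr : 0 < r) (hg : LipschitzOnWith K g (sphere c r)) {z : ℂ}
    (hz : z ≠ c) :
    CircleIntegrable (fun η => ((g η - g (radialProj c r z) : ℝ) : ℂ) / (η - z)) c r := by
  rw [CircleIntegrable, intervalIntegrable_iff]
  refine Measure.integrableOn_of_bounded (M := 2 * K) (by simp [ENNReal.mul_eq_top]) ?_ ?_
  · have h1 := continuous_comp_circleMap hr hg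
    exact ((Complex.measurable_ofReal.comp (h1.measurable.sub_const _)).div
      (by fun_prop)).aestronglyMeasurable
  · exact Eventually.of_forall fun θ =>
      norm_cauchyReg_integrand_le hr hg hz (circleMap_mem_sphere c hr.le θ)

theorem norm_cauchyReg_le (hr : 0 < r) (hg : LipschitzOnWith K g (sphere c r)) {z : ℂ}
    (hz : z ≠ c) : ‖cauchyReg c r g z‖ ≤ 2 * π * r * (2 * K) :=
  circleIntegral.norm_integral_le_of_norm_le_const hr.le fun _ hη =>
    norm_cauchyReg_integrand_le hr hg hz hη

theorem continuousAt_comp_radialProj (hr : 0 < r) (hg : LipschitzOnWith K g (sphere c r)) {z : ℂ}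
    (hz : z ≠ c) : ContinuousAt (fun z => g (radialProj c r z)) z := by
  have h1 : Tendsto (radialProj c r) (𝓝 z) (𝓝[sphere c r] (radialProj c r z)) := by
    refine tendsto_nhdsWithin_iff.2 ⟨continuousAt_radialProj hz, ?_⟩
    filter_upwards [isOpen_ne.mem_nhds hz] with y hy using radialProj_mem hr hy
  exact (hg.continuousOn _ (radialProj_mem hr hz)).tendsto.comp h1

/-- Dominated convergence with the uniform bound on the integrand. The only bad parameter values are
those with η = z, a countable set. All the jump of the Cauchy integral is thereby confined to the
explicit term with ∮ dη/(η − z), equal to 0 outside and 2πi inside, while its principal value on the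
circle is πi. -/
theorem continuousAt_cauchyReg (hr : 0 < r) (hg : LipschitzOnWith K g (sphere c r)) {z : ℂ}
    (hz : z ≠ c) : ContinuousAt (cauchyReg c r g) z := by
  unfold cauchyReg circleIntegral
  refine intervalIntegral.continuousAt_of_dominated_interval (bound := fun _ => r * (2 * K))
    ?_ ?_ (by simp) ?_
  · filter_upwards [isOpen_ne.mem_nhds hz] with y hy
    exact (intervalIntegrable_iff.1 (circleIntegrable_cauchyReg hr hg hy).out).aestronglyMeasurable
  · filter_upwards [isOpen_ne.mem_nhds hz] with y hy
    refine Eventually.of_forall fun θ _ => ?_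
    rw [norm_smul, deriv_circleMap]
    refine mul_le_mul ?_ (norm_cauchyReg_integrand_le hr hg hy (circleMap_mem_sphere c hr.le θ))
      (norm_nonneg _) hr.le
    simp [abs_of_pos hr]
  · have hcount : (circleMap c r ⁻¹' {z}).Countable :=
      (Set.countable_singleton z).preimage_circleMap c hr.ne'
    filter_upwards [hcount.ae_notMem volume] with θ hθ _
    have h1 : circleMap c r θ - z ≠ 0 := sub_ne_zero.2 hθ
    have h2 := continuousAt_comp_radialProj hr hg hz
    have h3 : ContinuousAt (fun x => ((g (circleMap c r θ) - g (radialProj c r x) : ℝ) : ℂ)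
        / (circleMap c r θ - x)) z :=
      (Complex.continuous_ofReal.continuousAt.comp (continuousAt_const.sub h2)).div
        (by fun_prop) h1
    simp only [smul_eq_mul]
    exact continuousAt_const.mul h3

theorem circleIntegral_eq_cauchyReg_add (hr : 0 < r) (hg : LipschitzOnWith K g (sphere c r))
    {z : ℂ} (hz : z ≠ c) (hz' : z ∉ sphere c r) :
    (∮ η in C(c, r), (g η : ℂ) / (η - z))
      = cauchyReg c r g z + (g (radialProj c r z) : ℂ) * ∮ η in C(c, r), 1 / (η - z) := by
  have hne : ∀ η ∈ sphere c r, η - z ≠ 0 := by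
    rintro η hη h0
    rw [sub_eq_zero] at h0
    exact hz' (h0 ▸ hη)
  have h1 : CircleIntegrable (fun η => (g (radialProj c r z) : ℂ) * (1 / (η - z))) c r :=
    (continuousOn_const.mul (continuousOn_const.div (by fun_prop) hne)).circleIntegrable hr.le
  rw [cauchyReg, ← circleIntegral.integral_const_mul,
    ← circleIntegral.integral_add (circleIntegrable_cauchyReg hr hg hz) h1]
  refine circleIntegral.integral_congr hr.le fun η _ => ?_
  push_cast
  ring

theorem circleIntegral_eq_cauchyReg_of_outside (hr : 0 < r)
    (hg : LipschitzOnWith K g (sphere c r)) {z : ℂ} (hz : r < dist z c) :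
    (∮ η in C(c, r), (g η : ℂ) / (η - z)) = cauchyReg c r g z := by
  have h1 : z ≠ c := dist_pos.1 (hr.trans hz)
  rw [circleIntegral_eq_cauchyReg_add hr hg h1 (fun h => hz.ne' h),
    circleIntegral_one_div_sub_of_outside hr hz, mul_zero, add_zero]

theorem circleIntegral_eq_cauchyReg_of_inside (hr : 0 < r)
    (hg : LipschitzOnWith K g (sphere c r)) {z : ℂ} (hz : dist z c < r) (hzc : z ≠ c) :
    (∮ η in C(c, r), (g η : ℂ) / (η - z))
      = cauchyReg c r g z + 2 * π * Complex.I * g (radialProj c r z) := by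
  rw [circleIntegral_eq_cauchyReg_add hr hg hzc (fun h => hz.ne h),
    circleIntegral_one_div_sub_of_inside hz]
  ring

/-- The Cauchy integral of `g`, understood as a principal value on the circle. -/
noncomputable def pvCauchy (c : ℂ) (r : ℝ) (g : ℂ → ℝ) (z : ℂ) : ℂ :=
  if dist z c = r then cauchyReg c r g z + π * Complex.I * g z
  else ∮ η in C(c, r), (g η : ℂ) / (η - z)

theorem pvCauchy_of_notMem {z : ℂ} (hz : z ∉ sphere c r) :
    pvCauchy c r g z = ∮ η in C(c, r), (g η : ℂ) / (η - z) := if_neg hz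

/-- The principal value of the Cauchy integral of a Lipschitz density exists. -/
theorem tendsto_pvCauchy (hr : 0 < r) (hg : LipschitzOnWith K g (sphere c r)) {ξ : ℂ}
    (hξ : ξ ∈ sphere c r) :
    Tendsto (fun ε : ℝ => ∮ η in C(c, r), {η : ℂ | ε < dist η ξ}.indicator
      (fun η => (g η : ℂ) / (η - ξ)) η) (𝓝[>] 0) (𝓝 (pvCauchy c r g ξ)) := by
  have hξc : ξ ≠ c := by
    rw [← dist_pos, mem_sphere.1 hξ]; exact hr
  have h1 := tendsto_circleIntegral_indicator hr.ne' (circleIntegrable_cauchyReg hr hg hξc) ξ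
  have h2 := (tendsto_circleIntegral_indicator_one_div_sub hr hξ).const_mul (g ξ : ℂ)
  rw [pvCauchy, if_pos (mem_sphere.1 hξ)]
  have h3 := h1.add h2
  rw [show (g ξ : ℂ) * (π * Complex.I) = π * Complex.I * g ξ by ring] at h3
  refine h3.congr' ?_
  filter_upwards [self_mem_nhdsWithin] with ε hε
  have hgc : ContinuousOn g (sphere c |r|) := by rw [abs_of_pos hr]; exact hg.continuousOn
  have hgc' : ContinuousOn (fun η => (g η : ℂ)) (sphere c |r|) :=
    Complex.continuous_ofReal.comp_continuousOn hgc
  have hne : ∀ η ∈ sphere c |r| \ {ξ}, η - ξ ≠ 0 := fun η hη => sub_ne_zero.2 hη.2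
  have h4 : CircleIntegrable ({η : ℂ | ε < dist η ξ}.indicator
      (fun η => ((g η - g (radialProj c r ξ) : ℝ) : ℂ) / (η - ξ))) c r := by
    refine circleIntegrable_indicator (ContinuousOn.div ?_ (by fun_prop) hne) hε
    exact Complex.continuous_ofReal.comp_continuousOn
      ((hgc.mono Set.sdiff_subset).sub continuousOn_const)
  have h5 : CircleIntegrable (fun η => (g ξ : ℂ) * {η : ℂ | ε < dist η ξ}.indicator
      (fun η => 1 / (η - ξ)) η) c r :=
    (circleIntegrable_indicator (continuousOn_const.div (by fun_prop) hne) hε).const_smul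
  rw [← circleIntegral.integral_const_mul, ← circleIntegral.integral_add h4 h5]
  refine circleIntegral.integral_congr hr.le fun η _ => ?_
  by_cases hη : ε < dist η ξ
  · simp only [Set.indicator_of_mem (show η ∈ {η : ℂ | ε < dist η ξ} from hη),
      radialProj_of_mem hr hξ]
    push_cast
    ring
  · simp only [Set.indicator_of_notMem (show η ∉ {η : ℂ | ε < dist η ξ} from hη)]
    ring

end Plemelj

end Antiplane

namespace Antiplane

open MeasureTheory Metric
open scoped NNReal

namespace Circles

variable {n : ℕ}

/-! ### Integrals of the kernel as series -/

instance : Countable (SchottkyWord n) :=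
  inferInstanceAs (Countable {w : List (Fin n) // w.IsChain (· ≠ ·) ∧ Even w.length})

/-- A density is Lipschitz on each of the circles. -/
def LipschitzDensity (Γ : Circles n) (g : Fin n → ℂ → ℝ) : Prop :=
  ∀ l, ∃ K, LipschitzOnWith K (g l) (Γ.circle l)

/-- `(1 / 2π) ∑_l ∫_{𝔏_l} g_l(η) / (η - z) dη`, a principal value on the circles. -/
noncomputable def potential (Γ : Circles n) (g : Fin n → ℂ → ℝ) (z : ℂ) : ℂ :=
  1 / (2 * (π : ℂ)) * ∑ l, pvCauchy (Γ.center l) (Γ.radius l) (g l) z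

theorem continuousOn_ofReal_density {s : Set ℂ} {g : ℂ → ℝ} {K : ℝ≥0}
    (hg : LipschitzOnWith K g s) : ContinuousOn (fun η => (g η : ℂ)) s :=
  Complex.continuous_ofReal.comp_continuousOn hg.continuousOn

/-- The cut is made at ξ while the pole is at y. Either y is off the circle and the cut disappears
in the limit, or y = ξ and this is a true principal value. -/
theorem tendsto_pvCauchy_of_imp {c : ℂ} {r : ℝ} (hr : 0 < r) {g : ℂ → ℝ} {K : ℝ≥0}
    (hg : LipschitzOnWith K g (sphere c r)) {y ξ : ℂ} (hy : y ∈ sphere c r → y = ξ) :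
    Tendsto (fun ε : ℝ => ∮ η in C(c, r), {η : ℂ | ε < dist η ξ}.indicator
      (fun η => (g η : ℂ) / (η - y)) η) (𝓝[>] 0) (𝓝 (pvCauchy c r g y)) ∧
    ∀ ε > 0, CircleIntegrable ({η : ℂ | ε < dist η ξ}.indicator
      (fun η => (g η : ℂ) / (η - y))) c r := by
  constructor
  · by_cases h : y ∈ sphere c r
    · obtain rfl := hy h
      exact tendsto_pvCauchy hr hg h
    · rw [pvCauchy_of_notMem h]
      refine tendsto_circleIntegral_indicator hr.ne' ?_ ξ
      refine ContinuousOn.circleIntegrable hr.le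
        ((continuousOn_ofReal_density hg).div (by fun_prop) fun η hη h0 => ?_)
      rw [sub_eq_zero] at h0
      exact h (h0 ▸ hη)
  · intro ε hε
    refine circleIntegrable_indicator ?_ hε
    rw [abs_of_pos hr]
    refine ((continuousOn_ofReal_density hg).mono Set.sdiff_subset).div (by fun_prop)
      fun η hη h0 => ?_
    rw [sub_eq_zero] at h0
    subst h0
    exact hη.2 (hy hη.1)

/-- Weierstrass majorant: uniform convergence on the compact circle permits termwise integration. -/
theorem hasSum_circleIntegral_mul {ι : Type*} [Countable ι] {c : ℂ} {r : ℝ} (hr : 0 ≤ r) {φ : ℂ → ℂ}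
    (hφ : ContinuousOn φ (sphere c r)) {f : ι → ℂ → ℂ} {u : ι → ℝ} (hu : Summable u)
    (hf : ∀ i, ContinuousOn (f i) (sphere c r)) (hfu : ∀ i, ∀ η ∈ sphere c r, ‖f i η‖ ≤ u i) :
    ContinuousOn (fun η => ∑' i, f i η) (sphere c r) ∧
    HasSum (fun i => ∮ η in C(c, r), φ η * f i η) (∮ η in C(c, r), φ η * ∑' i, f i η) := by
  obtain ⟨B, hB⟩ := (isCompact_sphere c r).exists_bound_of_continuousOn hφ
  refine ⟨continuousOn_tsum hf hu hfu, ?_⟩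
  have h1 : ∀ i, ∀ η ∈ sphere c r, ‖φ η * f i η‖ ≤ B * u i := fun i η hη => by
    rw [norm_mul]
    exact mul_le_mul (hB η hη) (hfu i η hη) (norm_nonneg _) ((norm_nonneg _).trans (hB η hη))
  have h2 := tendstoUniformlyOn_tsum (hu.mul_left B) h1
  have h3 := TendstoUniformlyOn.tendsto_circleIntegral_of_continuousOn (c := c) (R := r) hr
    (Eventually.of_forall fun s => continuousOn_finsetSum s fun i _ => hφ.mul (hf i)) h2
  rw [HasSum]
  have h4 : (∮ η in C(c, r), φ η * ∑' i, f i η) = ∮ η in C(c, r), ∑' i, φ η * f i η := by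
    simp only [tsum_mul_left]
  rw [h4]
  refine h3.congr fun s => ?_
  exact circleIntegral.integral_fun_sum fun i _ => (hφ.mul (hf i)).circleIntegrable hr

theorem continuousOn_kernelTerm {Γ : Circles n} {ζs z : ℂ} {w : SchottkyWord n} {s : Set ℂ}
    (h1 : Γ.comp w.1 z ∉ s) (h2 : Γ.comp w.1 ζs ∉ s) :
    ContinuousOn (fun η => Γ.kernelTerm ζs z η w) s := by
  unfold kernelTerm
  refine ContinuousOn.sub ?_ ?_ <;>
  · refine continuousOn_const.div (by fun_prop) fun η hη h0 => ?_
    rw [sub_eq_zero] at h0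
    subst h0
    contradiction

theorem circle_subset_contour (Γ : Circles n) (l : Fin n) : Γ.circle l ⊆ Γ.contour :=
  fun _ hη => mem_contour.2 ⟨l, hη⟩

theorem Sep.orbit_notMem_contour {Γ : Circles n} {t : ℝ} (h : Γ.Sep t) {z : ℂ}
    (hz : z ∈ Γ.ext) (w : RedWord n) : Γ.comp w.1 z ∉ Γ.contour := by
  obtain ⟨δ, hδ, h1⟩ := h.exists_le_dist_orbit hz
  intro h2
  have := h1 w _ h2
  rw [dist_self] at this
  linarith

theorem circleIntegral_mul_kernelTerm {Γ : Circles n} {t : ℝ} (h : Γ.Sep t) {ζs z : ℂ}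
    (hζs : ζs ∈ Γ.ext) {l : Fin n} {g : ℂ → ℝ} {K : ℝ≥0} (hg : LipschitzOnWith K g (Γ.circle l))
    {w : SchottkyWord n} (hw : Γ.comp w.1 z ∉ Γ.contour) :
    (∮ η in C(Γ.center l, Γ.radius l), (g η : ℂ) * Γ.kernelTerm ζs z η w)
      = pvCauchy (Γ.center l) (Γ.radius l) g (Γ.comp w.1 z)
        - pvCauchy (Γ.center l) (Γ.radius l) g (Γ.comp w.1 ζs) := by
  have hr := h.radius_pos l
  have h1 : Γ.comp w.1 z ∉ Γ.circle l := fun h0 => hw (Γ.circle_subset_contour l h0)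
  have h2 : Γ.comp w.1 ζs ∉ Γ.circle l := fun h0 =>
    h.orbit_notMem_contour hζs w.toRed (Γ.circle_subset_contour l h0)
  have h3 : ∀ {y : ℂ}, y ∉ Γ.circle l → CircleIntegrable (fun η => (g η : ℂ) / (η - y))
      (Γ.center l) (Γ.radius l) := by
    intro y hy
    refine ContinuousOn.circleIntegrable hr.le ((continuousOn_ofReal_density hg).div (by fun_prop)
      fun η hη h0 => ?_)
    rw [sub_eq_zero] at h0
    exact hy (h0 ▸ hη)
  rw [pvCauchy_of_notMem h1, pvCauchy_of_notMem h2, ← circleIntegral.integral_sub (h3 h1) (h3 h2)]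
  refine circleIntegral.integral_congr hr.le fun η _ => ?_
  simp only [kernelTerm]
  ring

section Kernel

variable [NeZero n] {Γ : Circles n} {t : ℝ} {ζs z : ℂ} {l : Fin n} {g : ℂ → ℝ} {K : ℝ≥0}

/-- The integral of the kernel against a density, when no image of `z` is on the circles. -/
theorem Sep.hasSum_circleIntegral_kernel (h : Γ.Sep t) (hζs : ζs ∈ Γ.ext)
    (hz : Summable fun w : SchottkyWord n => dist (Γ.comp w.1 z) (Γ.comp w.1 ζs))
    (hzc : ∀ w : SchottkyWord n, Γ.comp w.1 z ∉ Γ.contour)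
    (hg : LipschitzOnWith K g (Γ.circle l)) :
    ContinuousOn (fun η => Γ.kernel ζs z η) (Γ.circle l) ∧
    HasSum (fun w : SchottkyWord n => pvCauchy (Γ.center l) (Γ.radius l) g (Γ.comp w.1 z)
        - pvCauchy (Γ.center l) (Γ.radius l) g (Γ.comp w.1 ζs))
      (∮ η in C(Γ.center l, Γ.radius l), (g η : ℂ) * Γ.kernel ζs z η) := by
  obtain ⟨-, u, hu, h1⟩ := h.exists_kernel_bound hζs hz
  have h2 := hasSum_circleIntegral_mul (h.radius_pos l).le (continuousOn_ofReal_density hg) hu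
    (f := fun w η => Γ.kernelTerm ζs z η w)
    (fun w => continuousOn_kernelTerm (fun h0 => hzc w (Γ.circle_subset_contour l h0))
      fun h0 => h.orbit_notMem_contour hζs w.toRed (Γ.circle_subset_contour l h0))
    (fun w η hη => h1 w (hzc w) η (Γ.circle_subset_contour l hη))
  refine ⟨h2.1, ?_⟩
  have h3 := h2.2
  simp only [circleIntegral_mul_kernelTerm h hζs hg (hzc _)] at h3
  exact h3

/-- The principal value of the integral of the kernel against a density. -/
theorem Sep.tendsto_circleIntegral_kernel (h : Γ.Sep t) (hζs : ζs ∈ Γ.ext)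
    (hz : Summable fun w : SchottkyWord n => dist (Γ.comp w.1 z) (Γ.comp w.1 ζs)) {ξ : ℂ}
    (hzξ : ∀ w : SchottkyWord n, Γ.comp w.1 z ∈ Γ.contour → Γ.comp w.1 z = ξ)
    (hg : LipschitzOnWith K g (Γ.circle l)) :
    Summable (fun w : SchottkyWord n => pvCauchy (Γ.center l) (Γ.radius l) g (Γ.comp w.1 z)
        - pvCauchy (Γ.center l) (Γ.radius l) g (Γ.comp w.1 ζs)) ∧
    Tendsto (fun ε : ℝ => ∮ η in C(Γ.center l, Γ.radius l),
      {η : ℂ | ε < dist η ξ}.indicator (fun η => (g η : ℂ) * Γ.kernel ζs z η) η) (𝓝[>] 0)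
      (𝓝 (∑' w : SchottkyWord n, (pvCauchy (Γ.center l) (Γ.radius l) g (Γ.comp w.1 z)
        - pvCauchy (Γ.center l) (Γ.radius l) g (Γ.comp w.1 ζs)))) := by
  classical
  obtain ⟨hS, u, hu, h1⟩ := h.exists_kernel_bound hζs hz
  have hr := h.radius_pos l
  have hsub := Γ.circle_subset_contour l
  set c := Γ.center l
  set r := Γ.radius l
  set S : Finset (SchottkyWord n) := hS.toFinset with hSdef
  have hmem : ∀ w : SchottkyWord n, w ∈ S ↔ Γ.comp w.1 z ∈ Γ.contour := fun w => by
    rw [hSdef, Set.Finite.mem_toFinset]; rfl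
  set P : SchottkyWord n → ℂ := fun w => pvCauchy c r g (Γ.comp w.1 z)
    - pvCauchy c r g (Γ.comp w.1 ζs) with hP
  -- The finitely many words in S, whose images of z lie on the circles and hence equal ξ, are
  -- treated as individual principal values. The remaining series `f` converges uniformly on the
  -- circles and needs no principal value.
  set f : SchottkyWord n → ℂ → ℂ := fun w η => if w ∈ S then 0 else Γ.kernelTerm ζs z η w with hf
  have hζsc : ∀ w : SchottkyWord n, Γ.comp w.1 ζs ∉ Γ.contour := fun w =>
    h.orbit_notMem_contour hζs w.toRed
  have hfc : ∀ w, ContinuousOn (f w) (Γ.circle l) := by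
    intro w
    by_cases hw : w ∈ S
    · simp only [hf, hw, if_true]; exact continuousOn_const
    · simp only [hf, hw, if_false]
      exact continuousOn_kernelTerm (fun h0 => hw ((hmem w).2 (hsub h0)))
        fun h0 => hζsc w (hsub h0)
  have hu' : Summable fun w => |u w| := hu.abs
  have hfu : ∀ w, ∀ η ∈ Γ.contour, ‖f w η‖ ≤ |u w| := by
    intro w η hη
    by_cases hw : w ∈ S
    · simp [hf, hw]
    · simp only [hf, hw, if_false]
      exact (h1 w (fun h0 => hw ((hmem w).2 h0)) η hη).trans (le_abs_self _)
  obtain ⟨hRc, hRs⟩ := hasSum_circleIntegral_mul hr.le (continuousOn_ofReal_density hg) hu' hfc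
    (fun w η hη => hfu w η (hsub hη))
  have hfP : ∀ w, (∮ η in C(c, r), (g η : ℂ) * f w η) = if w ∈ S then 0 else P w := by
    intro w
    by_cases hw : w ∈ S
    · simp [hf, hw, circleIntegral]
    · simp only [hf, hw, if_false]
      exact circleIntegral_mul_kernelTerm h hζs hg (fun h0 => hw ((hmem w).2 h0))
  replace hRs : HasSum (fun w => if w ∈ S then 0 else P w)
      (∮ η in C(c, r), (g η : ℂ) * ∑' w, f w η) := (funext hfP : (fun w => _) = _) ▸ hRs
  have hPsum : HasSum P (∑ w ∈ S, P w + ∮ η in C(c, r), (g η : ℂ) * ∑' w, f w η) := by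
    have h2 : HasSum (fun w => if w ∈ S then P w else 0) (∑ w ∈ S, P w) := by
      have h3 := hasSum_sum_of_ne_finset_zero (f := fun w => if w ∈ S then P w else 0) (s := S)
        (L := .unconditional _) (fun w hw => if_neg hw)
      rwa [Finset.sum_congr rfl (fun w hw => if_pos hw)] at h3
    have h4 : P = fun w => (if w ∈ S then P w else 0) + if w ∈ S then 0 else P w := by
      funext w
      by_cases hw : w ∈ S <;> simp [hw]
    have h5 := h2.add hRs
    rwa [← h4] at h5
  refine ⟨hPsum.summable, ?_⟩
  rw [hPsum.tsum_eq]
  have hy1 : ∀ w ∈ S, Tendsto (fun ε : ℝ => ∮ η in C(c, r), {η : ℂ | ε < dist η ξ}.indicator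
      (fun η => (g η : ℂ) / (η - Γ.comp w.1 z)) η) (𝓝[>] 0)
        (𝓝 (pvCauchy c r g (Γ.comp w.1 z))) ∧
      ∀ ε > 0, CircleIntegrable ({η : ℂ | ε < dist η ξ}.indicator
      (fun η => (g η : ℂ) / (η - Γ.comp w.1 z))) c r := fun w hw =>
    tendsto_pvCauchy_of_imp hr hg fun _ => hzξ w ((hmem w).1 hw)
  have hy2 : ∀ w : SchottkyWord n, Tendsto (fun ε : ℝ => ∮ η in C(c, r),
      {η : ℂ | ε < dist η ξ}.indicator
      (fun η => (g η : ℂ) / (η - Γ.comp w.1 ζs)) η) (𝓝[>] 0)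
        (𝓝 (pvCauchy c r g (Γ.comp w.1 ζs))) ∧
      ∀ ε > 0, CircleIntegrable ({η : ℂ | ε < dist η ξ}.indicator
      (fun η => (g η : ℂ) / (η - Γ.comp w.1 ζs))) c r := fun w =>
    tendsto_pvCauchy_of_imp hr hg fun h0 => absurd (hsub h0) (hζsc w)
  have hgR : ContinuousOn (fun η => (g η : ℂ) * ∑' w, f w η) (Γ.circle l) :=
    (continuousOn_ofReal_density hg).mul hRc
  have hlim := (tendsto_finsetSum S fun w hw => (hy1 w hw).1.sub (hy2 w).1).add
    (tendsto_circleIntegral_indicator hr.ne' (hgR.circleIntegrable hr.le) ξ)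
  refine hlim.congr' ?_
  filter_upwards [self_mem_nhdsWithin] with ε hε
  have hε : 0 < ε := hε
  have hgRi : CircleIntegrable ({η : ℂ | ε < dist η ξ}.indicator
      (fun η => (g η : ℂ) * ∑' w, f w η)) c r := by
    refine circleIntegrable_indicator ?_ hε
    rw [abs_of_pos hr]
    exact hgR.mono Set.sdiff_subset
  have hA : ∀ w ∈ S, CircleIntegrable (fun η =>
      {η : ℂ | ε < dist η ξ}.indicator (fun η => (g η : ℂ) / (η - Γ.comp w.1 z)) η
        - {η : ℂ | ε < dist η ξ}.indicator (fun η => (g η : ℂ) / (η - Γ.comp w.1 ζs)) η) c r :=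
    fun w hw => ((hy1 w hw).2 ε hε).sub ((hy2 w).2 ε hε)
  have hAsum := circleIntegral.integral_fun_sum hA
  rw [Finset.sum_congr rfl fun w hw =>
    circleIntegral.integral_sub ((hy1 w hw).2 ε hε) ((hy2 w).2 ε hε)] at hAsum
  refine (congrArg (· + _) hAsum.symm).trans ?_
  refine (circleIntegral.integral_add (CircleIntegrable.fun_sum S hA) hgRi).symm.trans ?_
  refine circleIntegral.integral_congr hr.le fun η hη => ?_
  by_cases hηξ : ε < dist η ξ
  · simp only [Set.indicator_of_mem (show η ∈ {η : ℂ | ε < dist η ξ} from hηξ)]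
    have hker : Γ.kernel ζs z η = ∑ w ∈ S, Γ.kernelTerm ζs z η w + ∑' w, f w η := by
      have h2 : HasSum (fun w => if w ∈ S then Γ.kernelTerm ζs z η w else 0)
          (∑ w ∈ S, Γ.kernelTerm ζs z η w) := by
        have h3 := hasSum_sum_of_ne_finset_zero (s := S)
          (f := fun w => if w ∈ S then Γ.kernelTerm ζs z η w else 0)
          (L := .unconditional _) (fun w hw => if_neg hw)
        rwa [Finset.sum_congr rfl (fun w hw => if_pos hw)] at h3
      have h4 : HasSum (fun w => f w η) (∑' w, f w η) :=
        (Summable.of_norm_bounded hu' fun w => hfu w η (hsub hη)).hasSum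
      refine Eq.trans (tsum_congr fun w => ?_) (h2.add h4).tsum_eq
      by_cases hw : w ∈ S <;> simp [hf, hw]
    rw [hker, mul_add, Finset.mul_sum]
    congr 1
    refine Finset.sum_congr rfl fun w _ => ?_
    simp only [kernelTerm]
    ring
  · simp only [Set.indicator_of_notMem (show η ∉ {η : ℂ | ε < dist η ξ} from hηξ)]
    simp

end Kernel

end Circles

end Antiplane

namespace Antiplane

open MeasureTheory Metric
open scoped NNReal

namespace Circles

variable {n : ℕ} {Γ : Circles n} {s t : ℝ} {g : Fin n → ℂ → ℝ}

/-! ### The potential of a density -/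

theorem potential_of_notMem {z : ℂ} (hz : z ∉ Γ.contour) :
    Γ.potential g z = 1 / (2 * (π : ℂ)) *
      ∑ l, ∮ η in C(Γ.center l, Γ.radius l), (g l η : ℂ) / (η - z) := by
  rw [potential]
  congr 1
  exact Finset.sum_congr rfl fun l _ =>
    pvCauchy_of_notMem fun h => hz (Γ.circle_subset_contour l h)

theorem Sep.differentiableAt_potential (h : Γ.Sep t) (hg : Γ.LipschitzDensity g) {z : ℂ}
    (hz : z ∉ Γ.contour) : DifferentiableAt ℂ (Γ.potential g) z := by
  have h1 : Γ.potential g =ᶠ[𝓝 z] fun z => 1 / (2 * (π : ℂ)) *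
      ∑ l, ∮ η in C(Γ.center l, Γ.radius l), (g l η : ℂ) / (η - z) := by
    filter_upwards [Γ.isCompact_contour.isClosed.isOpen_compl.mem_nhds hz] with y hy
    exact potential_of_notMem hy
  refine DifferentiableAt.congr_of_eventuallyEq ?_ h1
  refine DifferentiableAt.const_mul (DifferentiableAt.fun_sum fun l _ => ?_) _
  obtain ⟨K, hK⟩ := hg l
  exact differentiableAt_circleIntegral_div_sub (h.radius_pos l) (continuousOn_ofReal_density hK)
    fun h0 => hz (Γ.circle_subset_contour l h0)

theorem Sep.exists_potential_lipschitz (h : Γ.Sep t) (hg : Γ.LipschitzDensity g) {δ : ℝ}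
    (hδ : 0 < δ) : ∃ C ≥ 0, ∀ z z', (∀ η ∈ Γ.contour, δ ≤ dist z η) →
      (∀ η ∈ Γ.contour, δ ≤ dist z' η) →
      ‖Γ.potential g z - Γ.potential g z'‖ ≤ C * dist z z' := by
  have h1 : ∀ l, ∃ C ≥ 0, ∀ z z', (∀ η ∈ Γ.contour, δ ≤ dist z η) →
      (∀ η ∈ Γ.contour, δ ≤ dist z' η) →
      ‖(∮ η in C(Γ.center l, Γ.radius l), (g l η : ℂ) / (η - z))
        - ∮ η in C(Γ.center l, Γ.radius l), (g l η : ℂ) / (η - z')‖ ≤ C * dist z z' := by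
    intro l
    obtain ⟨K, hK⟩ := hg l
    have hr := h.radius_pos l
    obtain ⟨B, hB⟩ := (isCompact_sphere (Γ.center l) (Γ.radius l)).exists_bound_of_continuousOn
      (continuousOn_ofReal_density hK)
    refine ⟨2 * π * Γ.radius l * (|B| / δ ^ 2), by positivity, fun z z' hz hz' => ?_⟩
    exact (norm_circleIntegral_div_sub_sub_le hr (continuousOn_ofReal_density hK)
      (fun η hη => (hB η hη).trans (le_abs_self B)) hδ
      (fun η hη => by rw [dist_comm]; exact hz η (Γ.circle_subset_contour l hη))
      (fun η hη => by rw [dist_comm]; exact hz' η (Γ.circle_subset_contour l hη))).2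
  choose C hC0 hC using h1
  refine ⟨‖1 / (2 * (π : ℂ))‖ * ∑ l, C l,
    mul_nonneg (norm_nonneg _) (Finset.sum_nonneg fun l _ => hC0 l), fun z z' hz hz' => ?_⟩
  have hne : ∀ {y}, (∀ η ∈ Γ.contour, δ ≤ dist y η) → y ∉ Γ.contour := by
    intro y hy h0
    have := hy y h0
    rw [dist_self] at this
    linarith
  rw [potential_of_notMem (hne hz), potential_of_notMem (hne hz'), ← mul_sub,
    ← Finset.sum_sub_distrib, norm_mul, mul_assoc, Finset.sum_mul]
  exact mul_le_mul_of_nonneg_left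
    ((norm_sum_le _ _).trans (Finset.sum_le_sum fun l _ => hC l z z' hz hz')) (norm_nonneg _)

/-- The continuous extension of the potential from the exterior to the circles. -/
noncomputable def extPotential (Γ : Circles n) (g : Fin n → ℂ → ℝ) (z : ℂ) : ℂ :=
  1 / (2 * (π : ℂ)) * ∑ l, cauchyReg (Γ.center l) (Γ.radius l) (g l) z

/-- The continuous extension of the potential from the interior of the `k`-th circle to this
circle. -/
noncomputable def intPotential (Γ : Circles n) (g : Fin n → ℂ → ℝ) (k : Fin n) (z : ℂ) : ℂ :=
  Γ.extPotential g z + Complex.I * g k (radialProj (Γ.center k) (Γ.radius k) z)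

theorem Sep.continuousAt_extPotential (h : Γ.Sep t) (hg : Γ.LipschitzDensity g) {z : ℂ}
    (hz : ∀ k, z ≠ Γ.center k) : ContinuousAt (Γ.extPotential g) z := by
  unfold extPotential
  refine continuousAt_const.mul (tendsto_finsetSum _ fun l _ => ?_)
  obtain ⟨K, hK⟩ := hg l
  exact continuousAt_cauchyReg (h.radius_pos l) hK (hz l)

theorem Sep.continuousAt_intPotential (h : Γ.Sep t) (hg : Γ.LipschitzDensity g) {z : ℂ}
    (hz : ∀ k, z ≠ Γ.center k) (k : Fin n) : ContinuousAt (Γ.intPotential g k) z := by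
  obtain ⟨K, hK⟩ := hg k
  exact (h.continuousAt_extPotential hg hz).add (continuousAt_const.mul
    (Complex.continuous_ofReal.continuousAt.comp
      (continuousAt_comp_radialProj (h.radius_pos k) hK (hz k))))

theorem Sep.exists_extPotential_bound (h : Γ.Sep t) (hg : Γ.LipschitzDensity g) :
    ∃ B, ∀ z, (∀ k, z ≠ Γ.center k) → ‖Γ.extPotential g z‖ ≤ B := by
  choose K hK using hg
  refine ⟨‖1 / (2 * (π : ℂ))‖ * ∑ l, 2 * π * Γ.radius l * (2 * K l), fun z hz => ?_⟩
  rw [extPotential, norm_mul]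
  exact mul_le_mul_of_nonneg_left ((norm_sum_le _ _).trans (Finset.sum_le_sum fun l _ =>
    norm_cauchyReg_le (h.radius_pos l) (hK l) (hz l))) (norm_nonneg _)

theorem Sep.exists_intPotential_bound (h : Γ.Sep t) (hg : Γ.LipschitzDensity g) :
    ∃ B, ∀ k z, (∀ k, z ≠ Γ.center k) → ‖Γ.intPotential g k z‖ ≤ B := by
  obtain ⟨B, hB⟩ := h.exists_extPotential_bound hg
  have h1 : ∀ k, ∃ B', ∀ η ∈ Γ.circle k, ‖(g k η : ℂ)‖ ≤ B' := fun k => by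
    obtain ⟨K, hK⟩ := hg k
    exact (isCompact_sphere (Γ.center k) (Γ.radius k)).exists_bound_of_continuousOn
      (continuousOn_ofReal_density hK)
  choose B' hB' using h1
  have h2 : ∀ k, B' k ≤ ∑ l, |B' l| := fun k => (le_abs_self _).trans
    (Finset.single_le_sum (f := fun l => |B' l|) (fun l _ => abs_nonneg _) (Finset.mem_univ k))
  refine ⟨B + ∑ l, |B' l|, fun k z hz => (norm_add_le _ _).trans (add_le_add (hB z hz) ?_)⟩
  rw [norm_mul, Complex.norm_I, one_mul]
  exact (hB' k _ (radialProj_mem (h.radius_pos k) (hz k))).trans (h2 k)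

theorem Sep.pvCauchy_of_outside (h : Γ.Sep t) (hg : Γ.LipschitzDensity g) {z : ℂ} {l : Fin n}
    (hz : Γ.radius l < dist z (Γ.center l)) :
    pvCauchy (Γ.center l) (Γ.radius l) (g l) z = cauchyReg (Γ.center l) (Γ.radius l) (g l) z := by
  obtain ⟨K, hK⟩ := hg l
  rw [pvCauchy, if_neg hz.ne', circleIntegral_eq_cauchyReg_of_outside (h.radius_pos l) hK hz]

theorem Sep.extPotential_of_mem_ext (h : Γ.Sep t) (hg : Γ.LipschitzDensity g) {z : ℂ}
    (hz : z ∈ Γ.ext) : Γ.extPotential g z = Γ.potential g z := by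
  rw [extPotential, potential]
  congr 1
  exact Finset.sum_congr rfl fun l _ => (h.pvCauchy_of_outside hg (hz l)).symm

theorem Sep.lt_dist_center_of_ne (h : Γ.Sep t) {j k : Fin n} (hjk : k ≠ j) {z : ℂ}
    (hz : dist z (Γ.center j) ≤ Γ.radius j) : Γ.radius k < dist z (Γ.center k) :=
  (h.radius_lt_div k).trans_le (h.lt_dist_of_ne hjk.symm (hz.trans (h.radius_lt_div j).le))

/-- Inside 𝔏_k only the k-th Cauchy integral jumps, by 2πi g_k, which the factor 1/2π turns into i
g_k. On the circle itself the principal value takes half of this jump. -/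
theorem Sep.potential_eq_of_inside (h : Γ.Sep t) (hg : Γ.LipschitzDensity g) {z : ℂ} {k : Fin n}
    (hz : dist z (Γ.center k) < Γ.radius k) (hzk : z ≠ Γ.center k) :
    Γ.potential g z = Γ.intPotential g k z := by
  obtain ⟨K, hK⟩ := hg k
  have h1 : ∀ l, pvCauchy (Γ.center l) (Γ.radius l) (g l) z
      = cauchyReg (Γ.center l) (Γ.radius l) (g l) z
        + if l = k then 2 * π * Complex.I * g k (radialProj (Γ.center k) (Γ.radius k) z)
          else 0 := by
    intro l
    by_cases hl : l = k
    · subst hl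
      rw [if_pos rfl, pvCauchy, if_neg hz.ne,
        circleIntegral_eq_cauchyReg_of_inside (h.radius_pos l) hK hz hzk]
    · rw [if_neg hl, add_zero, h.pvCauchy_of_outside hg (h.lt_dist_center_of_ne hl hz.le)]
  have hpi : (π : ℂ) ≠ 0 := by exact_mod_cast Real.pi_ne_zero
  rw [potential, intPotential, extPotential, Finset.sum_congr rfl fun l _ => h1 l,
    Finset.sum_add_distrib, Finset.sum_ite_eq' Finset.univ k, if_pos (Finset.mem_univ k)]
  field_simp

theorem Sep.potential_eq_of_mem_circle (h : Γ.Sep t) (hg : Γ.LipschitzDensity g) {ξ : ℂ}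
    {j : Fin n} (hξ : ξ ∈ Γ.circle j) :
    Γ.potential g ξ = Γ.extPotential g ξ + Complex.I / 2 * g j ξ := by
  have hξ' : dist ξ (Γ.center j) = Γ.radius j := hξ
  have h1 : ∀ l, pvCauchy (Γ.center l) (Γ.radius l) (g l) ξ
      = cauchyReg (Γ.center l) (Γ.radius l) (g l) ξ
        + if l = j then π * Complex.I * g j ξ else 0 := by
    intro l
    by_cases hl : l = j
    · subst hl
      rw [if_pos rfl, pvCauchy, if_pos hξ']
    · rw [if_neg hl, add_zero, h.pvCauchy_of_outside hg (h.lt_dist_center_of_ne hl hξ'.le)]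
  have hpi : (π : ℂ) ≠ 0 := by exact_mod_cast Real.pi_ne_zero
  rw [potential, extPotential, Finset.sum_congr rfl fun l _ => h1 l,
    Finset.sum_add_distrib, Finset.sum_ite_eq' Finset.univ j, if_pos (Finset.mem_univ j)]
  field_simp

/-! ### Words as (anti)holomorphic maps -/

theorem Sep.ne_center_of_mem_hood (h : Γ.Sep t) {z : ℂ} (hz : z ∈ Γ.hood t) (k : Fin n) :
    z ≠ Γ.center k := dist_pos.1 ((mul_pos h.pos (h.radius_pos k)).trans (hz k))

theorem Sep.comp_tail_ne_center (h : Γ.Sep t) {z : ℂ} (hz : z ∈ Γ.hood t) {k : Fin n}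
    {w : List (Fin n)} (hw : (k :: w).IsChain (· ≠ ·)) : Γ.comp w z ≠ Γ.center k := by
  cases w with
  | nil => exact h.ne_center_of_mem_hood hz k
  | cons j w =>
    rw [List.isChain_cons_cons] at hw
    have h1 := (h.dist_comp_le hw.2 (awayLast_of_mem_hood hz _)).1
    exact dist_pos.1 ((div_pos (h.radius_pos k) h.pos).trans_le (h.lt_dist_of_ne hw.1.symm h1))

theorem conj_T (Γ : Circles n) (k : Fin n) (z : ℂ) :
    conj (Γ.T k z) = conj (Γ.center k) + (Γ.radius k : ℂ) ^ 2 / (z - Γ.center k) := by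
  simp [T]

/-- Each inversion is antiholomorphic, so even words are holomorphic and odd words are conjugates of
holomorphic maps. Both parities must be carried through the induction. -/
theorem Sep.differentiableAt_comp (h : Γ.Sep t) {z : ℂ} (hz : z ∈ Γ.hood t) (w : List (Fin n))
    (hw : w.IsChain (· ≠ ·)) :
    (Even w.length → DifferentiableAt ℂ (Γ.comp w) z) ∧
    (¬ Even w.length → DifferentiableAt ℂ (fun z => conj (Γ.comp w z)) z) := by
  induction w with
  | nil => exact ⟨fun _ => differentiableAt_id, fun h => absurd (by simp) h⟩
  | cons k w ih =>
    obtain ⟨ih1, ih2⟩ := ih hw.tail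
    have hne := h.comp_tail_ne_center hz hw
    constructor
    · intro he
      rw [List.length_cons, Nat.even_add_one] at he
      have h1 : Γ.comp (k :: w) = fun z => Γ.center k +
          (Γ.radius k : ℂ) ^ 2 / (conj (Γ.comp w z) - conj (Γ.center k)) := by
        funext z; simp [T]
      rw [h1]
      have h2 := ih2 he
      have h3 : conj (Γ.comp w z) - conj (Γ.center k) ≠ 0 := by
        rw [← map_sub]; exact (map_ne_zero _).2 (sub_ne_zero.2 hne)
      exact (DifferentiableAt.div (by fun_prop) (h2.sub_const _) h3).const_add _
    · intro he
      rw [List.length_cons, Nat.even_add_one, not_not] at he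
      simp only [comp_cons, conj_T]
      exact (DifferentiableAt.div (by fun_prop) ((ih1 he).sub_const _)
        (sub_ne_zero.2 hne)).const_add _

/-! ### Regular parts of the two series -/

/-- The odd word `σ T_0`. -/
def oddWord [NeZero n] (w : SchottkyWord n) : RedWord n := rmul 0 w.toRed

theorem not_even_oddWord [NeZero n] (w : SchottkyWord n) : ¬ Even (oddWord w).1.length := by
  rw [oddWord, even_length_rmul, not_not]; exact w.2.2

theorem oddWord_injective [NeZero n] :
    Function.Injective (oddWord : SchottkyWord n → RedWord n) :=
  (rmulEquiv (0 : Fin n)).injective.comp SchottkyWord.toRed_injective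

theorem Sep.comp_oddWord [NeZero n] (h : Γ.Sep t) (w : SchottkyWord n) {z : ℂ}
    (hz : z ≠ Γ.center 0) : Γ.comp (oddWord w).1 z = Γ.comp w.1 (Γ.T 0 z) :=
  h.comp_rmul w.toRed hz

/-- The Schottky word `T_k T_0`, or the identity for `k = 0`. -/
def shortWord [NeZero n] (k : Fin n) : SchottkyWord n :=
  ⟨(rmul 0 ⟨[k], List.isChain_singleton k⟩).1, (rmul 0 ⟨[k], List.isChain_singleton k⟩).2,
    (even_length_rmul _ _).2 (by simp)⟩

theorem oddWord_shortWord [NeZero n] (k : Fin n) : (oddWord (shortWord k)).1 = [k] :=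
  congrArg Subtype.val (rmul_rmul 0 (⟨[k], List.isChain_singleton k⟩ : RedWord n))

theorem shortWord_injective [NeZero n] :
    Function.Injective (shortWord : Fin n → SchottkyWord n) := fun j k hjk => by
  have := oddWord_shortWord j
  rw [hjk, oddWord_shortWord] at this
  exact (List.singleton_injective this).symm

theorem exists_shortWord [NeZero n] {w : SchottkyWord n} (hw : (oddWord w).1.length = 1) :
    ∃ k, shortWord k = w := by
  obtain ⟨k, hk⟩ := List.length_eq_one_iff.1 hw
  exact ⟨k, oddWord_injective (Subtype.ext ((oddWord_shortWord k).trans hk.symm))⟩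

/-- The term of `Ψ` that belongs to `σ`, without the singular identity term. -/
noncomputable def evenTerm (Γ : Circles n) (g : Fin n → ℂ → ℝ) (ζs ζ : ℂ)
    (w : SchottkyWord n) : ℂ :=
  (if w.1.length = 0 then 0 else Γ.potential g (Γ.comp w.1 ζ)) - Γ.potential g (Γ.comp w.1 ζs)

/-- The term of `Ψ ∘ T_0` that belongs to `σ`, without the terms singular on the circles. -/
noncomputable def oddTerm [NeZero n] (Γ : Circles n) (g : Fin n → ℂ → ℝ) (ζs ζ : ℂ)
    (w : SchottkyWord n) : ℂ :=
  (if (oddWord w).1.length = 1 then 0 else Γ.potential g (Γ.comp (oddWord w).1 ζ))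
    - Γ.potential g (Γ.comp w.1 ζs)

theorem Sep.le_dist_contour_of_two_le (h : Γ.Sep t) {δ : ℝ}
    (hδ : ∀ k, δ ≤ (1 - t) * Γ.radius k) {z : ℂ} (hz : z ∈ Γ.hood t) {w : List (Fin n)}
    (hw : w.IsChain (· ≠ ·)) (h2 : 2 ≤ w.length) {η : ℂ} (hη : η ∈ Γ.contour) :
    δ ≤ dist (Γ.comp w z) η := by
  match w, hw, h2 with
  | k :: j :: w, hw, _ =>
    have h1 := (h.dist_comp_le hw (awayLast_of_mem_hood hz _)).2 (by simp)
    have := h.le_dist_contour h1 hη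
    have := hδ k
    linarith

theorem two_le_length {w : SchottkyWord n} (hw : w.1.length ≠ 0) : 2 ≤ w.1.length := by
  obtain ⟨m, hm⟩ := w.2.2
  omega

theorem two_le_length_oddWord [NeZero n] {w : SchottkyWord n} (hw : (oddWord w).1.length ≠ 1) :
    2 ≤ (oddWord w).1.length := by
  by_contra h0
  have h1 := not_even_oddWord w
  have h2 : (oddWord w).1.length = 0 := by omega
  rw [h2] at h1
  exact h1 (by simp)

theorem finite_short [NeZero n] : {w : SchottkyWord n | (oddWord w).1.length = 1}.Finite :=
  (Set.finite_range shortWord).subset fun _ hw => exists_shortWord hw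

theorem finite_nil : {w : SchottkyWord n | w.1.length = 0}.Finite :=
  (Set.finite_singleton (⟨[], by simp⟩ : SchottkyWord n)).subset fun _ hw =>
    Subtype.ext (List.length_eq_zero_iff.1 hw)

/-- Words of length at least two keep `hood` at a fixed distance from the circles, where the
potential is Lipschitz, so differences of potentials inherit the summable contraction bounds. One
majorant valid on all of `hood` makes the two remainders analytic across the circles. -/
theorem Sep.exists_term_bound [NeZero n] (hs : Γ.Sep s) (hst : s < t) (ht : Γ.Sep t)
    (hf : Γ.FirstClass) (hg : Γ.LipschitzDensity g) {ζs : ℂ} (hζs : ζs ∈ Γ.ext) :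
    ∃ u : SchottkyWord n → ℝ, Summable u ∧ ∀ ζ ∈ Γ.hood t, ∀ w,
      ‖Γ.evenTerm g ζs ζ w‖ ≤ u w ∧ ‖Γ.oddTerm g ζs ζ w‖ ≤ u w := by
  have hζs' := subset_closure hζs
  obtain ⟨C, hC, hcon⟩ := hs.exists_contraction hst
  obtain ⟨δ₁, hδ₁, h1⟩ := hs.exists_le_dist_orbit hζs
  obtain ⟨δ₂, hδ₂, h2⟩ := exists_pos_le_of_finite (fun k => (1 - t) * Γ.radius k)
    fun k => mul_pos (sub_pos.2 ht.lt_one) (ht.radius_pos k)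
  have hδ : 0 < min δ₁ δ₂ := lt_min hδ₁ hδ₂
  obtain ⟨C', hC', hlip⟩ := hs.exists_potential_lipschitz hg hδ
  have hζsd : ∀ w : SchottkyWord n, ∀ η ∈ Γ.contour, min δ₁ δ₂ ≤ dist (Γ.comp w.1 ζs) η :=
    fun w η hη => (min_le_left _ _).trans (h1 w.toRed η hη)
  have hd : ∀ ζ ∈ Γ.hood t, ∀ w : List (Fin n), w.IsChain (· ≠ ·) → 2 ≤ w.length →
      ∀ η ∈ Γ.contour, min δ₁ δ₂ ≤ dist (Γ.comp w ζ) η := fun ζ hζ w hw hl η hη =>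
    ht.le_dist_contour_of_two_le (fun k => (min_le_right _ _).trans (h2 k)) hζ hw hl hη
  -- `A` pays for the finitely many terms whose singular part was dropped and only the value at the
  -- orbit of ζ_* is left. `E` bounds the even words; `O` bounds the odd ones, passing from ζ to ζ_*
  -- under σT_0 and then from σT_0(ζ_*) to σ(ζ_*).
  set A : SchottkyWord n → ℝ := fun w => if w.1.length = 0 ∨ (oddWord w).1.length = 1 then
    ‖Γ.potential g (Γ.comp w.1 ζs)‖ else 0 with hA
  have hA0 : ∀ w, 0 ≤ A w := fun w => by simp only [hA]; split_ifs <;> positivity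
  have hAs : Summable A := by
    refine summable_of_hasFiniteSupport ((finite_nil.union finite_short).subset fun w hw => ?_)
    by_contra h0
    exact hw (if_neg h0)
  have hρ := hs.summable_isoRad hf
  set E : SchottkyWord n → ℝ := fun w => C' * (C * Γ.isoRad w.1) with hE
  set O : SchottkyWord n → ℝ := fun w => C' * (C * Γ.isoRad (oddWord w).1
    + dist (Γ.comp w.1 (Γ.T 0 ζs)) (Γ.comp w.1 ζs)) with hO
  have hE0 : ∀ w, 0 ≤ E w := fun w => by
    have := Γ.isoRad_nonneg w.1
    simp only [hE]; positivity
  have hO0 : ∀ w, 0 ≤ O w := fun w => by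
    have := Γ.isoRad_nonneg (oddWord w).1
    simp only [hO]; positivity
  have hEs : Summable E :=
    ((hρ.comp_injective (i := SchottkyWord.toRed) SchottkyWord.toRed_injective).mul_left
      C).mul_left C'
  have hOs : Summable O :=
    (((hρ.comp_injective (i := oddWord) oddWord_injective).mul_left C).add
      (hs.summable_orbit_even hf hζs' hζs' [0])).mul_left C'
  refine ⟨fun w => A w + E w + O w, (hAs.add hEs).add hOs, fun ζ hζ w => ⟨?_, ?_⟩⟩
  · rw [evenTerm]
    split_ifs with hw
    · rw [zero_sub, norm_neg]
      have : ‖Γ.potential g (Γ.comp w.1 ζs)‖ = A w := by simp only [hA]; rw [if_pos (Or.inl hw)]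
      rw [this]
      linarith [hE0 w, hO0 w]
    · have h3 := hlip _ _ (hd ζ hζ w.1 w.2.1 (two_le_length hw)) (hζsd w)
      have h4 := hcon w.1 w.2.1 (by rintro h0; simp [h0] at hw) ζ ζs
        (awayLast_of_mem_hood hζ _) (ht.awayLast hζs' _)
      have h5 : ‖Γ.potential g (Γ.comp w.1 ζ) - Γ.potential g (Γ.comp w.1 ζs)‖ ≤ E w :=
        h3.trans (mul_le_mul_of_nonneg_left h4 hC')
      linarith [hA0 w, hO0 w]
  · rw [oddTerm]
    split_ifs with hw
    · rw [zero_sub, norm_neg]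
      have : ‖Γ.potential g (Γ.comp w.1 ζs)‖ = A w := by simp only [hA]; rw [if_pos (Or.inr hw)]
      rw [this]
      linarith [hE0 w, hO0 w]
    · have h3 := hlip _ _ (hd ζ hζ _ (oddWord w).2 (two_le_length_oddWord hw)) (hζsd w)
      have h4 := hcon _ (oddWord w).2
        (by rintro h0; exact not_even_oddWord w (by simp [h0])) ζ ζs
        (awayLast_of_mem_hood hζ _) (ht.awayLast hζs' _)
      have h5 : ‖Γ.potential g (Γ.comp (oddWord w).1 ζ) - Γ.potential g (Γ.comp w.1 ζs)‖
          ≤ O w := by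
        refine h3.trans (mul_le_mul_of_nonneg_left ?_ hC')
        rw [← hs.comp_oddWord w (show ζs ≠ Γ.center 0 from hs.comp_ne_center hζs' [] 0)]
        exact (dist_triangle _ _ _).trans (add_le_add_left h4 _)
      linarith [hA0 w, hE0 w]

/-- The sum of the terms of `Ψ(ζ)` that are regular on the circles. -/
noncomputable def evenRest (Γ : Circles n) (g : Fin n → ℂ → ℝ) (ζs ζ : ℂ) : ℂ :=
  ∑' w, Γ.evenTerm g ζs ζ w

/-- The sum of the terms of `Ψ(T_0(ζ))` that are regular on the circles. -/
noncomputable def oddRest [NeZero n] (Γ : Circles n) (g : Fin n → ℂ → ℝ) (ζs ζ : ℂ) : ℂ :=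
  ∑' w, Γ.oddTerm g ζs ζ w

theorem Sep.notMem_contour_of_two_le (h : Γ.Sep t) {z : ℂ} (hz : z ∈ Γ.hood t)
    {w : List (Fin n)} (hw : w.IsChain (· ≠ ·)) (h2 : 2 ≤ w.length) :
    Γ.comp w z ∉ Γ.contour := by
  intro h0
  obtain ⟨δ, hδ, h3⟩ := exists_pos_le_of_finite (fun k => (1 - t) * Γ.radius k)
    fun k => mul_pos (sub_pos.2 h.lt_one) (h.radius_pos k)
  have := h.le_dist_contour_of_two_le h3 hz hw h2 h0
  rw [dist_self] at this
  linarith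

section Rest

variable [NeZero n] {ζs : ℂ}

theorem Sep.differentiableOn_evenRest (hs : Γ.Sep s) (hst : s < t) (ht : Γ.Sep t)
    (hf : Γ.FirstClass) (hg : Γ.LipschitzDensity g) (hζs : ζs ∈ Γ.ext) :
    DifferentiableOn ℂ (Γ.evenRest g ζs) (Γ.hood t) := by
  obtain ⟨u, hu, hb⟩ := hs.exists_term_bound hst ht hf hg hζs
  refine Complex.differentiableOn_tsum_of_summable_norm hu (fun w z hz => ?_) (isOpen_hood Γ t)
    fun w z hz => (hb z hz w).1
  refine DifferentiableAt.differentiableWithinAt (DifferentiableAt.sub_const ?_ _)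
  split_ifs with hw
  · exact differentiableAt_const _
  · exact (hs.differentiableAt_potential hg
      (ht.notMem_contour_of_two_le hz w.2.1 (two_le_length hw))).comp z
        ((ht.differentiableAt_comp hz w.1 w.2.1).1 w.2.2)

theorem Sep.differentiableOn_conj_oddRest (hs : Γ.Sep s) (hst : s < t) (ht : Γ.Sep t)
    (hf : Γ.FirstClass) (hg : Γ.LipschitzDensity g) (hζs : ζs ∈ Γ.ext) :
    DifferentiableOn ℂ (fun ζ => conj (Γ.oddRest g ζs ζ)) (Γ.hood t) := by
  obtain ⟨u, hu, hb⟩ := hs.exists_term_bound hst ht hf hg hζs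
  have h1 : (fun ζ => conj (Γ.oddRest g ζs ζ)) = fun ζ => ∑' w, conj (Γ.oddTerm g ζs ζ w) := by
    funext ζ
    rw [oddRest, Complex.conj_tsum]
  rw [h1]
  refine Complex.differentiableOn_tsum_of_summable_norm hu (fun w z hz => ?_) (isOpen_hood Γ t)
    fun w z hz => by rw [RCLike.norm_conj]; exact (hb z hz w).2
  simp only [oddTerm, map_sub]
  refine DifferentiableAt.differentiableWithinAt (DifferentiableAt.sub_const ?_ _)
  split_ifs with hw
  · exact differentiableAt_const _
  · have h2 := (ht.differentiableAt_comp hz _ (oddWord w).2).2 (not_even_oddWord w)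
    have h3 := (hs.differentiableAt_potential hg
      (ht.notMem_contour_of_two_le hz (oddWord w).2 (two_le_length_oddWord hw))).conj_conj
    have h4 := DifferentiableAt.comp z h3 h2
    refine h4.congr_of_eventuallyEq (Eventually.of_forall fun y => ?_)
    simp

theorem Sep.exists_rest_bound (hs : Γ.Sep s) (hst : s < t) (ht : Γ.Sep t)
    (hf : Γ.FirstClass) (hg : Γ.LipschitzDensity g) (hζs : ζs ∈ Γ.ext) :
    ∃ B, ∀ ζ ∈ Γ.hood t, ‖Γ.evenRest g ζs ζ‖ ≤ B ∧ ‖Γ.oddRest g ζs ζ‖ ≤ B := by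
  obtain ⟨u, hu, hb⟩ := hs.exists_term_bound hst ht hf hg hζs
  exact ⟨∑' w, u w, fun ζ hζ => ⟨tsum_of_norm_bounded hu.hasSum fun w => (hb ζ hζ w).1,
    tsum_of_norm_bounded hu.hasSum fun w => (hb ζ hζ w).2⟩⟩

theorem Sep.hasSum_even (hs : Γ.Sep s) (hst : s < t) (ht : Γ.Sep t)
    (hf : Γ.FirstClass) (hg : Γ.LipschitzDensity g) (hζs : ζs ∈ Γ.ext) {ζ : ℂ}
    (hζ : ζ ∈ Γ.hood t) :
    HasSum (fun w : SchottkyWord n => Γ.potential g (Γ.comp w.1 ζ)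
      - Γ.potential g (Γ.comp w.1 ζs)) (Γ.potential g ζ + Γ.evenRest g ζs ζ) := by
  obtain ⟨u, hu, hb⟩ := hs.exists_term_bound hst ht hf hg hζs
  have h1 : HasSum (fun w => Γ.evenTerm g ζs ζ w) (Γ.evenRest g ζs ζ) :=
    (Summable.of_norm_bounded hu fun w => (hb ζ hζ w).1).hasSum
  have h2 := hasSum_single (f := fun w : SchottkyWord n =>
    if w.1.length = 0 then Γ.potential g (Γ.comp w.1 ζ) else 0) (⟨[], by simp⟩ : SchottkyWord n)
    fun w hw => if_neg fun h0 => hw (Subtype.ext (List.length_eq_zero_iff.1 h0))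
  have h3 : (fun w : SchottkyWord n => Γ.potential g (Γ.comp w.1 ζ)
      - Γ.potential g (Γ.comp w.1 ζs)) = fun w : SchottkyWord n =>
      (if w.1.length = 0 then Γ.potential g (Γ.comp w.1 ζ) else 0) + Γ.evenTerm g ζs ζ w := by
    funext w
    rw [evenTerm]
    split_ifs <;> ring
  rw [h3]
  exact h2.add h1

/-- As σ runs through the group, σT_0 runs once through the odd reduced words. Those of length one
are the inversions T_k, which carry all the singular terms. -/
theorem Sep.hasSum_odd (hs : Γ.Sep s) (hst : s < t) (ht : Γ.Sep t)
    (hf : Γ.FirstClass) (hg : Γ.LipschitzDensity g) (hζs : ζs ∈ Γ.ext) {ζ : ℂ}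
    (hζ : ζ ∈ Γ.hood t) :
    HasSum (fun w : SchottkyWord n => Γ.potential g (Γ.comp w.1 (Γ.T 0 ζ))
      - Γ.potential g (Γ.comp w.1 ζs)) (∑ k, Γ.potential g (Γ.T k ζ) + Γ.oddRest g ζs ζ) := by
  obtain ⟨u, hu, hb⟩ := hs.exists_term_bound hst ht hf hg hζs
  have h1 : HasSum (fun w => Γ.oddTerm g ζs ζ w) (Γ.oddRest g ζs ζ) :=
    (Summable.of_norm_bounded hu fun w => (hb ζ hζ w).2).hasSum
  set f : SchottkyWord n → ℂ := fun w =>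
    if (oddWord w).1.length = 1 then Γ.potential g (Γ.comp (oddWord w).1 ζ) else 0 with hfdef
  have h2 : HasSum f (∑ k, Γ.potential g (Γ.T k ζ)) := by
    refine (shortWord_injective.hasSum_iff fun w hw => if_neg fun h0 => hw ?_).1 ?_
    · obtain ⟨k, hk⟩ := exists_shortWord h0
      exact ⟨k, hk⟩
    · have h4 : f ∘ shortWord = fun k => Γ.potential g (Γ.T k ζ) := by
        funext k
        simp [hfdef, oddWord_shortWord]
      rw [h4]
      exact hasSum_fintype _
  have h3 : (fun w : SchottkyWord n => Γ.potential g (Γ.comp w.1 (Γ.T 0 ζ))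
      - Γ.potential g (Γ.comp w.1 ζs)) = fun w => f w + Γ.oddTerm g ζs ζ w := by
    funext w
    rw [oddTerm, ← hs.comp_oddWord w (ht.ne_center_of_mem_hood hζ 0)]
    simp only [hfdef]
    split_ifs <;> ring
  rw [h3]
  exact h2.add h1

end Rest

end Circles

end Antiplane

namespace Antiplane

open MeasureTheory Metric
open scoped NNReal

/-! ### Orbits of circle points and construction of the Schwarz operator -/

namespace Circles

variable {n : ℕ} {Γ : Circles n} {s t : ℝ} {g : Fin n → ℂ → ℝ}

theorem Sep.mem_hood_of_mem_circle (h : Γ.Sep t) {j : Fin n} {ξ : ℂ} (hξ : ξ ∈ Γ.circle j) :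
    ξ ∈ Γ.hood t := h.closure_ext_subset_hood (circle_subset_closure_ext h j hξ)

theorem Sep.dist_T_lt (h : Γ.Sep t) {j k : Fin n} (hjk : k ≠ j) {ξ : ℂ} (hξ : ξ ∈ Γ.circle j) :
    dist (Γ.T k ξ) (Γ.center k) < Γ.radius k := by
  have hξ' : dist ξ (Γ.center j) = Γ.radius j := hξ
  have h1 := h.lt_dist_center_of_ne hjk hξ'.le
  have h2 := h.radius_pos k
  rw [dist_T, div_lt_iff₀ (h2.trans h1)]
  nlinarith

theorem Sep.notMem_contour_of_inside (h : Γ.Sep t) {k : Fin n} {y : ℂ}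
    (hy : dist y (Γ.center k) < Γ.radius k) : y ∉ Γ.contour := by
  intro h0
  have := h.le_dist_contour (k := k) (le_refl (dist y (Γ.center k))) h0
  rw [dist_self] at this
  linarith

theorem continuousAt_T {k : Fin n} {z : ℂ} (hz : z ≠ Γ.center k) :
    ContinuousAt (Γ.T k) z := by
  have h1 : conj (z - Γ.center k) ≠ 0 := (map_ne_zero _).2 (sub_ne_zero.2 hz)
  unfold T
  have h2 : ContinuousAt (fun z => conj (z - Γ.center k)) z :=
    Complex.continuous_conj.continuousAt.comp (by fun_prop)
  exact continuousAt_const.add (continuousAt_const.div h2 h1)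

theorem Sep.dist_T_lt_of_mem_ext (h : Γ.Sep t) {z : ℂ} (hz : z ∈ Γ.ext) (k : Fin n) :
    dist (Γ.T k z) (Γ.center k) < Γ.radius k := by
  have h1 := hz k
  have h2 := h.radius_pos k
  rw [dist_T, div_lt_iff₀ (h2.trans h1)]
  nlinarith

theorem notMem_contour_of_mem_ext {z : ℂ} (hz : z ∈ Γ.ext) : z ∉ Γ.contour := by
  intro h0
  obtain ⟨l, hl⟩ := mem_contour.1 h0
  exact (hz l).ne' hl

theorem Sep.dist_orbit_lt (h : Γ.Sep t) {ζs : ℂ} (hζs : ζs ∈ Γ.ext) {k : Fin n} {w : List (Fin n)}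
    (hw : (k :: w).IsChain (· ≠ ·)) :
    dist (Γ.comp (k :: w) ζs) (Γ.center k) < Γ.radius k := by
  cases w with
  | nil => exact h.dist_T_lt_of_mem_ext hζs k
  | cons j w =>
    have h1 := (h.dist_comp_le hw (h.awayLast (subset_closure hζs) _)).2 (by simp)
    nlinarith [h.radius_pos k, h.lt_one]

/-- A nontrivial image of ζ_* lies in the disc of its first letter, so the winding integral merely
reads off that letter. -/
theorem Sep.pvCauchy_one_orbit (h : Γ.Sep t) {ζs : ℂ} (hζs : ζs ∈ Γ.ext) (l : Fin n) (w : RedWord n) :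
    pvCauchy (Γ.center l) (Γ.radius l) (fun _ => 1) (Γ.comp w.1 ζs)
      = if w.1.head? = some l then 2 * π * Complex.I else 0 := by
  rw [pvCauchy_of_notMem fun h0 =>
    h.orbit_notMem_contour hζs w (Γ.circle_subset_contour l h0), Complex.ofReal_one]
  obtain ⟨w, hw⟩ := w
  cases w with
  | nil =>
    rw [if_neg (by simp), comp_nil, circleIntegral_one_div_sub_of_outside (h.radius_pos l) (hζs l)]
  | cons k w =>
    have h1 := h.dist_orbit_lt hζs hw
    by_cases hk : k = l
    · subst hk
      rw [if_pos (by simp), circleIntegral_one_div_sub_of_inside h1]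
    · rw [if_neg (by simpa using hk), circleIntegral_one_div_sub_of_outside (h.radius_pos l)
        (h.lt_dist_center_of_ne (Ne.symm hk) h1.le)]

theorem differentiableAt_conj_T {k : Fin n} {z : ℂ} (hz : z ≠ Γ.center k) :
    DifferentiableAt ℂ (fun z => conj (Γ.T k z)) z := by
  have h1 : z - Γ.center k ≠ 0 := sub_ne_zero.2 hz
  have h2 : DifferentiableAt ℂ (fun y => (Γ.radius k : ℂ) ^ 2 / (y - Γ.center k)) z :=
    (differentiableAt_const _).div (differentiableAt_id.sub_const _) h1
  simp only [conj_T]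
  exact h2.const_add _

section Schwarz

variable [NeZero n] {ζs : ℂ}

/-! ### Principal values of the kernel integrals -/

theorem Sep.tendsto_truncPsi (h : Γ.Sep t) (hg : Γ.LipschitzDensity g) (hζs : ζs ∈ Γ.ext) {z : ℂ}
    (hz : Summable fun w : SchottkyWord n => dist (Γ.comp w.1 z) (Γ.comp w.1 ζs)) {ξ : ℂ}
    (hzξ : ∀ w : SchottkyWord n, Γ.comp w.1 z ∈ Γ.contour → Γ.comp w.1 z = ξ) :
    Tendsto (Γ.truncPsi ζs g z ξ) (𝓝[>] 0) (𝓝 (∑' w : SchottkyWord n,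
      (Γ.potential g (Γ.comp w.1 z) - Γ.potential g (Γ.comp w.1 ζs)))) := by
  have h1 : ∀ l, _ := fun l => h.tendsto_circleIntegral_kernel hζs hz hzξ (hg l).choose_spec
  have h2 : ∑' w : SchottkyWord n,
      (Γ.potential g (Γ.comp w.1 z) - Γ.potential g (Γ.comp w.1 ζs))
      = 1 / (2 * (π : ℂ)) * ∑ l, ∑' w : SchottkyWord n,
        (pvCauchy (Γ.center l) (Γ.radius l) (g l) (Γ.comp w.1 z)
        - pvCauchy (Γ.center l) (Γ.radius l) (g l) (Γ.comp w.1 ζs)) := by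
    rw [← Summable.tsum_finsetSum fun l _ => (h1 l).1, ← tsum_mul_left]
    refine tsum_congr fun w => ?_
    rw [potential, potential, ← mul_sub, Finset.sum_sub_distrib]
  rw [h2]
  exact (tendsto_finsetSum _ fun l _ => (h1 l).2).const_mul _

theorem Sep.tendsto_pvPsi (hs : Γ.Sep s) (hst : s < t) (ht : Γ.Sep t) (hf : Γ.FirstClass)
    (hg : Γ.LipschitzDensity g) (hζs : ζs ∈ Γ.ext) {j : Fin n} {ξ : ℂ} (hξ : ξ ∈ Γ.circle j) :
    Tendsto (Γ.truncPsi ζs g ξ ξ) (𝓝[>] 0) (𝓝 (Γ.pvPsi ζs g ξ ξ)) ∧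
      Γ.pvPsi ζs g ξ ξ = Γ.potential g ξ + Γ.evenRest g ζs ξ := by
  have hξX := circle_subset_closure_ext hs j hξ
  have hξh := ht.mem_hood_of_mem_circle hξ
  have h1 := hs.tendsto_truncPsi hg hζs (z := ξ)
    (hs.summable_orbit_even hf hξX (subset_closure hζs) []) (ξ := ξ) fun w hw => by
      by_cases h0 : w.1.length = 0
      · rw [List.length_eq_zero_iff.1 h0, comp_nil]
      · exact absurd hw (ht.notMem_contour_of_two_le hξh w.2.1 (two_le_length h0))
  rw [(hs.hasSum_even hst ht hf hg hζs hξh).tsum_eq] at h1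
  have h2 : Γ.pvPsi ζs g ξ ξ = Γ.potential g ξ + Γ.evenRest g ζs ξ := h1.limUnder_eq
  exact ⟨h2 ▸ h1, h2⟩

/-- The images σT_0(ξ) are the images of ξ under odd words. Only T_j(ξ) = ξ meets the circles, so
cutting at ξ, rather than at T_0(ξ), removes the one singularity. -/
theorem Sep.tendsto_pvPsi_T (hs : Γ.Sep s) (hst : s < t) (ht : Γ.Sep t) (hf : Γ.FirstClass)
    (hg : Γ.LipschitzDensity g) (hζs : ζs ∈ Γ.ext) {j : Fin n} {ξ : ℂ} (hξ : ξ ∈ Γ.circle j) :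
    Tendsto (Γ.truncPsi ζs g (Γ.T 0 ξ) ξ) (𝓝[>] 0) (𝓝 (Γ.pvPsi ζs g (Γ.T 0 ξ) ξ)) ∧
      Γ.pvPsi ζs g (Γ.T 0 ξ) ξ = ∑ k, Γ.potential g (Γ.T k ξ) + Γ.oddRest g ζs ξ := by
  have hξX := circle_subset_closure_ext hs j hξ
  have hξh := ht.mem_hood_of_mem_circle hξ
  have h1 := hs.tendsto_truncPsi hg hζs (z := Γ.T 0 ξ)
    (hs.summable_orbit_even hf hξX (subset_closure hζs) [0]) (ξ := ξ) fun w hw => by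
      rw [← hs.comp_oddWord w (ht.ne_center_of_mem_hood hξh 0)] at hw ⊢
      by_cases h0 : (oddWord w).1.length = 1
      · obtain ⟨k, rfl⟩ := exists_shortWord h0
        rw [oddWord_shortWord, comp_cons, comp_nil] at hw ⊢
        by_cases hk : k = j
        · subst hk; exact hs.T_of_mem_circle hξ
        · exact absurd hw (hs.notMem_contour_of_inside (hs.dist_T_lt hk hξ))
      · exact absurd hw (ht.notMem_contour_of_two_le hξh (oddWord w).2
          (two_le_length_oddWord h0))
  rw [(hs.hasSum_odd hst ht hf hg hζs hξh).tsum_eq] at h1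
  have h2 : Γ.pvPsi ζs g (Γ.T 0 ξ) ξ = ∑ k, Γ.potential g (Γ.T k ξ) + Γ.oddRest g ζs ξ :=
    h1.limUnder_eq
  exact ⟨h2 ▸ h1, h2⟩

/-! ### The Schwarz operator -/

/-- The function `Ψ(ζ) + conj Ψ(T_0(ζ))` in the exterior of the circles, extended continuously to
the circles. -/
noncomputable def schwarz (Γ : Circles n) (ζs : ℂ) (g : Fin n → ℂ → ℝ) (ζ : ℂ) : ℂ :=
  Γ.extPotential g ζ + ∑ k, conj (Γ.intPotential g k (Γ.T k ζ)) + Γ.evenRest g ζs ζ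
    + conj (Γ.oddRest g ζs ζ)

/-- The exterior limit differs from the principal value at ξ by −(i/2)g_j. The interior limit at
T_j(ξ) = ξ differs by +(i/2)g_j, which conjugation turns into −(i/2)g_j. Together they give −i g_j.
-/
theorem Sep.schwarz_of_mem_circle (hs : Γ.Sep s) (hst : s < t) (ht : Γ.Sep t) (hf : Γ.FirstClass)
    (hg : Γ.LipschitzDensity g) (hζs : ζs ∈ Γ.ext) {j : Fin n} {ξ : ℂ} (hξ : ξ ∈ Γ.circle j) :
    Γ.schwarz ζs g ξ = -Complex.I * g j ξ + Γ.pvPsi ζs g ξ ξ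
      + conj (Γ.pvPsi ζs g (Γ.T 0 ξ) ξ) := by
  rw [(hs.tendsto_pvPsi hst ht hf hg hζs hξ).2, (hs.tendsto_pvPsi_T hst ht hf hg hζs hξ).2, schwarz]
  have h1 : ∀ k, Γ.intPotential g k (Γ.T k ξ) = Γ.potential g (Γ.T k ξ)
      + if k = j then Complex.I / 2 * g j ξ else 0 := by
    intro k
    by_cases hk : k = j
    · subst hk
      rw [if_pos rfl, hs.T_of_mem_circle hξ, intPotential,
        hs.potential_eq_of_mem_circle hg hξ, radialProj_of_mem (hs.radius_pos k) hξ]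
      ring
    · rw [if_neg hk, add_zero, hs.potential_eq_of_inside hg (hs.dist_T_lt hk hξ)
        (hs.T_ne_center (hs.comp_ne_center (circle_subset_closure_ext hs j hξ) [] k))]
  simp only [h1, map_add, map_sum, Finset.sum_add_distrib, apply_ite conj, map_zero, map_mul,
    map_div₀, Complex.conj_I, Complex.conj_ofReal, Finset.sum_ite_eq', Finset.mem_univ, if_true,
    hs.potential_eq_of_mem_circle hg hξ, map_ofNat]
  ring

theorem Sep.continuousOn_schwarz (hs : Γ.Sep s) (hst : s < t) (ht : Γ.Sep t) (hf : Γ.FirstClass)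
    (hg : Γ.LipschitzDensity g) (hζs : ζs ∈ Γ.ext) :
    ContinuousOn (Γ.schwarz ζs g) (closure Γ.ext) := by
  have hX := ht.closure_ext_subset_hood
  have h1 := (hs.differentiableOn_evenRest hst ht hf hg hζs).continuousOn.mono hX
  have h2 := (hs.differentiableOn_conj_oddRest hst ht hf hg hζs).continuousOn.mono hX
  refine (ContinuousOn.add (fun z hz => ContinuousAt.continuousWithinAt ?_) h1).add h2
  refine (hs.continuousAt_extPotential hg fun k => hs.comp_ne_center hz [] k).add
    (tendsto_finsetSum _ fun k _ => ?_)
  have h3 := (hs.continuousAt_intPotential hg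
    (fun l => hs.comp_ne_center hz [k] l) k).comp
    (continuousAt_T (hs.comp_ne_center hz [] k))
  exact Complex.continuous_conj.continuousAt.comp h3

theorem Sep.schwarz_of_mem_ext (hs : Γ.Sep s) (hg : Γ.LipschitzDensity g) {ζ : ℂ}
    (hζ : ζ ∈ Γ.ext) :
    Γ.schwarz ζs g ζ = Γ.potential g ζ + ∑ k, conj (Γ.potential g (Γ.T k ζ))
      + Γ.evenRest g ζs ζ + conj (Γ.oddRest g ζs ζ) := by
  have h1 : ∀ k, Γ.intPotential g k (Γ.T k ζ) = Γ.potential g (Γ.T k ζ) := fun k =>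
    (hs.potential_eq_of_inside hg (hs.dist_T_lt_of_mem_ext hζ k)
      (hs.T_ne_center (hs.comp_ne_center (subset_closure hζ) [] k))).symm
  rw [schwarz, hs.extPotential_of_mem_ext hg hζ]
  simp only [h1]

theorem Sep.differentiableOn_schwarz (hs : Γ.Sep s) (hst : s < t) (ht : Γ.Sep t)
    (hf : Γ.FirstClass) (hg : Γ.LipschitzDensity g) (hζs : ζs ∈ Γ.ext) :
    DifferentiableOn ℂ (Γ.schwarz ζs g) Γ.ext := by
  have hX : Γ.ext ⊆ Γ.hood t := subset_closure.trans ht.closure_ext_subset_hood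
  have h1 := (hs.differentiableOn_evenRest hst ht hf hg hζs).mono hX
  have h2 := (hs.differentiableOn_conj_oddRest hst ht hf hg hζs).mono hX
  refine DifferentiableOn.congr ((DifferentiableOn.add (fun z hz =>
    DifferentiableAt.differentiableWithinAt ?_) h1).add h2)
    fun z hz => hs.schwarz_of_mem_ext hg hz
  refine (hs.differentiableAt_potential hg (notMem_contour_of_mem_ext hz)).add
    (DifferentiableAt.fun_sum fun k _ => ?_)
  have h3 := (hs.differentiableAt_potential hg
    (hs.notMem_contour_of_inside (hs.dist_T_lt_of_mem_ext hz k))).conj_conj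
  have h4 := differentiableAt_conj_T (hs.comp_ne_center (subset_closure hz) [] k)
  have h6 := DifferentiableAt.comp z h3 h4
  refine h6.congr_of_eventuallyEq (Eventually.of_forall fun y => ?_)
  simp

theorem Sep.exists_schwarz_bound (hs : Γ.Sep s) (hst : s < t) (ht : Γ.Sep t)
    (hf : Γ.FirstClass) (hg : Γ.LipschitzDensity g) (hζs : ζs ∈ Γ.ext) :
    ∃ B, ∀ ζ ∈ closure Γ.ext, ‖Γ.schwarz ζs g ζ‖ ≤ B := by
  obtain ⟨B₁, h1⟩ := hs.exists_extPotential_bound hg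
  obtain ⟨B₂, h2⟩ := hs.exists_intPotential_bound hg
  obtain ⟨B₃, h3⟩ := hs.exists_rest_bound hst ht hf hg hζs
  refine ⟨B₁ + ∑ _k : Fin n, B₂ + B₃ + B₃, fun ζ hζ => ?_⟩
  obtain ⟨h4, h5⟩ := h3 ζ (ht.closure_ext_subset_hood hζ)
  refine (norm_add_le _ _).trans (add_le_add ((norm_add_le _ _).trans (add_le_add
    ((norm_add_le _ _).trans (add_le_add (h1 ζ fun k => hs.comp_ne_center hζ [] k)
      ((norm_sum_le _ _).trans (Finset.sum_le_sum fun k _ => ?_)))) h4)) ?_)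
  · rw [RCLike.norm_conj]
    exact h2 k _ fun l => hs.comp_ne_center hζ [k] l
  · rwa [RCLike.norm_conj]

/-! ### Quasiautomorphy -/

/-- Right multiplication by `σ_j = T_j T_0` as a permutation of the Schottky group. -/
def mulSigma (j : Fin n) : SchottkyWord n ≃ SchottkyWord n where
  toFun w := ⟨(rmul 0 (rmul j w.toRed)).1, (rmul 0 (rmul j w.toRed)).2, by
    rw [even_length_rmul, even_length_rmul, not_not]; exact w.2.2⟩
  invFun w := ⟨(rmul j (rmul 0 w.toRed)).1, (rmul j (rmul 0 w.toRed)).2, by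
    rw [even_length_rmul, even_length_rmul, not_not]; exact w.2.2⟩
  left_inv w := by
    apply Subtype.ext
    change (rmul j (rmul 0 (rmul 0 (rmul j w.toRed)))).1 = w.1
    rw [rmul_rmul, rmul_rmul]; rfl
  right_inv w := by
    apply Subtype.ext
    change (rmul 0 (rmul j (rmul j (rmul 0 w.toRed)))).1 = w.1
    rw [rmul_rmul, rmul_rmul]; rfl

theorem mulSigma_val (j : Fin n) (w : SchottkyWord n) :
    (mulSigma j w).1 = (rmul 0 (rmul j w.toRed)).1 := rfl

theorem Sep.comp_mulSigma (h : Γ.Sep t) {j : Fin n} (w : SchottkyWord n) {z : ℂ}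
    (h0 : z ≠ Γ.center 0) (hj : Γ.T 0 z ≠ Γ.center j) :
    Γ.comp (mulSigma j w).1 z = Γ.comp w.1 (Γ.T j (Γ.T 0 z)) := by
  rw [mulSigma_val, h.comp_rmul _ h0, h.comp_rmul _ hj]; rfl

theorem Sep.comp_mulSigma_base (h : Γ.Sep t) {j : Fin n} (w : SchottkyWord n)
    (hζs : ζs ∈ Γ.ext) :
    Γ.comp (mulSigma j w).1 ζs = Γ.comp w.1 (Γ.T j (Γ.T 0 ζs)) :=
  h.comp_mulSigma w (h.comp_ne_center (subset_closure hζs) [] 0)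
    (h.comp_ne_center (subset_closure hζs) [0] j)

/-- The points σσ_j(ζ_*) are again in the orbit of ζ_*, hence off the circles, so χ_{σ_j} is
continuous there and integrates termwise. -/
theorem Sep.hasSum_chi (h : Γ.Sep t) (hf : Γ.FirstClass) (hζs : ζs ∈ Γ.ext) (j l : Fin n)
    {φ : ℂ → ℝ} {K : ℝ≥0} (hφ : LipschitzOnWith K φ (Γ.circle l)) :
    ContinuousOn (Γ.chi ζs j) (Γ.circle l) ∧
    HasSum (fun w : SchottkyWord n =>
      pvCauchy (Γ.center l) (Γ.radius l) φ (Γ.comp (mulSigma j w).1 ζs)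
        - pvCauchy (Γ.center l) (Γ.radius l) φ (Γ.comp w.1 ζs))
      (∮ η in C(Γ.center l, Γ.radius l), (φ η : ℂ) * Γ.chi ζs j η) := by
  simp only [h.comp_mulSigma_base _ hζs]
  refine h.hasSum_circleIntegral_kernel hζs (h.summable_orbit_even hf (subset_closure hζs)
    (subset_closure hζs) [j, 0]) (fun w => ?_) hφ
  rw [← h.comp_mulSigma_base w hζs]
  exact h.orbit_notMem_contour hζs (mulSigma j w).toRed

/-- `Ψ(ξ) - Ψ(T_0(ξ))` for `ξ ∈ 𝔏_j`. -/
theorem Sep.pvPsi_sub_pvPsi_T (hs : Γ.Sep s) (hst : s < t) (ht : Γ.Sep t) (hf : Γ.FirstClass)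
    (hg : Γ.LipschitzDensity g) (hζs : ζs ∈ Γ.ext) {j : Fin n} {ξ : ℂ} (hξ : ξ ∈ Γ.circle j) :
    Γ.pvPsi ζs g ξ ξ - Γ.pvPsi ζs g (Γ.T 0 ξ) ξ = 1 / (2 * (π : ℂ)) *
      ∑ l, ∮ η in C(Γ.center l, Γ.radius l), (g l η : ℂ) * Γ.chi ζs j η := by
  have hξX := circle_subset_closure_ext hs j hξ
  have hξh := ht.mem_hood_of_mem_circle hξ
  rw [(hs.tendsto_pvPsi hst ht hf hg hζs hξ).2, (hs.tendsto_pvPsi_T hst ht hf hg hζs hξ).2]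
  have h1 := hs.hasSum_even hst ht hf hg hζs hξh
  have h2 := (mulSigma j).hasSum_iff.2 (hs.hasSum_odd hst ht hf hg hζs hξh)
  have h3 := h1.sub h2
  have h4 := (hasSum_sum (s := Finset.univ) fun l _ =>
    (hs.hasSum_chi hf hζs j l (hg l).choose_spec).2).mul_left (1 / (2 * (π : ℂ)))
  refine h3.unique (Eq.mp ?_ h4)
  congr 1
  funext w
  -- σ_j T_0(ξ) = T_j(ξ) = ξ. After reindexing by σ ↦ σσ_j, the odd series therefore has the same
  -- potentials at the orbit of ξ as the even one, and only terms at the orbit of ζ_* remain in the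
  -- difference.
  have h5 : Γ.comp (mulSigma j w).1 (Γ.T 0 ξ) = Γ.comp w.1 ξ := by
    have hne : ξ ≠ Γ.center 0 := hs.comp_ne_center hξX [] 0
    rw [hs.comp_mulSigma w (hs.T_ne_center hne)
      (by rw [hs.T_T hne]; exact hs.comp_ne_center hξX [] j), hs.T_T hne, hs.T_of_mem_circle hξ]
  simp only [Function.comp, h5, potential, Finset.sum_sub_distrib]
  ring

/-- Term by term the integral compares the first letters of σσ_j and σ. Right multiplication leaves
the first letter unchanged except for σ = 1, where σσ_j begins with j, and σ = T_0T_j, where σσ_j =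
1 and the letter 0 is lost. -/
theorem Sep.circleIntegral_chi (h : Γ.Sep t) (hf : Γ.FirstClass) (hζs : ζs ∈ Γ.ext) {j : Fin n}
    (hj : j ≠ 0) (l : Fin n) :
    (∮ η in C(Γ.center l, Γ.radius l), Γ.chi ζs j η)
      = (if l = j then 2 * π * Complex.I else 0) - if l = 0 then 2 * π * Complex.I else 0 := by
  classical
  have h1 := (h.hasSum_chi hf hζs j l (φ := fun _ => 1) (K := 0)
    (LipschitzWith.const 1).lipschitzOnWith).2
  simp only [Complex.ofReal_one, one_mul] at h1
  have e1 : ∀ w : SchottkyWord n, pvCauchy (Γ.center l) (Γ.radius l) (fun _ => 1)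
      (Γ.comp (mulSigma j w).1 ζs) = _ := fun w => h.pvCauchy_one_orbit hζs l (mulSigma j w).toRed
  have e2 : ∀ w : SchottkyWord n, pvCauchy (Γ.center l) (Γ.radius l) (fun _ => 1)
      (Γ.comp w.1 ζs) = _ := fun w => h.pvCauchy_one_orbit hζs l w.toRed
  simp only [e1, e2] at h1
  set f : SchottkyWord n → ℂ := fun w =>
    (if (mulSigma j w).1.head? = some l then 2 * π * Complex.I else 0)
      - if w.1.head? = some l then 2 * π * Complex.I else 0 with hfdef
  let a : SchottkyWord n := ⟨[], by simp⟩
  let b : SchottkyWord n := ⟨[0, j], by simp [hj.symm], by simp⟩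
  have e3 : rmul j b.toRed = ⟨[0], List.isChain_singleton 0⟩ := by
    have e5 : (rmul j (⟨[0], List.isChain_singleton 0⟩ : RedWord n)).1 = [0, j] :=
      rmul_of_not_last (by simpa using hj.symm)
    have e6 : b.toRed = rmul j ⟨[0], List.isChain_singleton 0⟩ := Subtype.ext e5.symm
    rw [e6, rmul_rmul]
  have hab : a ≠ b := fun h0 => by
    have := congrArg (fun w : SchottkyWord n => w.1.length) h0
    simp [a, b] at this
  have hja : (rmul j a.toRed).1 = [j] := rmul_of_not_last (by simp [a, SchottkyWord.toRed])
  have hma : (mulSigma j a).1 = [j, 0] := by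
    rw [mulSigma_val, rmul_of_not_last (by rw [hja]; simpa using hj), hja]; rfl
  have hmb : (mulSigma j b).1 = [] := by
    have e4 : rmul 0 (⟨[], List.isChain_nil⟩ : RedWord n) = ⟨[0], List.isChain_singleton 0⟩ :=
      Subtype.ext (rmul_of_not_last (by simp))
    rw [mulSigma_val, e3, ← e4, rmul_rmul]
  have h2 : HasSum f (∑ w ∈ ({a, b} : Finset (SchottkyWord n)), f w) := by
    refine hasSum_sum_of_ne_finset_zero fun w hw => ?_
    have hwa : w.1 ≠ [] := fun h0 => hw (by
      rw [Finset.mem_insert]; exact Or.inl (Subtype.ext h0))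
    have hlen : ¬ Even (rmul j w.toRed).1.length := by
      rw [even_length_rmul, not_not]; exact w.2.2
    have hwj : w.toRed.1 ≠ [j] := fun h0 => by
      have := w.2.2
      rw [show w.1 = [j] from h0] at this
      simp at this
    have hu0 : (rmul j w.toRed).1 ≠ [] := fun h0 => by simp [h0] at hlen
    have hu1 : (rmul j w.toRed).1 ≠ [0] := fun h0 => hw (by
      rw [Finset.mem_insert, Finset.mem_singleton]
      right
      have e5 : rmul j w.toRed = rmul j b.toRed := by
        apply Subtype.ext
        rw [h0, e3]
      exact SchottkyWord.toRed_injective ((rmulEquiv j).injective e5))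
    have e6 : (mulSigma j w).1.head? = w.1.head? := by
      rw [mulSigma_val, head?_rmul hu0 hu1, head?_rmul (w := w.toRed) hwa hwj]; rfl
    simp only [hfdef, e6, sub_self]
  have h3 := h1.unique h2
  rw [h3, Finset.sum_pair hab]
  simp only [hfdef, hma, hmb]
  simp [a, b, eq_comm, sub_eq_add_neg]

/-- The choice of the constants that makes `Ψ + conj (Ψ ∘ T_0)` solve the Schwarz problem. -/
theorem Sep.im_pvPsi_sub_eq_zero (hs : Γ.Sep s) (hst : s < t) (ht : Γ.Sep t) (hf : Γ.FirstClass)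
    (hζs : ζs ∈ Γ.ext) {G : Fin n → ℂ → ℝ} (hG : Γ.LipschitzDensity G) {A : Fin n → ℝ}
    (hg : Γ.LipschitzDensity fun l η => G l η - A l)
    (hA : ∀ j, j ≠ 0 → A j = A 0 + 1 / (2 * π) *
      (∑ l, ∮ η in C(Γ.center l, Γ.radius l), (G l η : ℂ) * Γ.chi ζs j η).im)
    {j : Fin n} {ξ : ℂ} (hξ : ξ ∈ Γ.circle j) :
    (Γ.pvPsi ζs (fun l η => G l η - A l) ξ ξ
      - Γ.pvPsi ζs (fun l η => G l η - A l) (Γ.T 0 ξ) ξ).im = 0 := by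
  by_cases hj : j = 0
  · subst hj
    rw [hs.T_of_mem_circle hξ, sub_self, Complex.zero_im]
  rw [hs.pvPsi_sub_pvPsi_T hst ht hf hg hζs hξ]
  have h1 : ∀ l, (∮ η in C(Γ.center l, Γ.radius l), ((G l η - A l : ℝ) : ℂ) * Γ.chi ζs j η)
      = (∮ η in C(Γ.center l, Γ.radius l), (G l η : ℂ) * Γ.chi ζs j η)
        - A l * ((if l = j then 2 * π * Complex.I else 0)
          - if l = 0 then 2 * π * Complex.I else 0) := by
    intro l
    obtain ⟨K, hK⟩ := hG l
    have hχ := (hs.hasSum_chi hf hζs j l hK).1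
    have hr := (hs.radius_pos l).le
    have i1 : CircleIntegrable (fun η => (G l η : ℂ) * Γ.chi ζs j η) (Γ.center l) (Γ.radius l) :=
      ((continuousOn_ofReal_density hK).mul hχ).circleIntegrable hr
    have i2 : CircleIntegrable (fun η => (A l : ℂ) * Γ.chi ζs j η) (Γ.center l) (Γ.radius l) :=
      (continuousOn_const.mul hχ).circleIntegrable hr
    rw [← hs.circleIntegral_chi hf hζs hj l, ← circleIntegral.integral_const_mul,
      ← circleIntegral.integral_sub i1 i2]
    refine circleIntegral.integral_congr hr fun η _ => ?_
    push_cast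
    ring
  have h2 := hA j hj
  simp only [h1, Finset.sum_sub_distrib, mul_sub, mul_ite, mul_zero, Finset.sum_ite_eq',
    Finset.mem_univ, if_true]
  set S := ∑ l, ∮ η in C(Γ.center l, Γ.radius l), (G l η : ℂ) * Γ.chi ζs j η
  have hpi : (π : ℂ) ≠ 0 := by exact_mod_cast Real.pi_ne_zero
  have h3 : 1 / (2 * (π : ℂ)) * S - (1 / (2 * (π : ℂ)) * (A j * (2 * π * Complex.I))
      - 1 / (2 * (π : ℂ)) * (A 0 * (2 * π * Complex.I)))
      = ((1 / (2 * π) : ℝ) : ℂ) * S - ((A j - A 0 : ℝ) : ℂ) * Complex.I := by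
    push_cast
    field_simp
  -- Subtracting A from the density lowers the constant by i(A_j − A_0), and by `hA` this is exactly
  -- its imaginary part.
  rw [h3, Complex.sub_im, Complex.im_ofReal_mul, Complex.im_ofReal_mul, Complex.I_im]
  linarith

end Schwarz

end Circles

end Antiplane

namespace Antiplane

open MeasureTheory Metric
open scoped NNReal

/-! ### The density of the first problem -/

section ImLinear

variable {c₀ : ℂ} {r : ℝ}

theorem lipschitzOnWith_im_linear (c : ℂ) (a : ℝ) (s : Set ℂ) :
    LipschitzOnWith ‖c‖₊ (fun η : ℂ => (c * η).im - a) s := by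
  refine LipschitzOnWith.of_dist_le_mul fun x _ y _ => ?_
  rw [Real.dist_eq, sub_sub_sub_cancel_right, ← Complex.sub_im, ← mul_sub, coe_nnnorm, dist_eq_norm,
    ← norm_mul]
  exact Complex.abs_im_le_norm _

/-- The Cauchy integral of `Im (c η) - a`, in terms of that of the constant density. -/
theorem circleIntegral_im_linear_div_sub (hr : 0 < r) (c : ℂ) (a : ℝ) {z : ℂ}
    (hz : z ∉ sphere c₀ r) (hzc : z ≠ c₀) :
    (∮ η in C(c₀, r), (((c * η).im - a : ℝ) : ℂ) / (η - z))
      = ((c * z - conj c * conj c₀) / (2 * Complex.I) - a) * (∮ η in C(c₀, r), 1 / (η - z))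
        - conj c * r ^ 2 / (2 * Complex.I) / (z - c₀)
          * ((∮ η in C(c₀, r), 1 / (η - z)) - 2 * π * Complex.I) := by
  have h0 : (∮ η in C(c₀, r), 1 / (η - c₀)) = 2 * π * Complex.I :=
    circleIntegral_one_div_sub_of_inside (by simpa using hr)
  have hne : ∀ y, y ∉ sphere c₀ r → ∀ η ∈ sphere c₀ r, η - y ≠ 0 := fun y hy η hη h =>
    hy (sub_eq_zero.1 h ▸ hη)
  have hc₀ : c₀ ∉ sphere c₀ r := by simpa using hr.ne
  have int : ∀ y, y ∉ sphere c₀ r → CircleIntegrable (fun η => 1 / (η - y)) c₀ r := fun y hy =>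
    (continuousOn_const.div (by fun_prop) (hne y hy)).circleIntegrable hr.le
  have hconst : (∮ _η in C(c₀, r), c / (2 * Complex.I)) = 0 := by
    rw [← mul_one (c / (2 * Complex.I)), circleIntegral.integral_const_mul]
    have := circleIntegral.integral_sub_zpow_of_ne (n := 0) (by norm_num) c₀ c₀ r
    simp only [zpow_zero] at this
    rw [this, mul_zero]
  set p : ℂ := (c * z - conj c * conj c₀) / (2 * Complex.I) - a with hp
  set q : ℂ := conj c * r ^ 2 / (2 * Complex.I) / (z - c₀) with hq
  have i1 : CircleIntegrable (fun η => p * (1 / (η - z))) c₀ r := (int z hz).const_smul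
  have i2 : CircleIntegrable (fun η => q * (1 / (η - z) - 1 / (η - c₀))) c₀ r :=
    ((int z hz).sub (int c₀ hc₀)).const_smul
  have i3 : CircleIntegrable (fun η => p * (1 / (η - z)) - q * (1 / (η - z) - 1 / (η - c₀))) c₀ r :=
    i1.sub i2
  rw [← h0, ← circleIntegral.integral_sub (int z hz) (int c₀ hc₀),
    ← circleIntegral.integral_const_mul, ← circleIntegral.integral_const_mul,
    ← circleIntegral.integral_sub i1 i2,
    ← zero_add (∮ η in C(c₀, r), p * (1 / (η - z)) - q * (1 / (η - z) - 1 / (η - c₀))), ← hconst,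
    ← circleIntegral.integral_add (circleIntegrable_const _ _ _) i3]
  refine circleIntegral.integral_congr hr.le fun η hη => ?_
  have h1 := hne z hz η hη
  have h2 := hne c₀ hc₀ η hη
  have h3 : z - c₀ ≠ 0 := sub_ne_zero.2 hzc
  -- On the circle conj η = conj c₀ + r²/(η − c₀), so the density is rational in η. The constants p
  -- and q come from its partial fractions after division by η − z, whose polynomial part integrates
  -- to zero (`hconst`).
  have h4 : conj η = conj c₀ + r ^ 2 / (η - c₀) := by
    have : (η - c₀) * conj (η - c₀) = r ^ 2 := by
      rw [Complex.mul_conj, Complex.normSq_eq_norm_sq, ← dist_eq_norm, mem_sphere.1 hη]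
      norm_cast
    rw [← this, map_sub]
    field_simp
    ring
  have h5 : (((c * η).im : ℝ) : ℂ) = (c * η - conj c * conj η) / (2 * Complex.I) := by
    rw [Complex.im_eq_sub_conj, map_mul]
  push_cast
  rw [h5, h4, hp, hq]
  have hI := Complex.I_ne_zero
  have h6 := Complex.I_sq
  field_simp
  ring

theorem circleIntegral_im_linear_div_sub_of_outside (hr : 0 < r) (c : ℂ) (a : ℝ) {z : ℂ}
    (hz : r < dist z c₀) :
    1 / (2 * (π : ℂ)) * (∮ η in C(c₀, r), (((c * η).im - a : ℝ) : ℂ) / (η - z))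
      = conj c * r ^ 2 / 2 / (z - c₀) := by
  have h1 : z ≠ c₀ := dist_pos.1 (hr.trans hz)
  rw [circleIntegral_im_linear_div_sub hr c a (fun h => hz.ne' h) h1,
    circleIntegral_one_div_sub_of_outside hr hz]
  have h2 : z - c₀ ≠ 0 := sub_ne_zero.2 h1
  have hpi : (π : ℂ) ≠ 0 := by exact_mod_cast Real.pi_ne_zero
  have hI := Complex.I_ne_zero
  field_simp
  ring

theorem circleIntegral_im_linear_div_sub_of_inside (hr : 0 < r) (c : ℂ) (a : ℝ) {z : ℂ}
    (hz : dist z c₀ < r) (h1 : z ≠ c₀) :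
    1 / (2 * (π : ℂ)) * (∮ η in C(c₀, r), (((c * η).im - a : ℝ) : ℂ) / (η - z))
      = (c * z - conj c * conj c₀) / 2 - Complex.I * a := by
  rw [circleIntegral_im_linear_div_sub hr c a (fun h => hz.ne h) h1,
    circleIntegral_one_div_sub_of_inside hz]
  have hpi : (π : ℂ) ≠ 0 := by exact_mod_cast Real.pi_ne_zero
  have hI := Complex.I_ne_zero
  field_simp
  ring

end ImLinear

namespace Circles

section ImLinear

variable {n : ℕ} {Γ : Circles n} {s t : ℝ} {c : ℂ} {a : Fin n → ℝ}

theorem lipschitzDensity_im_linear (Γ : Circles n) (c : ℂ) (a : Fin n → ℝ) :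
    Γ.LipschitzDensity fun l η => (c * η).im - a l := fun l =>
  ⟨‖c‖₊, lipschitzOnWith_im_linear c (a l) _⟩

/-- The potential of the density `Im (c η) - a_l` in the exterior of the circles. -/
noncomputable def linearPotential (Γ : Circles n) (c : ℂ) (z : ℂ) : ℂ :=
  ∑ l, conj c * (Γ.radius l : ℂ) ^ 2 / 2 / (z - Γ.center l)

/-- The potential of the density `Im (c η) - a_l` inside `𝔏_k`, continued analytically to all points
other than the centres. -/
noncomputable def linearPotentialInside (Γ : Circles n) (c : ℂ) (a : Fin n → ℝ) (k : Fin n)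
    (z : ℂ) : ℂ :=
  Γ.linearPotential c z - conj c * (Γ.radius k : ℂ) ^ 2 / 2 / (z - Γ.center k)
    + ((c * z - conj c * conj (Γ.center k)) / 2 - Complex.I * a k)

theorem differentiableAt_linearPotential {z : ℂ} (hz : ∀ l, z ≠ Γ.center l) :
    DifferentiableAt ℂ (Γ.linearPotential c) z := by
  unfold linearPotential
  refine DifferentiableAt.fun_sum fun l _ => ?_
  exact (differentiableAt_const _).div (by fun_prop) (sub_ne_zero.2 (hz l))

theorem differentiableAt_linearPotentialInside {z : ℂ} (hz : ∀ l, z ≠ Γ.center l) (k : Fin n) :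
    DifferentiableAt ℂ (Γ.linearPotentialInside c a k) z := by
  unfold linearPotentialInside
  refine ((differentiableAt_linearPotential hz).sub ?_).add (by fun_prop)
  exact (differentiableAt_const _).div (by fun_prop) (sub_ne_zero.2 (hz k))

theorem Sep.potential_im_linear_of_mem_ext (h : Γ.Sep t) {z : ℂ} (hz : z ∈ Γ.ext) :
    Γ.potential (fun l η => (c * η).im - a l) z = Γ.linearPotential c z := by
  rw [potential_of_notMem (notMem_contour_of_mem_ext hz), Finset.mul_sum]
  exact Finset.sum_congr rfl fun l _ =>
    circleIntegral_im_linear_div_sub_of_outside (h.radius_pos l) c (a l) (hz l)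

theorem Sep.potential_im_linear_of_inside (h : Γ.Sep t) {z : ℂ} {k : Fin n}
    (hz : dist z (Γ.center k) < Γ.radius k) (hzk : z ≠ Γ.center k) :
    Γ.potential (fun l η => (c * η).im - a l) z = Γ.linearPotentialInside c a k z := by
  rw [potential_of_notMem (h.notMem_contour_of_inside hz), Finset.mul_sum, linearPotentialInside,
    linearPotential, ← Finset.add_sum_erase _ _ (Finset.mem_univ k),
    ← Finset.add_sum_erase _ (fun l => conj c * (Γ.radius l : ℂ) ^ 2 / 2 / (z - Γ.center l))
      (Finset.mem_univ k),
    circleIntegral_im_linear_div_sub_of_inside (h.radius_pos k) c (a k) hz hzk,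
    Finset.sum_congr rfl fun l hl =>
      circleIntegral_im_linear_div_sub_of_outside (h.radius_pos l) c (a l)
        (h.lt_dist_center_of_ne (Finset.ne_of_mem_erase hl) hz.le)]
  ring

/-- T_k sends `hood` into a disc of radius r_k/t about its centre, free of the other centres. Hence
the poles of the explicit interior potential are avoided when its formula is continued across 𝔏_k.
-/
theorem Sep.T_ne_center_of_mem_hood (h : Γ.Sep t) {z : ℂ} (hz : z ∈ Γ.hood t) (k l : Fin n) :
    Γ.T k z ≠ Γ.center l := by
  have h1 := h.ne_center_of_mem_hood hz k
  by_cases hlk : l = k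
  · subst hlk
    exact h.T_ne_center h1
  · have h2 : dist (Γ.T k z) (Γ.center k) ≤ Γ.radius k / t := by
      rw [dist_T, div_le_div_iff₀ (dist_pos.2 h1) h.pos]
      nlinarith [hz k, h.radius_pos k]
    have h3 := h.lt_dist_of_ne (Ne.symm hlk) h2
    exact dist_pos.1 ((div_pos (h.radius_pos l) h.pos).trans_le h3)

variable [NeZero n] {ζs : ℂ}

/-- For the density `Im (c η) - a_l` the solution of the Schwarz problem extends analytically
across the circles. -/
theorem Sep.exists_schwarz_extension (hs : Γ.Sep s) (hst : s < t) (ht : Γ.Sep t)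
    (hf : Γ.FirstClass) (hζs : ζs ∈ Γ.ext) (c : ℂ) (a : Fin n → ℝ) :
    ∃ Φ : ℂ → ℂ, DifferentiableOn ℂ Φ (Γ.hood t) ∧
      Set.EqOn Φ (Γ.schwarz ζs fun l η => (c * η).im - a l) (closure Γ.ext) := by
  have hg := Γ.lipschitzDensity_im_linear c a
  set g : Fin n → ℂ → ℝ := fun l η => (c * η).im - a l with hgdef
  let Φ : ℂ → ℂ := fun z => Γ.linearPotential c z
    + ∑ k, conj (Γ.linearPotentialInside c a k (Γ.T k z))
    + Γ.evenRest g ζs z + conj (Γ.oddRest g ζs z)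
  have hΦ : DifferentiableOn ℂ Φ (Γ.hood t) := by
    refine (DifferentiableOn.add (fun z hz => DifferentiableAt.differentiableWithinAt ?_)
      (hs.differentiableOn_evenRest hst ht hf hg hζs)).add
      (hs.differentiableOn_conj_oddRest hst ht hf hg hζs)
    refine (differentiableAt_linearPotential (ht.ne_center_of_mem_hood hz)).add
      (DifferentiableAt.fun_sum fun k _ => ?_)
    have h3 := (differentiableAt_linearPotentialInside (c := c) (a := a)
      (fun l => ht.T_ne_center_of_mem_hood hz k l) k).conj_conj
    have h4 := differentiableAt_conj_T (ht.ne_center_of_mem_hood hz k)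
    refine (DifferentiableAt.comp z h3 h4).congr_of_eventuallyEq
      (Eventually.of_forall fun y => ?_)
    simp
  refine ⟨Φ, hΦ, ?_⟩
  refine Set.EqOn.of_subset_closure (s := Γ.ext) (fun z hz => ?_)
    (hΦ.continuousOn.mono ht.closure_ext_subset_hood)
    (hs.continuousOn_schwarz hst ht hf hg hζs) subset_closure subset_rfl
  rw [hs.schwarz_of_mem_ext hg hz, hs.potential_im_linear_of_mem_ext hz]
  refine congrArg (fun x => x + _ + _) (congrArg _ (Finset.sum_congr rfl fun k _ => ?_))
  rw [hs.potential_im_linear_of_inside (hs.dist_T_lt_of_mem_ext hz k)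
    (hs.comp_ne_center (subset_closure hz) [k] k)]

end ImLinear

end Circles

end Antiplane

namespace Antiplane

open MeasureTheory Metric
open scoped NNReal

/-! ### The solution of the Schwarz problems -/

theorem _root_.DifferentiableOn.exists_lipschitzOnWith_re {f : ℂ → ℂ} {U K : Set ℂ} (hU : IsOpen U)
    (hf : DifferentiableOn ℂ f U) (hK : IsCompact K) (hKU : K ⊆ U) :
    ∃ C : ℝ≥0, LipschitzOnWith C (fun z => (f z).re) K := by
  have h1 : LocallyLipschitzOn K f := fun x hx => by
    obtain ⟨C, v, hv, h⟩ :=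
      ((hf.contDiffOn (n := 1) hU).contDiffAt (hU.mem_nhds (hKU hx))).exists_lipschitzOnWith
    exact ⟨C, v, mem_nhdsWithin_of_mem_nhds hv, h⟩
  obtain ⟨C, hC⟩ := h1.exists_lipschitzOnWith_of_compact hK
  refine ⟨C, LipschitzOnWith.of_dist_le_mul fun x hx y hy => ?_⟩
  refine le_trans ?_ (hC.dist_le_mul x hx y hy)
  rw [Real.dist_eq, ← Complex.sub_re, dist_eq_norm]
  exact Complex.abs_re_le_norm _

theorem isBigO_one_of_bound {f : ℂ → ℂ} {S : Set ℂ} (hS : IsBounded S) {B : ℝ}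
    (h : ∀ z ∉ S, ‖f z‖ ≤ B) : f =O[cobounded ℂ] (fun _ => (1 : ℝ)) := by
  refine Asymptotics.IsBigO.of_bound B ?_
  filter_upwards [isBounded_def.1 hS] with z hz
  simpa using h z hz

theorem Circles.isBounded_compl_ext {n : ℕ} (Γ : Circles n) : IsBounded (Γ.extᶜ) := by
  refine ((isBounded_iUnion (s := fun j => closedBall (Γ.center j) (Γ.radius j))).2
    fun j => isBounded_closedBall).subset fun z hz => ?_
  simpa [Circles.ext] using hz

namespace Data

variable {n : ℕ} [NeZero n] {P : Data n} {s t : ℝ}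

/-- The analytic function with the boundary values `P.F`. -/
noncomputable def solF (P : Data n) (ζ : ℂ) : ℂ :=
  P.L.c P.c₁ * ζ + P.Γ.schwarz P.ζs P.dens₁ ζ

/-- The analytic function with the boundary values `P.ω`. -/
noncomputable def solω (P : Data n) (ζ : ℂ) : ℂ :=
  P.c₁ * ζ - (P.L.mu : ℂ) / conj P.L.tau * (Complex.I * P.Γ.schwarz P.ζs P.dens₂ ζ)

/-- The circles satisfy the hypotheses of the theorem; `s < t` measure their separation. -/
structure Regular (P : Data n) (s t : ℝ) : Prop where
  sep_left : P.Γ.Sep s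
  lt : s < t
  sep : P.Γ.Sep t
  firstClass : P.Γ.FirstClass
  base : P.ζs ∈ P.Γ.ext

namespace Regular

theorem lipschitz₁ (P : Data n) : P.Γ.LipschitzDensity P.dens₁ :=
  P.Γ.lipschitzDensity_im_linear _ _

theorem solF_eq (h : P.Regular s t) {j : Fin n} {ξ : ℂ} (hξ : ξ ∈ P.Γ.circle j) :
    P.solF ξ = P.F j ξ := by
  rw [solF, F, h.sep_left.schwarz_of_mem_circle h.lt h.sep h.firstClass (lipschitz₁ P) h.base hξ]
  ring

/-- `F` is analytic across the circles. -/
theorem exists_extension (h : P.Regular s t) :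
    ∃ Φ : ℂ → ℂ, DifferentiableOn ℂ Φ (P.Γ.hood t) ∧ Set.EqOn Φ P.solF (closure P.Γ.ext) := by
  obtain ⟨Φ, h1, h2⟩ := h.sep_left.exists_schwarz_extension h.lt h.sep h.firstClass h.base
    (P.L.c P.c₁) P.a
  refine ⟨fun ζ => P.L.c P.c₁ * ζ + Φ ζ, DifferentiableOn.add (by fun_prop) h1,
    fun ζ hζ => congrArg _ (h2 hζ)⟩

/-- F is given by principal values, whose regularity is not evident. On the circles it agrees with a
function analytic in a neighbourhood, and this one is Lipschitz on compact sets. -/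
theorem lipschitz_g (h : P.Regular s t) : P.Γ.LipschitzDensity P.g := fun j => by
  obtain ⟨Φ, h1, h2⟩ := h.exists_extension
  have h3 : DifferentiableOn ℂ (fun ξ => ((P.L.kappa j / (P.L.kappa j - 1) : ℝ) : ℂ) * Φ ξ
      + conj P.L.tau / (P.L.mu : ℂ) * P.c₁ * ξ) (P.Γ.hood t) :=
    (h1.const_mul _).add (by fun_prop)
  obtain ⟨K, hK⟩ := h3.exists_lipschitzOnWith_re (P.Γ.isOpen_hood t)
    (isCompact_sphere (P.Γ.center j) (P.Γ.radius j))
    fun ξ hξ => h.sep.mem_hood_of_mem_circle (j := j) hξ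
  refine ⟨K, LipschitzOnWith.of_dist_le_mul fun x hx y hy => ?_⟩
  have h4 : ∀ ξ ∈ P.Γ.circle j, P.F j ξ = Φ ξ := fun ξ hξ =>
    (h.solF_eq hξ).symm.trans (h2 (Circles.circle_subset_closure_ext h.sep j hξ)).symm
  rw [g, g, h4 x hx, h4 y hy]
  exact hK.dist_le_mul x hx y hy

theorem lipschitz₂ (h : P.Regular s t) : P.Γ.LipschitzDensity P.dens₂ := fun j => by
  obtain ⟨K, hK⟩ := h.lipschitz_g j
  refine ⟨K, LipschitzOnWith.of_dist_le_mul fun x hx y hy => ?_⟩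
  rw [dens₂, dens₂, Real.dist_eq, sub_sub_sub_cancel_right]
  exact hK.dist_le_mul x hx y hy

theorem lipschitz_of_mem (h : P.Regular s t) {g : Fin n → ℂ → ℝ}
    (hg : g ∈ ({P.dens₁, P.dens₂} : Set (Fin n → ℂ → ℝ))) : P.Γ.LipschitzDensity g := by
  rcases hg with rfl | rfl
  exacts [lipschitz₁ P, h.lipschitz₂]

theorem solω_eq (h : P.Regular s t) {j : Fin n} {ξ : ℂ} (hξ : ξ ∈ P.Γ.circle j) :
    P.solω ξ = P.ω j ξ := by
  rw [solω, ω, h.sep_left.schwarz_of_mem_circle h.lt h.sep h.firstClass h.lipschitz₂ h.base hξ]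
  linear_combination (P.L.mu : ℂ) / conj P.L.tau * P.dens₂ j ξ * Complex.I_sq

theorem im_F (h : P.Regular s t) {j : Fin n} {ξ : ℂ} (hξ : ξ ∈ P.Γ.circle j) :
    (P.F j ξ).im = P.a j := by
  have h1 := h.sep_left.im_pvPsi_sub_eq_zero h.lt h.sep h.firstClass h.base
    (G := fun _ η => (P.L.c P.c₁ * η).im) (A := P.a)
    (by simpa using P.Γ.lipschitzDensity_im_linear (P.L.c P.c₁) fun _ => 0) (lipschitz₁ P)
    (fun j hj => by rw [a, if_neg hj, a, if_pos rfl]) hξ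
  have h2 : (fun l η => (P.L.c P.c₁ * η).im - P.a l) = P.dens₁ := rfl
  rw [h2, Complex.sub_im] at h1
  simp only [F, Complex.add_im, Complex.sub_im, Complex.conj_im, Complex.mul_im, Complex.I_re,
    Complex.I_im, Complex.ofReal_re, Complex.ofReal_im, dens₁] at h1 ⊢
  linarith

/-- The factor i turns the vanishing of Im(Ψ₂(ξ) − Ψ₂(T_0ξ)) into the vanishing of the real part
contributed by the principal values. What is left is Re(conj τ c_{-1}ξ/μ) minus the density, and
κ/(κ − 1) = −λ. -/
theorem re_ω (h : P.Regular s t) (hmu : P.L.mu ≠ 0) (hi : ∀ j, P.L.muIncl j ≠ 0)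
    (hne : ∀ j, P.L.muIncl j ≠ P.L.mu) (htau : P.L.tau ≠ 0) {j : Fin n} {ξ : ℂ}
    (hξ : ξ ∈ P.Γ.circle j) :
    (conj P.L.tau / (P.L.mu : ℂ) * P.ω j ξ).re
      = P.L.lam j * ((P.F j ξ).re - (P.L.kappa j - 1) / P.L.kappa j * P.d j) := by
  have h1 := h.sep_left.im_pvPsi_sub_eq_zero h.lt h.sep h.firstClass h.base
    (G := P.g) (A := P.d) h.lipschitz_g h.lipschitz₂
    (fun j hj => by rw [d, if_neg hj, d, if_pos rfl]) hξ
  have h2 : (fun l η => P.g l η - P.d l) = P.dens₂ := rfl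
  rw [h2, Complex.sub_im] at h1
  have hmu' : (P.L.mu : ℂ) ≠ 0 := by exact_mod_cast hmu
  have htau' : conj P.L.tau ≠ 0 := by simpa using htau
  have h3 : conj P.L.tau / (P.L.mu : ℂ) * P.ω j ξ = conj P.L.tau / (P.L.mu : ℂ) * P.c₁ * ξ
      - ((P.dens₂ j ξ : ℂ) + Complex.I * P.Γ.pvPsi P.ζs P.dens₂ ξ ξ
      + Complex.I * conj (P.Γ.pvPsi P.ζs P.dens₂ (P.Γ.T 0 ξ) ξ)) := by
    rw [ω]
    field_simp
  have hk0 : P.L.kappa j ≠ 0 := div_ne_zero (hi j) hmu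
  have hk1 : P.L.kappa j - 1 ≠ 0 := fun h0 => hne j (by
    rw [Loading.kappa, sub_eq_zero, div_eq_one_iff_eq hmu] at h0
    exact h0)
  have hk2 : 1 - P.L.kappa j ≠ 0 := fun h0 => hk1 (by linarith)
  have h4 : P.dens₂ j ξ = P.L.kappa j / (P.L.kappa j - 1) * (P.F j ξ).re
      + (conj P.L.tau / (P.L.mu : ℂ) * P.c₁ * ξ).re - P.d j := by
    rw [dens₂, g, Complex.add_re, Complex.re_ofReal_mul]
  rw [h3, Complex.sub_re, Complex.add_re, Complex.add_re, Complex.ofReal_re, h4]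
  simp only [Complex.mul_re Complex.I, Complex.I_re, Complex.I_im, Complex.conj_re,
    Complex.conj_im]
  rw [Loading.lam, show P.L.kappa j / (P.L.kappa j - 1) = -(P.L.kappa j / (1 - P.L.kappa j)) by
    rw [← div_neg, neg_sub]]
  have h5 : P.L.kappa j / (1 - P.L.kappa j) * ((P.L.kappa j - 1) / P.L.kappa j * P.d j)
      = - P.d j := by
    field_simp
    ring
  rw [mul_sub, h5]
  linarith

theorem solvesSchwarz (h : P.Regular s t) (hmu : P.L.mu ≠ 0) (hi : ∀ j, P.L.muIncl j ≠ 0)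
    (hne : ∀ j, P.L.muIncl j ≠ P.L.mu) (htau : P.L.tau ≠ 0) :
    SolvesSchwarz P.L P.Γ P.c₁ P.a (fun j => (P.L.kappa j - 1) / P.L.kappa j * P.d j)
      P.solF P.solω where
  F_analytic := DifferentiableOn.add (by fun_prop)
    (h.sep_left.differentiableOn_schwarz h.lt h.sep h.firstClass (lipschitz₁ P) h.base)
  F_continuous := ContinuousOn.add (by fun_prop)
    (h.sep_left.continuousOn_schwarz h.lt h.sep h.firstClass (lipschitz₁ P) h.base)
  ω_analytic := DifferentiableOn.sub (by fun_prop)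
    (((h.sep_left.differentiableOn_schwarz h.lt h.sep h.firstClass h.lipschitz₂
      h.base).const_mul _).const_mul _)
  ω_continuous := ContinuousOn.sub (by fun_prop) (continuousOn_const.mul (continuousOn_const.mul
    (h.sep_left.continuousOn_schwarz h.lt h.sep h.firstClass h.lipschitz₂ h.base)))
  F_boundary j ξ hξ := by rw [h.solF_eq hξ, h.im_F hξ]
  ω_boundary j ξ hξ := by rw [h.solω_eq hξ, h.solF_eq hξ, h.re_ω hmu hi hne htau hξ]
  F_infinity := by
    obtain ⟨B, hB⟩ := h.sep_left.exists_schwarz_bound h.lt h.sep h.firstClass (lipschitz₁ P) h.base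
    refine isBigO_one_of_bound P.Γ.isBounded_compl_ext (B := B) fun z hz => ?_
    rw [solF, add_sub_cancel_left]
    exact hB z (subset_closure (not_not.1 hz))
  ω_infinity := by
    obtain ⟨B, hB⟩ := h.sep_left.exists_schwarz_bound h.lt h.sep h.firstClass h.lipschitz₂ h.base
    refine isBigO_one_of_bound P.Γ.isBounded_compl_ext
      (B := ‖(P.L.mu : ℂ) / conj P.L.tau * Complex.I‖ * B) fun z hz => ?_
    rw [solω, sub_sub_cancel_left, norm_neg, ← mul_assoc, norm_mul]
    exact mul_le_mul_of_nonneg_left (hB z (subset_closure (not_not.1 hz))) (norm_nonneg _)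

end Regular

end Data

end Antiplane

namespace Antiplane

open MeasureTheory Metric
open scoped NNReal

/-! ### Uniqueness -/

/-- A bounded open set in the plane whose frontier lies on finitely many horizontal lines is
empty. -/
theorem eq_empty_of_im_frontier_finite {V : Set ℂ} (hV : IsOpen V) (hb : IsBounded V) {A : Set ℝ}
    (hA : A.Finite) (h : ∀ w ∈ frontier V, w.im ∈ A) : V = ∅ := by
  by_contra hne
  obtain ⟨w₁, hw₁⟩ := Set.nonempty_iff_ne_empty.2 hne
  -- The heights of a nonempty open set are infinitely many, so some horizontal line through V
  -- misses the frontier.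
  have h1 : (Complex.im '' V).Infinite :=
    infinite_of_mem_nhds w₁.im ((Complex.isOpenMap_im V hV).mem_nhds ⟨w₁, hw₁, rfl⟩)
  obtain ⟨y, ⟨w₀, hw₀, rfl⟩, hy⟩ := h1.exists_notMem_finite hA
  let l : ℝ → ℂ := fun x => ⟨x, w₀.im⟩
  have hl : Continuous l := by
    have : l = fun x : ℝ => (x : ℂ) + w₀.im * Complex.I := by
      funext x; exact Complex.ext (by simp [l]) (by simp [l])
    rw [this]; fun_prop
  -- On such a line V is open and closed, hence is the whole line, against boundedness.
  have hclopen : IsClopen (l ⁻¹' V) := by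
    refine ⟨?_, hV.preimage hl⟩
    refine isClosed_of_closure_subset fun x hx => ?_
    have h2 : l x ∈ closure V := hl.closure_preimage_subset V hx
    by_contra h3
    refine hy (h (l x) ?_)
    rw [hV.frontier_eq]
    exact ⟨h2, h3⟩
  have h4 : l ⁻¹' V = Set.univ := by
    rcases isClopen_iff.1 hclopen with h5 | h5
    · have : w₀.re ∈ l ⁻¹' V := hw₀
      rw [h5] at this
      exact this.elim
    · exact h5
  obtain ⟨R, hR⟩ := hb.exists_norm_le
  have h5 : l (|R| + 1) ∈ V := by
    have : |R| + 1 ∈ l ⁻¹' V := h4 ▸ Set.mem_univ _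
    exact this
  have h6 := (Complex.abs_re_le_norm _).trans (hR _ h5)
  simp only [l] at h6
  have h7 := le_abs_self (|R| + 1)
  have h8 := le_abs_self R
  linarith

/-- A function that is analytic and bounded near infinity has a limit there. -/
theorem exists_tendsto_cobounded {f : ℂ → ℂ} {U : Set ℂ} (hU : U ∈ cobounded ℂ)
    (hf : DifferentiableOn ℂ f U) (hUo : IsOpen U)
    (hb : f =O[cobounded ℂ] (fun _ => (1 : ℝ))) :
    ∃ b : ℂ, Tendsto f (cobounded ℂ) (𝓝 b) := by
  have h1 : Tendsto (fun w : ℂ => w⁻¹) (𝓝[≠] 0) (cobounded ℂ) := tendsto_inv₀_nhdsNE_zero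
  -- In the variable w = 1/z, infinity becomes a removable singularity.
  have h2 : ∀ᶠ w in 𝓝[≠] (0 : ℂ), DifferentiableAt ℂ (fun w => f w⁻¹) w := by
    filter_upwards [h1 hU, self_mem_nhdsWithin] with w hw hw0
    exact ((hf.differentiableAt (hUo.mem_nhds hw)).comp w (differentiableAt_inv hw0))
  obtain ⟨C, hC⟩ := hb.bound
  have h3 : IsBoundedUnder (· ≤ ·) (𝓝[≠] (0 : ℂ)) fun w => ‖f w⁻¹ - (fun w => f w⁻¹) 0‖ := by
    refine ⟨C + ‖(fun w : ℂ => f w⁻¹) 0‖, ?_⟩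
    rw [eventually_map]
    filter_upwards [h1 hC] with w hw
    refine (norm_sub_le _ _).trans (add_le_add ?_ le_rfl)
    simpa using hw
  have h4 := Complex.tendsto_limUnder_of_differentiable_on_punctured_nhds_of_bounded_under h2 h3
  refine ⟨_, (h4.comp Filter.tendsto_inv₀_cobounded').congr fun w => ?_⟩
  simp

namespace Circles

variable {n : ℕ} {Γ : Circles n} {t : ℝ}

/-- A map that opens up the centres of the circles to their discs. -/
noncomputable def inflate (Γ : Circles n) (t : ℝ) (z : ℂ) : ℂ :=
  z + ∑ j, ((max 0 (Γ.radius j - t * dist z (Γ.center j)) / dist z (Γ.center j) : ℝ) : ℂ)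
    * (z - Γ.center j)

theorem continuousAt_inflate {z : ℂ} (hz : ∀ k, z ≠ Γ.center k) :
    ContinuousAt (Γ.inflate t) z := by
  unfold inflate
  refine continuousAt_id.add (tendsto_finsetSum _ fun j _ => ?_)
  have h1 : ContinuousAt (fun z => max 0 (Γ.radius j - t * dist z (Γ.center j))
      / dist z (Γ.center j)) z :=
    ContinuousAt.div (by fun_prop) (by fun_prop) (dist_ne_zero.2 (hz j))
  exact (Complex.continuous_ofReal.continuousAt.comp h1).mul (by fun_prop)

theorem Sep.inflate_of_le (h : Γ.Sep t) {z : ℂ} {j : Fin n}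
    (hz : dist z (Γ.center j) ≤ Γ.radius j / t) : Γ.inflate t z = z
      + (((Γ.radius j - t * dist z (Γ.center j)) / dist z (Γ.center j) : ℝ) : ℂ)
        * (z - Γ.center j) := by
  rw [inflate, Finset.sum_eq_single j, max_eq_right]
  · have := (le_div_iff₀ h.pos).1 hz
    linarith
  · intro k _ hkj
    have := (div_le_iff₀ h.pos).1 (h.lt_dist_of_ne (Ne.symm hkj) hz)
    rw [max_eq_left (by linarith)]
    simp
  · simp

theorem inflate_of_forall_le {z : ℂ} (ht : 0 < t)
    (hz : ∀ j, Γ.radius j / t ≤ dist z (Γ.center j)) : Γ.inflate t z = z := by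
  rw [inflate, Finset.sum_eq_zero, add_zero]
  intro k _
  have := (div_le_iff₀ ht).1 (hz k)
  rw [max_eq_left (by linarith)]
  simp

/-- The map is radial, ρ ↦ r_j + (1 − t)ρ for ρ ≤ r_j/t. It opens the punctured centre to radius r_j
and fixes the circle ρ = r_j/t, beyond which nothing moves. -/
theorem Sep.inflate_sub_center (h : Γ.Sep t) {z : ℂ} {j : Fin n} (hzj : z ≠ Γ.center j)
    (hz : dist z (Γ.center j) ≤ Γ.radius j / t) : Γ.inflate t z - Γ.center j
      = ((Γ.radius j + (1 - t) * dist z (Γ.center j) : ℝ) : ℂ)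
        * ((z - Γ.center j) / (dist z (Γ.center j) : ℝ)) := by
  have h0 : ((dist z (Γ.center j) : ℝ) : ℂ) ≠ 0 := by
    exact_mod_cast dist_ne_zero.2 hzj
  rw [h.inflate_of_le hz]
  push_cast
  field_simp
  ring

theorem Sep.inflate_mem_ext (h : Γ.Sep t) {z : ℂ} (hz : ∀ k, z ≠ Γ.center k) :
    Γ.inflate t z ∈ Γ.ext := by
  by_cases h1 : ∃ j, dist z (Γ.center j) ≤ Γ.radius j / t
  · obtain ⟨j, hj⟩ := h1
    have h0 := dist_pos.2 (hz j)
    have ht := h.lt_one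
    have hr := h.radius_pos j
    have h2 : dist (Γ.inflate t z) (Γ.center j) = Γ.radius j + (1 - t) * dist z (Γ.center j) := by
      rw [dist_eq_norm, h.inflate_sub_center (hz j) hj, norm_mul, norm_div, Complex.norm_real,
        Complex.norm_real, ← dist_eq_norm, Real.norm_of_nonneg h0.le, div_self h0.ne', mul_one,
        Real.norm_of_nonneg (by nlinarith)]
    intro k
    by_cases hkj : k = j
    · subst hkj
      rw [h2]
      nlinarith
    · have h3 : dist (Γ.inflate t z) (Γ.center j) ≤ Γ.radius j / t := by
        rw [h2]
        have : (1 - t) * dist z (Γ.center j) ≤ (1 - t) * (Γ.radius j / t) :=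
          mul_le_mul_of_nonneg_left hj (by linarith)
        have h4 : (1 - t) * (Γ.radius j / t) = Γ.radius j / t - Γ.radius j := by
          have := h.pos.ne'
          field_simp
        linarith
      exact (h.radius_lt_div k).trans_le (h.lt_dist_of_ne (Ne.symm hkj) h3)
  · push Not at h1
    rw [inflate_of_forall_le h.pos fun j => (h1 j).le]
    exact fun j => (h.radius_lt_div j).trans (h1 j)

theorem Sep.exists_inflate_eq (h : Γ.Sep t) {w : ℂ} (hw : w ∈ Γ.ext) :
    ∃ z, (∀ k, z ≠ Γ.center k) ∧ Γ.inflate t z = w := by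
  by_cases h1 : ∃ j, dist w (Γ.center j) ≤ Γ.radius j / t
  · obtain ⟨j, hj⟩ := h1
    have ht : 0 < 1 - t := by linarith [h.lt_one]
    have ht0 := h.pos
    have hr := h.radius_pos j
    set d := dist w (Γ.center j) with hd
    have hd0 : 0 < d := hr.trans (hw j)
    set m := (d - Γ.radius j) / (1 - t) with hm
    have hm0 : 0 < m := div_pos (sub_pos.2 (hw j)) ht
    have hdC : (d : ℂ) ≠ 0 := by exact_mod_cast hd0.ne'
    have hmC : (m : ℂ) ≠ 0 := by exact_mod_cast hm0.ne'
    let z : ℂ := Γ.center j + ((m / d : ℝ) : ℂ) * (w - Γ.center j)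
    have hzj : dist z (Γ.center j) = m := by
      rw [dist_eq_norm, show z - Γ.center j = ((m / d : ℝ) : ℂ) * (w - Γ.center j) by
        simp only [z]; ring, norm_mul, ← dist_eq_norm, ← hd, Complex.norm_real,
        Real.norm_of_nonneg (div_pos hm0 hd0).le]
      field_simp
    have hmle : m ≤ Γ.radius j / t := by
      rw [hm, div_le_div_iff₀ ht ht0]
      have := (le_div_iff₀ ht0).1 hj
      linarith
    have hne : z ≠ Γ.center j := dist_pos.1 (hzj ▸ hm0)
    refine ⟨z, fun k => ?_, ?_⟩
    · by_cases hkj : k = j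
      · exact hkj ▸ hne
      · exact dist_pos.1 ((div_pos (h.radius_pos k) ht0).trans_le
          (h.lt_dist_of_ne (Ne.symm hkj) (hzj.trans_le hmle)))
    · rw [← sub_left_inj (a := Γ.center j), h.inflate_sub_center hne (hzj.trans_le hmle), hzj]
      have h2 : Γ.radius j + (1 - t) * m = d := by
        rw [hm]; field_simp; ring
      rw [h2]
      simp only [z]
      push_cast
      field_simp
      ring
  · push Not at h1
    refine ⟨w, fun k => ?_, inflate_of_forall_le h.pos fun j => (h1 j).le⟩
    exact dist_pos.1 ((h.radius_pos k).trans (hw k))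

/-- The exterior is a continuous image of the plane without the finitely many centres, which is
connected. -/
theorem Sep.isPreconnected_ext (h : Γ.Sep t) : IsPreconnected Γ.ext := by
  have h1 : IsPreconnected ((Set.range Γ.center)ᶜ) :=
    ((Set.finite_range Γ.center).countable.isConnected_compl_of_one_lt_rank (by
      rw [Complex.rank_real_complex]; norm_num)).isPreconnected
  have h2 : Γ.inflate t '' (Set.range Γ.center)ᶜ = Γ.ext := by
    have h3 : ∀ z ∈ (Set.range Γ.center)ᶜ, ∀ k, z ≠ Γ.center k := fun z hz k hk => hz ⟨k, hk.symm⟩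
    refine Set.Subset.antisymm ?_ fun w hw => ?_
    · rintro _ ⟨z, hz, rfl⟩
      exact h.inflate_mem_ext (h3 z hz)
    · obtain ⟨z, hz, rfl⟩ := h.exists_inflate_eq hw
      exact ⟨z, fun ⟨k, hk⟩ => hz k hk.symm, rfl⟩
  rw [← h2]
  exact h1.image _ fun z hz => (continuousAt_inflate fun k hk => hz ⟨k, hk.symm⟩).continuousWithinAt

theorem ext_mem_cobounded (Γ : Circles n) : Γ.ext ∈ cobounded ℂ := by
  have := isBounded_def.1 Γ.isBounded_compl_ext
  rwa [compl_compl] at this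

/-- An analytic function in the exterior of the circles that is bounded at infinity and whose
imaginary part is constant on each circle is constant. -/
theorem Sep.eq_const_of_im_const (h : Γ.Sep t) {f : ℂ → ℂ} (hf : DifferentiableOn ℂ f Γ.ext)
    (hc : ContinuousOn f (closure Γ.ext)) {a : Fin n → ℝ}
    (ha : ∀ j, ∀ ξ ∈ Γ.circle j, (f ξ).im = a j)
    (hb : f =O[cobounded ℂ] (fun _ => (1 : ℝ))) :
    ∃ b : ℂ, ∀ ζ ∈ closure Γ.ext, f ζ = b := by
  suffices ∃ b : ℂ, ∀ ζ ∈ Γ.ext, f ζ = b by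
    obtain ⟨b, hb⟩ := this
    exact ⟨b, fun ζ hζ => Set.EqOn.of_subset_closure (g := fun _ => b) hb hc continuousOn_const
      subset_closure subset_rfl hζ⟩
  obtain ⟨b, hlim⟩ := exists_tendsto_cobounded Γ.ext_mem_cobounded hf Γ.isOpen_ext hb
  rcases (hf.analyticOnNhd Γ.isOpen_ext).is_constant_or_isOpen h.isPreconnected_ext with h1 | h1
  · exact h1
  exfalso
  have hV := h1 Γ.ext subset_rfl Γ.isOpen_ext
  have hne : Γ.ext.Nonempty := nonempty_of_mem Γ.ext_mem_cobounded
  have hcpt : ∀ R, IsCompact (f '' (closure Γ.ext ∩ closedBall 0 R)) := fun R =>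
    ((isCompact_closedBall 0 R).inter_left isClosed_closure).image_of_continuousOn
      (hc.mono Set.inter_subset_left)
  have hbdd : IsBounded (f '' Γ.ext) := by
    obtain ⟨C, hC⟩ := hb.bound
    obtain ⟨R, hR⟩ := (hasBasis_cobounded_norm (E := ℂ)).mem_iff.1 hC
    refine ((hcpt R).isBounded.union (isBounded_closedBall (x := (0 : ℂ)) (r := C))).subset ?_
    rintro _ ⟨z, hz, rfl⟩
    by_cases hzR : ‖z‖ ≤ R
    · exact Or.inl ⟨z, ⟨subset_closure hz, by simpa using hzR⟩, rfl⟩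
    · right
      have := hR.2 (show z ∈ {x | R ≤ ‖x‖} from (not_le.1 hzR).le)
      simpa using this
  -- The admissible heights are the constants a_j and the imaginary part of the limit b at infinity.
  refine (hne.image f).ne_empty (eq_empty_of_im_frontier_finite hV hbdd
    ((Set.finite_range a).insert b.im) fun w hw => ?_)
  rw [hV.frontier_eq] at hw
  obtain ⟨hw1, hw2⟩ := hw
  by_contra hwA
  have hwb : w ≠ b := fun h0 => hwA (h0 ▸ Set.mem_insert _ _)
  obtain ⟨u, v, hu, hv, huv⟩ := t2_separation_nhds hwb
  obtain ⟨R, -, hR⟩ := (hasBasis_cobounded_norm (E := ℂ)).mem_iff.1 (hlim hv)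
  -- Near infinity f is near b ≠ w, so w is a limit of values on a bounded part of the exterior and,
  -- by compactness, a value on its closure. As w is not in the open image, it is taken on a circle.
  have h2 : w ∈ closure (f '' (closure Γ.ext ∩ closedBall 0 R)) := by
    rw [mem_closure_iff_nhds] at hw1 ⊢
    intro O hO
    obtain ⟨_, hx, z, hz, rfl⟩ := hw1 (O ∩ u) (inter_mem hO hu)
    refine ⟨f z, hx.1, z, ⟨subset_closure hz, ?_⟩, rfl⟩
    by_contra hzR
    have h3 : f z ∈ v := hR (show R ≤ ‖z‖ by
      simp only [mem_closedBall, dist_zero_right, not_le] at hzR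
      exact hzR.le)
    exact huv.le_bot ⟨hx.2, h3⟩
  rw [(hcpt R).isClosed.closure_eq] at h2
  obtain ⟨z, ⟨hz, -⟩, rfl⟩ := h2
  rw [h.closure_ext_eq] at hz
  rcases hz with hz | hz
  · exact hw2 ⟨z, hz, rfl⟩
  · obtain ⟨j, hj⟩ := mem_contour.1 hz
    exact hwA (Or.inr ⟨j, (ha j z hj).symm⟩)

end Circles

/-- Once F is fixed up to a constant b, multiplication by i turns the condition on Re(conj τ(ω −
ω')/μ) into one on an imaginary part, with constants λ_j(Re b − d_j + d'_j), so the same rigidity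
applies twice. -/
theorem SolvesSchwarz.unique {n : ℕ} {L : Loading n} {Γ : Circles n} {t : ℝ} (h : Γ.Sep t) {c₁ : ℂ}
    {a d a' d' : Fin n → ℝ} {F ω F' ω' : ℂ → ℂ} (hmu : L.mu ≠ 0) (htau : L.tau ≠ 0)
    (h1 : SolvesSchwarz L Γ c₁ a d F ω) (h2 : SolvesSchwarz L Γ c₁ a' d' F' ω') :
    (∃ b : ℂ, ∀ ζ ∈ closure Γ.ext, F ζ = F' ζ + b) ∧
      ∃ b : ℂ, ∀ ζ ∈ closure Γ.ext, ω ζ = ω' ζ + b := by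
  have hF : ∃ b : ℂ, ∀ ζ ∈ closure Γ.ext, F ζ = F' ζ + b := by
    obtain ⟨b, hb⟩ := h.eq_const_of_im_const (f := fun ζ => F ζ - F' ζ)
      (a := fun j => a j - a' j) (h1.F_analytic.sub h2.F_analytic)
      (h1.F_continuous.sub h2.F_continuous)
      (fun j ξ hξ => by rw [Complex.sub_im, h1.F_boundary j ξ hξ, h2.F_boundary j ξ hξ])
      (by simpa using h1.F_infinity.sub h2.F_infinity)
    exact ⟨b, fun ζ hζ => by rw [← hb ζ hζ]; ring⟩
  refine ⟨hF, ?_⟩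
  obtain ⟨b, hb⟩ := hF
  set q : ℂ := conj L.tau / (L.mu : ℂ) with hq
  have hq0 : Complex.I * q ≠ 0 := mul_ne_zero Complex.I_ne_zero
    (div_ne_zero (by simpa using htau) (by exact_mod_cast hmu))
  obtain ⟨e, he⟩ := h.eq_const_of_im_const (f := fun ζ => Complex.I * q * (ω ζ - ω' ζ))
    (a := fun j => L.lam j * (b.re - d j + d' j))
    ((h1.ω_analytic.sub h2.ω_analytic).const_mul _)
    (continuousOn_const.mul (h1.ω_continuous.sub h2.ω_continuous))
    (fun j ξ hξ => by
      have e1 := h1.ω_boundary j ξ hξ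
      have e2 := h2.ω_boundary j ξ hξ
      rw [hb ξ (Circles.circle_subset_closure_ext h j hξ), Complex.add_re] at e1
      rw [mul_assoc, Complex.I_mul_im, mul_sub, Complex.sub_re, hq, e1, e2]
      ring)
    (by simpa using (h1.ω_infinity.sub h2.ω_infinity).const_mul_left (Complex.I * q))
  refine ⟨e / (Complex.I * q), fun ζ hζ => ?_⟩
  rw [← he ζ hζ, mul_div_cancel_left₀ _ hq0]
  ring

end Antiplane

namespace Antiplane

open MeasureTheory Metric
open scoped NNReal

/-! ### Uniformly stressed inclusions -/

theorem Loading.fderiv_inclDisplacement {n : ℕ} (L : Loading n) (j : Fin n) (d : ℝ) (z ν : ℂ) :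
    fderiv ℝ (L.inclDisplacement j d) z ν = (conj L.tau * ν).re / L.muIncl j := by
  have h1 : L.inclDisplacement j d = fun z =>
      (L.tau.re * Complex.reCLM z + L.tau.im * Complex.imCLM z) / L.muIncl j + d := rfl
  have h2 : HasFDerivAt (L.inclDisplacement j d)
      ((L.muIncl j)⁻¹ • (L.tau.re • Complex.reCLM + L.tau.im • Complex.imCLM)) z := by
    rw [h1]
    have := ((((Complex.reCLM.hasFDerivAt (x := z)).const_mul L.tau.re).add
      ((Complex.imCLM.hasFDerivAt (x := z)).const_mul L.tau.im)).mul_const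
        (L.muIncl j)⁻¹).add_const d
    simpa [div_eq_mul_inv] using this
  rw [h2.fderiv]
  simp [Complex.mul_re]
  ring

theorem Loading.inclDisplacement_eq {n : ℕ} (L : Loading n) (j : Fin n) (d : ℝ) (z : ℂ) :
    L.inclDisplacement j d z = (conj L.tau * z).re / L.muIncl j + d := by
  simp [Loading.inclDisplacement, Complex.mul_re]

/-- In terms of `φ - conj τ z / μ`, the traction condition says that its imaginary part is
stationary along the contour. -/
theorem Loading.traction_iff {n : ℕ} (L : Loading n) (hmu : L.mu ≠ 0) {j : Fin n}
    (hi : L.muIncl j ≠ 0) (d : ℝ) (z v φ' : ℂ) :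
    L.mu * (φ' * (-Complex.I * v)).re
        = L.muIncl j * fderiv ℝ (L.inclDisplacement j d) z (-Complex.I * v)
      ↔ (v * φ' - conj L.tau / (L.mu : ℂ) * v).im = 0 := by
  rw [L.fderiv_inclDisplacement, mul_div_cancel₀ _ hi]
  have h1 : conj L.tau / (L.mu : ℂ) * v = ((L.mu⁻¹ : ℝ) : ℂ) * (conj L.tau * v) := by
    push_cast; ring
  have h2 : ∀ x : ℂ, (x * (-Complex.I * v)).re = (x * v).im := fun x => by
    simp [Complex.mul_re, Complex.mul_im, add_comm]
  rw [h1, Complex.sub_im, Complex.im_ofReal_mul, h2, h2, mul_comm v φ', sub_eq_zero,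
    eq_inv_mul_iff_mul_eq₀ hmu]

/-- A continuous map tending to infinity at infinity is proper, so near any given w only a compact
piece of S matters. -/
theorem isClosed_image_of_tendsto_cobounded {ω : ℂ → ℂ} {S : Set ℂ} (hS : IsClosed S)
    (hc : ContinuousOn ω S) (h : Tendsto ω (cobounded ℂ) (cobounded ℂ)) : IsClosed (ω '' S) := by
  refine isClosed_of_closure_subset fun w hw => ?_
  obtain ⟨R, -, hR⟩ := (hasBasis_cobounded_norm (E := ℂ)).mem_iff.1
    (h (isBounded_def.1 (isBounded_ball (x := w) (r := 1))))
  have hcpt : IsCompact (ω '' (S ∩ closedBall 0 R)) :=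
    ((isCompact_closedBall 0 R).inter_left hS).image_of_continuousOn (hc.mono Set.inter_subset_left)
  refine Set.image_mono Set.inter_subset_left (hcpt.isClosed.closure_eq ▸ ?_ :
    w ∈ ω '' (S ∩ closedBall 0 R))
  rw [mem_closure_iff_nhds] at hw ⊢
  intro O hO
  obtain ⟨_, hx, z, hz, rfl⟩ := hw (O ∩ ball w 1) (inter_mem hO (ball_mem_nhds w one_pos))
  refine ⟨ω z, hx.1, z, ⟨hz, ?_⟩, rfl⟩
  by_contra hzR
  rw [mem_closedBall, dist_zero_right, not_le] at hzR
  exact hR (show R ≤ ‖z‖ from hzR.le) hx.2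

theorem tendsto_cobounded_of_isBigO {ω : ℂ → ℂ} {c₁ : ℂ} (hc₁ : c₁ ≠ 0)
    (h : (fun ζ => ω ζ - c₁ * ζ) =O[cobounded ℂ] (fun _ => (1 : ℝ))) :
    Tendsto ω (cobounded ℂ) (cobounded ℂ) := by
  obtain ⟨C, hC⟩ := h.bound
  rw [← tendsto_norm_atTop_iff_cobounded]
  have h1 := tendsto_norm_atTop_iff_cobounded.2 (tendsto_mul_left_cobounded (α := ℂ) hc₁)
  refine tendsto_atTop_mono' _ ?_ (tendsto_atTop_add_const_right _ (-C) h1)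
  filter_upwards [hC] with z hz
  have h2 := norm_sub_norm_le (c₁ * z) (c₁ * z - ω z)
  rw [sub_sub_cancel] at h2
  rw [norm_sub_rev, norm_one, mul_one] at hz
  linarith

theorem hasDerivAt_im {p : ℝ → ℂ} {v : ℂ} {θ : ℝ} (h : HasDerivAt p v θ) :
    HasDerivAt (fun θ => (p θ).im) v.im θ :=
  Complex.imCLM.hasFDerivAt.comp_hasDerivAt θ h

namespace IsConformalMap

variable {n : ℕ} {Γ : Circles n} {D : Fin n → Set ℂ} {c₁ : ℂ} {ω : ℂ → ℂ} {t : ℝ}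

theorem continuousOn (hω : IsConformalMap Γ D c₁ ω) : ContinuousOn ω (closure Γ.ext) := by
  obtain ⟨ω', -, h⟩ := hω.regular
  exact fun ζ hζ => (h ζ hζ).2.continuousWithinAt

theorem differentiableOn (hω : IsConformalMap Γ D c₁ ω) : DifferentiableOn ℂ ω Γ.ext := by
  obtain ⟨ω', -, h⟩ := hω.regular
  exact fun ζ hζ => ((h ζ (subset_closure hζ)).2.mono subset_closure).differentiableWithinAt

theorem tendsto_cobounded (hω : IsConformalMap Γ D c₁ ω) (hc₁ : c₁ ≠ 0) :
    Tendsto ω (cobounded ℂ) (cobounded ℂ) := tendsto_cobounded_of_isBigO hc₁ hω.infinity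

theorem image_closure (hω : IsConformalMap Γ D c₁ ω) (hc₁ : c₁ ≠ 0) :
    ω '' closure Γ.ext = closure (matrixRegion D) := by
  refine Set.Subset.antisymm ?_ ?_
  · rw [← hω.image_ext]
    exact hω.continuousOn.image_closure
  · refine closure_minimal ?_ (isClosed_image_of_tendsto_cobounded isClosed_closure
      hω.continuousOn (hω.tendsto_cobounded hc₁))
    rw [← hω.image_ext]
    exact Set.image_mono subset_closure

theorem mapsTo (hω : IsConformalMap Γ D c₁ ω) (hc₁ : c₁ ≠ 0) :
    Set.MapsTo ω (closure Γ.ext) (closure (matrixRegion D)) := fun _ hζ =>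
  hω.image_closure hc₁ ▸ Set.mem_image_of_mem ω hζ

theorem frontier_subset (hω : IsConformalMap Γ D c₁ ω) (hc₁ : c₁ ≠ 0) (h : Γ.Sep t) (j : Fin n) :
    frontier (D j) ⊆ closure (matrixRegion D) := by
  rw [← hω.image_circle, ← hω.image_closure hc₁]
  exact Set.image_mono (Circles.circle_subset_closure_ext h j)

/-- The potential of an antiplane state yields a solution of the Schwarz problems. -/
theorem solvesSchwarz_of_isAntiplaneState (hω : IsConformalMap Γ D c₁ ω) (hc₁ : c₁ ≠ 0)
    (h : Γ.Sep t) {L : Loading n} (hmu : L.mu ≠ 0) (hi : ∀ j, L.muIncl j ≠ 0)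
    (hne : ∀ j, L.muIncl j ≠ L.mu) {d : Fin n → ℝ} {φ φ' : ℂ → ℂ}
    (hφ : IsAntiplaneState L D d φ φ') :
    ∃ a, SolvesSchwarz L Γ c₁ a d (fun ζ => φ (ω ζ) - conj L.tau / (L.mu : ℂ) * ω ζ) ω := by
  obtain ⟨ω', hω'c, hω'⟩ := hω.regular
  set q : ℂ := conj L.tau / (L.mu : ℂ) with hq
  have hmuC : (L.mu : ℂ) ≠ 0 := by exact_mod_cast hmu
  have hF : ∀ ζ ∈ closure Γ.ext, HasDerivWithinAt (fun ζ => φ (ω ζ) - q * ω ζ)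
      (φ' (ω ζ) * ω' ζ - q * ω' ζ) (closure Γ.ext) ζ := fun ζ hζ =>
    ((hφ.hasDeriv _ (hω.mapsTo hc₁ hζ)).comp ζ (hω' ζ hζ).2 (hω.mapsTo hc₁)).sub
      ((hω' ζ hζ).2.const_mul q)
  have hconst : ∀ j θ, ((fun θ : ℝ => (φ (ω (circleMap (Γ.center j) (Γ.radius j) θ))
      - q * ω (circleMap (Γ.center j) (Γ.radius j) θ)).im) θ)
      = (φ (ω (circleMap (Γ.center j) (Γ.radius j) 0))
      - q * ω (circleMap (Γ.center j) (Γ.radius j) 0)).im := by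
    intro j θ
    have hmem : ∀ θ, circleMap (Γ.center j) (Γ.radius j) θ ∈ Γ.circle j := fun θ =>
      circleMap_mem_sphere _ (h.radius_pos j).le θ
    have hmemX := fun θ => Circles.circle_subset_closure_ext h j (hmem θ)
    have hp : ∀ θ, HasDerivAt (fun θ => ω (circleMap (Γ.center j) (Γ.radius j) θ))
        ((circleMap 0 (Γ.radius j) θ * Complex.I)
          • ω' (circleMap (Γ.center j) (Γ.radius j) θ)) θ := fun θ =>
      (hω' _ (hmemX θ)).2.scomp_hasDerivAt θ (hasDerivAt_circleMap _ _ θ) hmemX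
    set p : ℝ → ℂ := fun θ => ω (circleMap (Γ.center j) (Γ.radius j) θ) with hpdef
    have hpf : ∀ θ, p θ ∈ frontier (D j) := fun θ => by
      rw [← hω.image_circle j]
      exact ⟨_, hmem θ, rfl⟩
    set v : ℝ → ℂ := fun θ => (circleMap 0 (Γ.radius j) θ * Complex.I)
          • ω' (circleMap (Γ.center j) (Γ.radius j) θ)
    -- Along the parametrized contour the velocity is tangent, and rotated by −i it is an admissible
    -- normal. The traction condition then makes the imaginary part of φ − conj(τ)z/μ stationary,
    -- hence constant on each contour.
    have hG : ∀ θ, HasDerivAt (fun θ => (φ (p θ) - q * p θ).im) 0 θ := fun θ => by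
      have e1 : HasDerivAt (fun θ => φ (p θ)) (v θ • φ' (p θ)) θ :=
        (hφ.hasDeriv _ (hω.mapsTo hc₁ (hmemX θ))).scomp_hasDerivAt θ (hp θ)
          fun θ => hω.mapsTo hc₁ (hmemX θ)
      have e2 := hasDerivAt_im (e1.sub ((hp θ).const_mul q))
      have e3 : IsNormalVector (frontier (D j)) (p θ) (-Complex.I * v θ) := by
        refine ⟨fun s => p (θ + s), v θ, fun s => hpf _, by simp, ?_, rfl⟩
        have e4 : HasDerivAt p (v θ) (θ + 0) := by rw [add_zero]; exact hp θ
        exact e4.comp_const_add θ 0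
      have e5 := (L.traction_iff hmu (hi j) (d j) (p θ) (v θ) (φ' (p θ))).1
        (hφ.traction j (p θ) (hpf θ) _ e3)
      have e6 : (v θ • φ' (p θ) - q * v θ).im = 0 := e5
      rwa [← e6]
    exact is_const_of_deriv_eq_zero (fun θ => (hG θ).differentiableAt) (fun θ => (hG θ).deriv) θ 0
  refine ⟨fun j => (φ (ω (circleMap (Γ.center j) (Γ.radius j) 0))
      - q * ω (circleMap (Γ.center j) (Γ.radius j) 0)).im, ?_⟩
  refine
    { F_analytic := fun ζ hζ => ((hF ζ (subset_closure hζ)).mono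
        subset_closure).differentiableWithinAt
      F_continuous := fun ζ hζ => (hF ζ hζ).continuousWithinAt
      ω_analytic := hω.differentiableOn
      ω_continuous := hω.continuousOn
      F_boundary := fun j ξ hξ => ?_
      ω_boundary := fun j ξ hξ => ?_
      F_infinity := ?_
      ω_infinity := hω.infinity }
  · have h1 : ξ ∈ Set.range (circleMap (Γ.center j) (Γ.radius j)) := by
      rw [range_circleMap, abs_of_pos (h.radius_pos j)]
      exact hξ
    obtain ⟨θ, rfl⟩ := h1
    exact hconst j θ
  · have h1 := hφ.displacement j (ω ξ) (by rw [← hω.image_circle j]; exact ⟨ξ, hξ, rfl⟩)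
    rw [L.inclDisplacement_eq] at h1
    have h2 : (q * ω ξ).re = (conj L.tau * ω ξ).re / L.mu := by
      rw [hq, show conj L.tau / (L.mu : ℂ) * ω ξ = ((L.mu⁻¹ : ℝ) : ℂ) * (conj L.tau * ω ξ) by
        push_cast; ring, Complex.re_ofReal_mul]
      ring
    have h3 : L.mu - L.muIncl j ≠ 0 := sub_ne_zero.2 (hne j).symm
    rw [Complex.sub_re, h1, h2, Loading.lam, Loading.kappa]
    have h4 := hi j
    have h5 : 1 - L.muIncl j / L.mu ≠ 0 := by
      rw [one_sub_div hmu]; exact div_ne_zero h3 hmu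
    field_simp
    ring
  · obtain ⟨b, hb⟩ := hφ.infinity
    have h1 := (hb.comp (hω.tendsto_cobounded hc₁)).isBigO_one ℝ
    have h2 := h1.add (hω.infinity.const_mul_left ((conj L.tauInf - conj L.tau) / (L.mu : ℂ)))
    refine h2.congr_left fun ζ => ?_
    simp only [Function.comp, Loading.c, hq]
    ring

/-- The inverse of the conformal map is continuous up to the contours. -/
theorem continuousOn_invFunOn (hω : IsConformalMap Γ D c₁ ω) (hc₁ : c₁ ≠ 0) :
    ContinuousOn (Function.invFunOn ω (closure Γ.ext)) (closure (matrixRegion D)) := by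
  set ψ := Function.invFunOn ω (closure Γ.ext)
  rw [← hω.image_closure hc₁]
  rintro _ ⟨ζ, hζ, rfl⟩
  have hψ : ∀ z ∈ closure Γ.ext, ψ (ω z) = z := fun z hz => hω.injOn.leftInvOn_invFunOn hz
  rw [ContinuousWithinAt, hψ ζ hζ, _root_.tendsto_nhds]
  intro O hO hζO
  -- Properness makes ω a closed map. Injectivity keeps ω(ζ) out of the image of the complement of
  -- O, so nearby values come from O.
  have hcl : IsClosed (ω '' (closure Γ.ext \ O)) := isClosed_image_of_tendsto_cobounded
    (isClosed_closure.sdiff hO) (hω.continuousOn.mono Set.sdiff_subset)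
    (hω.tendsto_cobounded hc₁)
  have hmem : ω ζ ∉ ω '' (closure Γ.ext \ O) := by
    rintro ⟨z, hz, hzζ⟩
    exact hz.2 (hω.injOn hz.1 hζ hzζ ▸ hζO)
  filter_upwards [self_mem_nhdsWithin, mem_nhdsWithin_of_mem_nhds (hcl.isOpen_compl.mem_nhds hmem)]
    with w hw hw2
  obtain ⟨z, hz, rfl⟩ := hw
  by_contra h3
  rw [Set.mem_preimage, hψ z hz] at h3
  exact hw2 ⟨z, ⟨hz, h3⟩, rfl⟩

theorem invFunOn_apply (hω : IsConformalMap Γ D c₁ ω) {ζ : ℂ} (hζ : ζ ∈ closure Γ.ext) :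
    Function.invFunOn ω (closure Γ.ext) (ω ζ) = ζ := hω.injOn.leftInvOn_invFunOn hζ

/-- A solution of the Schwarz problems that is regular up to the circles yields an antiplane
state. -/
theorem uniformlyStressed (hω : IsConformalMap Γ D c₁ ω) (hD : IsInclusionFamily D)
    (hc₁ : c₁ ≠ 0) (h : Γ.Sep t) {L : Loading n} (hmu : L.mu ≠ 0) (hi : ∀ j, L.muIncl j ≠ 0)
    (hne : ∀ j, L.muIncl j ≠ L.mu) {a d : Fin n → ℝ} {F Φ : ℂ → ℂ}
    (hs : SolvesSchwarz L Γ c₁ a d F ω) {U : Set ℂ} (hU : IsOpen U) (hXU : closure Γ.ext ⊆ U)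
    (hΦ : DifferentiableOn ℂ Φ U) (hΦF : Set.EqOn Φ F (closure Γ.ext)) :
    UniformlyStressed L D := by
  obtain ⟨ω', hω'c, hω'⟩ := hω.regular
  set q : ℂ := conj L.tau / (L.mu : ℂ) with hq
  have hmuC : (L.mu : ℂ) ≠ 0 := by exact_mod_cast hmu
  set ψ := Function.invFunOn ω (closure Γ.ext) with hψdef
  have hψc : ContinuousOn ψ (closure (matrixRegion D)) := hω.continuousOn_invFunOn hc₁
  have hψ : ∀ ζ ∈ closure Γ.ext, ψ (ω ζ) = ζ := fun ζ hζ => hω.invFunOn_apply hζ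
  have hmaps : Set.MapsTo ψ (closure (matrixRegion D)) (closure Γ.ext) := by
    rw [← hω.image_closure hc₁]
    rintro _ ⟨ζ, hζ, rfl⟩
    rwa [hψ ζ hζ]
  have hinv : ∀ z ∈ closure (matrixRegion D), ω (ψ z) = z := by
    rw [← hω.image_closure hc₁]
    rintro _ ⟨ζ, hζ, rfl⟩
    rw [hψ ζ hζ]
  have hψd : ∀ z ∈ closure (matrixRegion D),
      HasDerivWithinAt ψ (ω' (ψ z))⁻¹ (closure (matrixRegion D)) z := by
    intro z hz
    obtain ⟨h1, h2⟩ := hω' (ψ z) (hmaps hz)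
    have h3 : HasFDerivWithinAt ω (ContinuousLinearEquiv.unitsEquivAut ℂ
        (Units.mk0 (ω' (ψ z)) h1) : ℂ →L[ℂ] ℂ) (closure Γ.ext) (ψ z) := h2.hasFDerivWithinAt
    exact (h3.of_local_left_inverse ((hψc z hz).tendsto_nhdsWithin hmaps) hz
      (eventually_of_mem self_mem_nhdsWithin hinv)).hasDerivWithinAt.congr_deriv (by simp)
  have hderiv : ∀ z ∈ closure (matrixRegion D), HasDerivWithinAt (fun z => Φ (ψ z) + q * z)
      (deriv Φ (ψ z) * (ω' (ψ z))⁻¹ + q) (closure (matrixRegion D)) z := by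
    intro z hz
    have h1 := (hΦ.differentiableAt (hU.mem_nhds (hXU (hmaps hz)))).hasDerivAt
    have h2 := (h1.comp_hasDerivWithinAt z (hψd z hz)).add
      ((hasDerivWithinAt_id z (closure (matrixRegion D))).const_mul q)
    rw [mul_one] at h2
    exact h2
  have hcirc : ∀ j, ∀ z ∈ frontier (D j), ψ z ∈ Γ.circle j ∧ z ∈ closure (matrixRegion D) := by
    intro j z hz
    refine ⟨?_, hω.frontier_subset hc₁ h j hz⟩
    rw [← hω.image_circle j] at hz
    obtain ⟨ξ, hξ, rfl⟩ := hz
    rwa [hψ ξ (Circles.circle_subset_closure_ext h j hξ)]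
  -- The potential is recovered by undoing F = φ∘ω − conj(τ)ω/μ. Using the continuation Φ in place
  -- of F supplies a derivative that is continuous up to the contours.
  refine ⟨d, fun z => Φ (ψ z) + q * z, fun z => deriv Φ (ψ z) * (ω' (ψ z))⁻¹ + q,
    ⟨hderiv, ?_, ?_, ?_, ?_⟩⟩
  · refine ContinuousOn.add (ContinuousOn.mul ?_ (ContinuousOn.inv₀ (hω'c.comp hψc hmaps)
      fun z hz => (hω' _ (hmaps hz)).1)) continuousOn_const
    exact (hΦ.deriv hU).continuousOn.comp hψc (hmaps.mono_right hXU)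
  · intro j z hz
    obtain ⟨h1, h2⟩ := hcirc j z hz
    have h3 := hs.ω_boundary j (ψ z) h1
    rw [hinv z h2, ← hq, ← hΦF (hmaps h2)] at h3
    rw [L.inclDisplacement_eq, Complex.add_re, h3]
    have h4 : (q * z).re = (conj L.tau * z).re / L.mu := by
      rw [hq, show conj L.tau / (L.mu : ℂ) * z = ((L.mu⁻¹ : ℝ) : ℂ) * (conj L.tau * z) by
        push_cast; ring, Complex.re_ofReal_mul]
      ring
    rw [h3, Loading.lam, Loading.kappa] at h4
    rw [Loading.lam, Loading.kappa]
    have h5 : L.mu - L.muIncl j ≠ 0 := sub_ne_zero.2 (hne j).symm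
    have h6 := hi j
    have h7 : 1 - L.muIncl j / L.mu ≠ 0 := by
      rw [one_sub_div hmu]; exact div_ne_zero h5 hmu
    have h8 : (conj L.tau * z).re = L.mu * (L.muIncl j / L.mu / (1 - L.muIncl j / L.mu)
        * ((Φ (ψ z)).re - d j)) := by
      rw [h4]; field_simp
    rw [h8]
    field_simp
    ring
  · rintro j z hz ν ⟨p, v, hp, rfl, hv, rfl⟩
    rw [L.traction_iff hmu (hi j)]
    have e1 : HasDerivAt (fun s => Φ (ψ (p s)) + q * p s)
        (v • (deriv Φ (ψ (p 0)) * (ω' (ψ (p 0)))⁻¹ + q)) 0 :=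
      (hderiv _ (hcirc j _ hz).2).scomp_hasDerivAt 0 hv fun s => (hcirc j _ (hp s)).2
    have e2 := hasDerivAt_im (e1.sub (hv.const_mul q))
    -- Im F is constant on the circle, so Im(φ − conj(τ)z/μ) is constant along any curve in the
    -- contour. This gives the traction condition for every normal so defined.
    have e3 : (fun s => (Φ (ψ (p s)) + q * p s - q * p s).im) = fun _ => a j := by
      funext s
      obtain ⟨h1, h2⟩ := hcirc j _ (hp s)
      rw [add_sub_cancel_right, hΦF (hmaps h2), hs.F_boundary j _ h1]
    have e4 : HasDerivAt (fun s => (Φ (ψ (p s)) + q * p s - q * p s).im) 0 0 := by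
      rw [e3]; exact hasDerivAt_const _ _
    exact e2.unique e4
  · obtain ⟨b₁, hb₁⟩ := exists_tendsto_cobounded (f := fun ζ => F ζ - L.c c₁ * ζ) Γ.ext_mem_cobounded
      (DifferentiableOn.sub hs.F_analytic (by fun_prop : DifferentiableOn ℂ (L.c c₁ * ·) Γ.ext))
      Γ.isOpen_ext hs.F_infinity
    obtain ⟨b₂, hb₂⟩ := exists_tendsto_cobounded (f := fun ζ => ω ζ - c₁ * ζ) Γ.ext_mem_cobounded
      (DifferentiableOn.sub hs.ω_analytic (by fun_prop : DifferentiableOn ℂ (c₁ * ·) Γ.ext))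
      Γ.isOpen_ext hs.ω_infinity
    have hY : closure (matrixRegion D) ∈ cobounded ℂ := by
      have h1 : IsBounded (⋃ j, closure (D j)) := isBounded_iUnion.2 fun j => (hD.isBounded j).closure
      exact mem_of_superset (isBounded_def.1 h1) subset_closure
    have hψt : Tendsto ψ (cobounded ℂ) (cobounded ℂ) := by
      refine (hasBasis_cobounded_norm (E := ℂ)).tendsto_right_iff.2 fun R _ => ?_
      have h1 : IsCompact (ω '' (closure Γ.ext ∩ closedBall 0 R)) :=
        ((isCompact_closedBall 0 R).inter_left isClosed_closure).image_of_continuousOn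
          (hω.continuousOn.mono Set.inter_subset_left)
      filter_upwards [hY, isBounded_def.1 h1.isBounded] with z hz hz2
      by_contra h3
      refine hz2 ⟨ψ z, ⟨hmaps hz, ?_⟩, hinv z hz⟩
      rw [mem_closedBall, dist_zero_right]
      exact (not_le.1 h3).le
    refine ⟨b₁ - (conj L.tauInf - conj L.tau) / (L.mu : ℂ) * b₂, ?_⟩
    refine ((hb₁.comp hψt).sub ((hb₂.comp hψt).const_mul _)).congr' ?_
    filter_upwards [hY] with z hz
    simp only [Function.comp, hinv z hz, Loading.c, hq]
    rw [hΦF (hmaps hz)]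
    ring

end IsConformalMap

namespace Data.Regular

variable {n : ℕ} [NeZero n] {P : Data n} {s t : ℝ}

theorem uniformlyStressed_iff (h : P.Regular s t) (hmu : P.L.mu ≠ 0)
    (hi : ∀ j, P.L.muIncl j ≠ 0) (hne : ∀ j, P.L.muIncl j ≠ P.L.mu) (htau : P.L.tau ≠ 0)
    (hc₁ : P.c₁ ≠ 0) {D : Fin n → Set ℂ} {ω : ℂ → ℂ} (hD : IsInclusionFamily D)
    (hω : IsConformalMap P.Γ D P.c₁ ω) :
    UniformlyStressed P.L D ↔ ∃ b : ℂ, ∀ j, ∀ ξ ∈ P.Γ.circle j, ω ξ = P.ω j ξ + b := by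
  have hsol := h.solvesSchwarz hmu hi hne htau
  constructor
  · rintro ⟨d, φ, φ', hφ⟩
    obtain ⟨a, ha⟩ := hω.solvesSchwarz_of_isAntiplaneState hc₁ h.sep hmu hi hne hφ
    obtain ⟨b, hb⟩ := (ha.unique h.sep hmu htau hsol).2
    exact ⟨b, fun j ξ hξ => by
      rw [hb ξ (Circles.circle_subset_closure_ext h.sep j hξ), h.solω_eq hξ]⟩
  · rintro ⟨b, hb⟩
    obtain ⟨Φ, hΦ, hΦF⟩ := h.exists_extension
    set q : ℂ := conj P.L.tau / (P.L.mu : ℂ) with hq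
    have hlam : ∀ j, P.L.lam j ≠ 0 := fun j => by
      have hk : P.L.kappa j ≠ 0 := div_ne_zero (hi j) hmu
      refine div_ne_zero hk fun h0 => hne j ?_
      have : P.L.kappa j = 1 := by linarith
      rwa [Loading.kappa, div_eq_one_iff_eq hmu] at this
    -- The translation b adds Re(conj(τ)b/μ) to the boundary values of Re(conj(τ)ω/μ), which is
    -- absorbed by shifting d_j' by that amount over λ_j. This needs λ_j ≠ 0.
    refine hω.uniformlyStressed hD hc₁ h.sep hmu hi hne
      (a := P.a) (d := fun j => (P.L.kappa j - 1) / P.L.kappa j * P.d j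
        - (q * b).re / P.L.lam j) (F := P.solF) ?_
      (P.Γ.isOpen_hood t) h.sep.closure_ext_subset_hood hΦ hΦF
    exact
      { F_analytic := hsol.F_analytic
        F_continuous := hsol.F_continuous
        ω_analytic := hω.differentiableOn
        ω_continuous := hω.continuousOn
        F_boundary := hsol.F_boundary
        ω_boundary := fun j ξ hξ => by
          have h1 := hsol.ω_boundary j ξ hξ
          rw [← hq] at h1 ⊢
          rw [hb j ξ hξ, ← h.solω_eq hξ, mul_add, Complex.add_re, h1]
          have := hlam j
          field_simp
          ring
        F_infinity := hsol.F_infinity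
        ω_infinity := hω.infinity }

end Data.Regular

end Antiplane

namespace Antiplane

/-! ### The free parameters -/

/-- There are (card α)^m words of length m, so the sum is a geometric series of ratio card α · q. -/
theorem _root_.summable_pow_length {α : Type*} [Fintype α] {q : ℝ} (hq : 0 ≤ q)
    (hq' : Fintype.card α * q < 1) : Summable fun w : List α => q ^ w.length := by
  rw [← List.equivSigmaTuple.symm.summable_iff, summable_sigma_of_nonneg fun _ => by
    simp only [Function.comp]; positivity]
  refine ⟨fun _ => Summable.of_finite, ?_⟩
  refine (summable_geometric_of_lt_one (by positivity) hq').congr fun m => ?_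
  simp [tsum_fintype, List.equivSigmaTuple, mul_pow]

namespace Circles

variable {n : ℕ} {Γ : Circles n} {t : ℝ}

/-- Circles that are far apart have a Schottky group of the first class. -/
theorem Sep.firstClass (h : Γ.Sep t) (ht : n * t ^ 2 < 1) : Γ.FirstClass := by
  obtain ⟨C, hC0, hC⟩ : ∃ C, 0 ≤ C ∧ ∀ k, Γ.radius k ^ 2 ≤ C :=
    ⟨∑ k, Γ.radius k ^ 2, Finset.sum_nonneg fun _ _ => sq_nonneg _, fun k =>
      Finset.single_le_sum (f := fun k => Γ.radius k ^ 2) (fun _ _ => sq_nonneg _)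
        (Finset.mem_univ k)⟩
  -- The majorant runs over all words, reduced or not. The factor C/t² corrects for the first letter
  -- used, which contributes a squared radius instead of a factor t².
  have h1 : Summable fun w : List (Fin n) => (t ^ 2) ^ w.length :=
    summable_pow_length (sq_nonneg t) (by simpa using ht)
  have h2 : Summable fun w : {w : SchottkyWord n // w.1 ≠ []} =>
      C / t ^ 2 * (t ^ 2) ^ w.1.1.length :=
    (h1.mul_left (C / t ^ 2)).comp_injective
      (i := fun w : {w : SchottkyWord n // w.1 ≠ []} => w.1.1)
      fun _ _ hw => Subtype.ext (Subtype.ext hw)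
  refine Summable.of_nonneg_of_le (fun w => by positivity) (fun w => ?_) h2
  rw [norm_det_compMatrix, (compMatrix_col Γ w.1.1).2]
  obtain ⟨⟨w, hw, -⟩, hne⟩ := w
  obtain ⟨k, v, rfl⟩ := List.exists_cons_of_ne_nil hne
  refine (h.isoRad_le_pow hC v k hw).trans (le_of_eq ?_)
  have := h.pos.ne'
  rw [List.length_cons, pow_succ (t ^ 2)]
  generalize (t ^ 2) ^ v.length = x
  field_simp

end Circles

theorem finrank_freeParams {n : ℕ} (hn : 2 ≤ n) : Module.finrank ℝ (FreeParams n) = 3 * n - 4 := by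
  rw [Module.finrank_prod, Module.finrank_prod, Module.finrank_pi,
    Module.finrank_pi_fintype]
  simp only [Complex.finrank_real_complex, Module.finrank_self, Fintype.card_fin,
    Finset.sum_const, Finset.card_univ, smul_eq_mul]
  omega

theorem continuous_circlesOf_center {n : ℕ} (z₀ : ℂ) (r₀ y₁ : ℝ) (j : Fin n) :
    Continuous fun p : FreeParams n => (circlesOf z₀ r₀ y₁ p).center j := by
  simp only [circlesOf]
  split_ifs
  · exact continuous_const
  · fun_prop
  · have h1 : ∀ x : ℝ, (⟨x, y₁⟩ : ℂ) = x + y₁ * Complex.I := fun x =>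
      Complex.ext (by simp) (by simp)
    simp only [h1]
    fun_prop

theorem continuous_circlesOf_radius {n : ℕ} (z₀ : ℂ) (r₀ y₁ : ℝ) (j : Fin n) :
    Continuous fun p : FreeParams n => (circlesOf z₀ r₀ y₁ p).radius j := by
  simp only [circlesOf]
  split_ifs
  · fun_prop
  · exact continuous_const

/-- Equal circles whose centres have the abscissas `Re z₀ + j M`. -/
theorem exists_freeParams {n : ℕ} (z₀ : ℂ) (r₀ y₁ M : ℝ) :
    ∃ p : FreeParams n, ∀ j, (circlesOf z₀ r₀ y₁ p).radius j = r₀ ∧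
      ((circlesOf z₀ r₀ y₁ p).center j).re = z₀.re + j * M := by
  refine ⟨⟨fun _ => r₀, z₀.re + M, fun i => ⟨z₀.re + (i.1 + 2) * M, 0⟩⟩, fun j => ⟨?_, ?_⟩⟩
  · simp only [circlesOf]
    split_ifs <;> rfl
  · simp only [circlesOf]
    split_ifs with h1 h2
    · simp [h1]
    · simp only
      rw [Nat.cast_sub h2]
      push_cast
      ring
    · have : j.1 = 1 := by omega
      simp [this]

/-- Strict separation with one fixed small ratio t is an open condition on the parameters and, by
`Sep.firstClass`, suffices. It remains to exhibit one such configuration. -/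
theorem interior_firstClass_nonempty {n : ℕ} (hn : 2 ≤ n) (z₀ : ℂ) {r₀ : ℝ} (y₁ : ℝ)
    (hr₀ : 0 < r₀) :
    (interior {p : FreeParams n |
      (circlesOf z₀ r₀ y₁ p).Valid ∧ (circlesOf z₀ r₀ y₁ p).FirstClass}).Nonempty := by
  have hn' : (2 : ℝ) ≤ n := by exact_mod_cast hn
  -- With this choice n t = 1/2, so n t² = t/2 < 1.
  set t : ℝ := 1 / (2 * n) with ht
  have ht0 : 0 < t := by positivity
  have ht1 : t < 1 := by
    rw [ht, div_lt_one (by positivity)]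
    linarith
  have htn : n * t ^ 2 < 1 := by
    have : n * t = 1 / 2 := by rw [ht]; field_simp
    nlinarith
  let S : Set (FreeParams n) := {p | (∀ j, 0 < (circlesOf z₀ r₀ y₁ p).radius j) ∧
    ∀ j k, j ≠ k → (circlesOf z₀ r₀ y₁ p).radius j + (circlesOf z₀ r₀ y₁ p).radius k
      < t * dist ((circlesOf z₀ r₀ y₁ p).center j) ((circlesOf z₀ r₀ y₁ p).center k)}
  have hcc := continuous_circlesOf_center (n := n) z₀ r₀ y₁
  have hcr := continuous_circlesOf_radius (n := n) z₀ r₀ y₁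
  have hS : IsOpen S := by
    have h1 : S = (⋂ j, {p | 0 < (circlesOf z₀ r₀ y₁ p).radius j}) ∩ ⋂ (j) (k), ⋂ (_ : j ≠ k),
        {p | (circlesOf z₀ r₀ y₁ p).radius j + (circlesOf z₀ r₀ y₁ p).radius k
          < t * dist ((circlesOf z₀ r₀ y₁ p).center j) ((circlesOf z₀ r₀ y₁ p).center k)} := by
      ext p
      simp [S]
    rw [h1]
    refine IsOpen.inter (isOpen_iInter_of_finite fun j => isOpen_lt continuous_const (hcr j))
      (isOpen_iInter_of_finite fun j => isOpen_iInter_of_finite fun k =>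
        isOpen_iInter_of_finite fun _ => isOpen_lt ((hcr j).add (hcr k))
          (continuous_const.mul ((hcc j).dist (hcc k))))
  have hsub : S ⊆ {p : FreeParams n |
      (circlesOf z₀ r₀ y₁ p).Valid ∧ (circlesOf z₀ r₀ y₁ p).FirstClass} := by
    rintro p ⟨h1, h2⟩
    have hsep : (circlesOf z₀ r₀ y₁ p).Sep t := ⟨ht0, ht1, h1, fun j k hjk => (h2 j k hjk).le⟩
    refine ⟨⟨h1, fun j k hjk => (h2 j k hjk).trans_le ?_⟩, hsep.firstClass htn⟩
    exact mul_le_of_le_one_left dist_nonneg ht1.le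
  refine Set.Nonempty.mono (interior_maximal hsub hS) ?_
  -- For the spacing M = 2r₀/t + 1 of the abscissas, t·M = 2r₀ + t exceeds the sum 2r₀ of two radii,
  -- whatever the imaginary parts are.
  obtain ⟨p, hp⟩ := exists_freeParams (n := n) z₀ r₀ y₁ (2 * r₀ / t + 1)
  refine ⟨p, fun j => hr₀.trans_eq (hp j).1.symm, fun j k hjk => ?_⟩
  rw [(hp j).1, (hp k).1]
  have hM : 0 < 2 * r₀ / t + 1 := by positivity
  have h3 : 2 * r₀ / t + 1 ≤ dist ((circlesOf z₀ r₀ y₁ p).center j)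
      ((circlesOf z₀ r₀ y₁ p).center k) := by
    rw [dist_eq_norm]
    refine le_trans ?_ (Complex.abs_re_le_norm _)
    rw [Complex.sub_re, (hp j).2, (hp k).2, add_sub_add_left_eq_sub, ← sub_mul, abs_mul,
      abs_of_pos hM]
    refine le_mul_of_one_le_left hM.le ?_
    have h4 : ((j.1 : ℤ) - (k.1 : ℤ)) ≠ 0 := fun h0 => hjk (Fin.ext (by omega))
    have h5 := Int.one_le_abs h4
    exact_mod_cast h5
  have h4 : t * (2 * r₀ / t + 1) = 2 * r₀ + t := by field_simp
  nlinarith [mul_le_mul_of_nonneg_left h3 ht0.le]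

end Antiplane

/-! ### Assembly of the claims -/

theorem mainTheorem1 (n : ℕ) [NeZero n] :
    (∀ P : Antiplane.Data n,
      0 < P.L.mu → (∀ j, 0 < P.L.muIncl j) → (∀ j, P.L.muIncl j ≠ P.L.mu) → P.L.tau ≠ 0 →
      P.Γ.Valid → P.Γ.FirstClass → P.ζs ∈ P.Γ.ext → P.c₁ ≠ 0 →
        -- the kernel series converges absolutely
        (∀ (v : List (Fin n)), ∀ ζ ∈ closure P.Γ.ext, ∀ l, ∀ η ∈ P.Γ.circle l,
          Summable fun w => ‖P.Γ.kernelTerm P.ζs (P.Γ.comp v ζ) η w‖) ∧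
        -- the principal values exist
        (∀ j, ∀ ξ ∈ P.Γ.circle j, ∀ ζ ∈ ({ξ, P.Γ.T 0 ξ} : Set ℂ),
          ∀ g ∈ ({P.dens₁, P.dens₂} : Set (Fin n → ℂ → ℝ)),
          Tendsto (P.Γ.truncPsi P.ζs g ζ ξ) (𝓝[>] (0 : ℝ)) (𝓝 (P.Γ.pvPsi P.ζs g ζ ξ))) ∧
        -- the closed form gives a solution of the Schwarz problems
        (∃ F ω : ℂ → ℂ,
          Antiplane.SolvesSchwarz P.L P.Γ P.c₁ P.a
            (fun j => (P.L.kappa j - 1) / P.L.kappa j * P.d j) F ω ∧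
          ∀ j, ∀ ξ ∈ P.Γ.circle j, F ξ = P.F j ξ ∧ ω ξ = P.ω j ξ) ∧
        -- every solution of the Schwarz problems is given by it, up to additive constants
        (∀ (a d : Fin n → ℝ) (F ω : ℂ → ℂ), Antiplane.SolvesSchwarz P.L P.Γ P.c₁ a d F ω →
          (∃ b : ℂ, ∀ j, ∀ ξ ∈ P.Γ.circle j, F ξ = P.F j ξ + b) ∧
          ∃ b : ℂ, ∀ j, ∀ ξ ∈ P.Γ.circle j, ω ξ = P.ω j ξ + b) ∧
        -- a conformal map onto the exterior of inclusions has these boundary values, up to a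
        -- translation, if and only if the inclusions are uniformly stressed
        (∀ (D : Fin n → Set ℂ) (ω : ℂ → ℂ), Antiplane.IsInclusionFamily D →
          Antiplane.IsConformalMap P.Γ D P.c₁ ω →
          (Antiplane.UniformlyStressed P.L D ↔
            ∃ b : ℂ, ∀ j, ∀ ξ ∈ P.Γ.circle j, ω ξ = P.ω j ξ + b))) ∧
    -- the family has `3n - 4` free real parameters
    (2 ≤ n →
      Module.finrank ℝ (Antiplane.FreeParams n) = 3 * n - 4 ∧
      ∀ (z₀ : ℂ) (r₀ y₁ : ℝ), 0 < r₀ →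
        (interior {p : Antiplane.FreeParams n |
          (Antiplane.circlesOf z₀ r₀ y₁ p).Valid ∧
          (Antiplane.circlesOf z₀ r₀ y₁ p).FirstClass}).Nonempty) := by
  refine ⟨fun P hmu hi hne htau hv hf hζs hc₁ => ?_, fun hn =>
    ⟨Antiplane.finrank_freeParams hn, fun z₀ r₀ y₁ hr₀ =>
      Antiplane.interior_firstClass_nonempty hn z₀ y₁ hr₀⟩⟩
  obtain ⟨s, hs⟩ := hv.exists_sep
  obtain ⟨t, hst, ht⟩ := hs.exists_mid
  have h : P.Regular s t := ⟨hs, hst, ht, hf, hζs⟩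
  have hi' : ∀ j, P.L.muIncl j ≠ 0 := fun j => (hi j).ne'
  have hsol := h.solvesSchwarz hmu.ne' hi' hne htau
  refine ⟨fun v ζ hζ l η hη => ?_, ?_, ?_, ?_, ?_⟩
  · exact hs.summable_norm_kernelTerm hζs
      (hs.summable_orbit_even hf hζ (subset_closure hζs) v) (P.Γ.circle_subset_contour l hη)
  · rintro j ξ hξ ζ (rfl | rfl) g hg
    · exact (hs.tendsto_pvPsi hst ht hf (h.lipschitz_of_mem hg) hζs hξ).1
    · exact (hs.tendsto_pvPsi_T hst ht hf (h.lipschitz_of_mem hg) hζs hξ).1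
  · exact ⟨P.solF, P.solω, hsol, fun j ξ hξ => ⟨h.solF_eq hξ, h.solω_eq hξ⟩⟩
  · intro a d F ω hFω
    obtain ⟨⟨b, hb⟩, b', hb'⟩ := hFω.unique hs hmu.ne' htau hsol
    have hX := fun j => Antiplane.Circles.circle_subset_closure_ext hs j
    exact ⟨⟨b, fun j ξ hξ => by rw [hb ξ (hX j hξ), h.solF_eq hξ]⟩,
      b', fun j ξ hξ => by rw [hb' ξ (hX j hξ), h.solω_eq hξ]⟩
  · exact fun D ω hD hω => h.uniformlyStressed_iff hmu.ne' hi' hne htau hc₁ hD hω
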